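/- Let $c\colon\{1,2,3,\dots\}\to[0,\infty)$ be bounded and not identically zero. For coprime integers $1\le u<v$ write $u/v=[a_1,\dots,a_k]=1/(a_1+1/(a_2+\cdots+1/a_k))$ with integers $a_i\ge1$ and $a_k\ge2$, and put $C(u/v)=\sum_{i=1}^k c(a_i)$. For $n\ge0$ let $\Omega_n$ be the set of pairs of integers $(u,v)$ with $1\le u<v\le n$ and $\gcd(u,v)=1$. Let $T(x)=\frac1x-\lfloor\frac1x\rfloor$, $\xi(z)=\frac{1}{(\log 2)(1+z)}$, $$\mathfrak h(T)=\int_0^1\log|T'(x)|\,\xi(x)\,dx,\qquad \mu=\frac{2}{\mathfrak h(T)}\sum_{n=1}^\infty c(n)\int_{1/(n+1)}^{1/n}\xi(x)\,dx .$$ Let $\mathbb D=\{z\in\mathbb C:|z-\frac23|<1\}$ and let $H^\infty(\mathbb D)$ be the Banach space of bounded holomorphic functions on $\mathbb D$ with the supremum norm. For $s,\omega\in\mathbb C$ with $\Re(s)>\frac12$ and $\Re(2s+\mu\omega)>1$ define bounded operators on $H^\infty(\mathbb D)$ by $$(\mathcal L_{s,\omega}f)(z)=\sum_{n=1}^\infty\frac{e^{\omega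 c(n)}}{(z+n)^{2s+\mu\omega}}f\Big(\frac1{z+n}\Big),\qquad (\mathcal F_{s,\omega}f)(z)=\sum_{n=2}^\infty\frac{e^{\omega c(n)}}{(z+n)^{2s+\mu\omega}}f\Big(\frac1{z+n}\Big).$$ There are an open set $\mathcal V\subset\mathbb C^2$ containing $(1,0)$, on which these operators are defined, and holomorphic functions $\lambda$ (complex-valued) and $\mathcal P,\mathcal N$ (with values in the bounded operators on $H^\infty(\mathbb D)$) on $\mathcal V$ such that, for all $(s,\omega)\in\mathcal V$, $\mathcal L_{s,\omega}=\lambda(s,\omega)\mathcal P_{s,\omega}+\mathcal N_{s,\omega}$, $\mathcal P_{s,\omega}\mathcal N_{s,\omega}=\mathcal N_{s,\omega}\mathcal P_{s,\omega}=0$, $\mathcal P_{s,\omega}$ is a projection whose range is one-dimensional and equals the eigenspace $\ker(\mathcal L_{s,\omega}-\lambda(s,\omega))$, and $\mathcal N_{s,\omega}$ has spectral radius less than $1$; moreover $\lambda(1,0)=1$ and $\mathcal P_{1,0}f=\big(\int_0^1f(x)\,dx\big)\xi$ for all $f$. For any such data, $\mathfrak f_0:=(\mathcal F_{1,0}\mathcal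 P_{1,0}\mathbf 1)(0)$ and $\sigma^2:=\frac{2}{\mathfrak h(T)}\frac{\partial^2\lambda}{\partial\omega^2}(1,0)$ are positive real numbers; let $\sigma>0$ be the square root of $\sigma^2$. For every integer $p\ge0$ the Dirichlet series $$D_p(s)=\sum_{n=1}^\infty\frac1{n^{2s}}\sum_{(u,v)\in\Omega_n\setminus\Omega_{n-1}}\big(C(u/v)-\mu\log v\big)^p$$ converges absolutely for $\Re(s)>1$ and extends holomorphically to (a neighbourhood of every point of) $\{s:\Re(s)\ge1,\ s\ne1\}$. If $p$ is odd, the extension has at $s=1$ at most a pole, of order not greater than $(p+1)/2$. If $p$ is even, there are complex numbers $a_1,\dots,a_{p/2}$ and a function $R$, holomorphic on a neighbourhood of $\{s:\Re(s)\ge1\}$, such that for $\Re(s)>1$ $$D_p(s)=\frac{p!\,\sigma^p\,\mathfrak f_0}{2^p\,\mathfrak h(T)\,(s-1)^{1+p/2}}+\sum_{k=1}^{p/2}\frac{a_k}{(s-1)^k}+R(s).$$ -/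

import Mathlib

open scoped BoundedContinuousFunction

noncomputable section

namespace EuclidCost

/-! ### Continued fractions, the cost function, and the sets of coprime pairs -/

/-- Digits of the continued fraction of `u / v`, produced by the Euclidean algorithm:
one digit `q = ⌊v / u⌋` for each division step `(u, v) ↦ (v - q u, u)`. -/
def cfDigits : ℕ → ℕ → List ℕ
  | 0, _ => []
  | (u + 1), v => v / (u + 1) :: cfDigits (v % (u + 1)) (u + 1)
termination_by u => u
decreasing_by exact Nat.mod_lt _ (Nat.succ_pos u)

/-- The rational number `[a₁, …, aₙ] = 1 / (a₁ + 1 / (a₂ + ⋯ + 1 / aₙ))`. -/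
def cfValue : List ℕ → ℚ
  | [] => 0
  | a :: l => 1 / (a + cfValue l)

/-- `cfDigits u v` is the continued fraction expansion of `u / v` with all digits positive and
last digit at least `2`. -/
theorem cfDigits_spec (u v : ℕ) (hu : 0 < u) (huv : u < v) :
    cfValue (cfDigits u v) = (u : ℚ) / v ∧ (∀ a ∈ cfDigits u v, 1 ≤ a) ∧
      ∃ a ∈ (cfDigits u v).getLast?, 2 ≤ a := by
  induction u using Nat.strong_induction_on generalizing v with
  | _ u ih =>
    obtain ⟨w, rfl⟩ : ∃ w, u = w + 1 := ⟨u - 1, by omega⟩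
    rw [cfDigits]
    have hq : 1 ≤ v / (w + 1) := Nat.div_pos huv.le hu
    have hdm := Nat.div_add_mod v (w + 1)
    have hdm' : ((w + 1 : ℕ) : ℚ) * ((v / (w + 1) : ℕ) : ℚ) + ((v % (w + 1) : ℕ) : ℚ) = v := by
      exact_mod_cast hdm
    have hw : ((w + 1 : ℕ) : ℚ) ≠ 0 := by positivity
    have hv : (v : ℚ) ≠ 0 := by
      have : v ≠ 0 := by omega
      exact_mod_cast this
    rcases Nat.eq_zero_or_pos (v % (w + 1)) with h0 | hpos
    · rw [h0] at hdm hdm' ⊢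
      refine ⟨?_, ?_, ?_⟩
      · simp only [cfDigits, cfValue, add_zero]
        have hq' : ((v / (w + 1) : ℕ) : ℚ) ≠ 0 := by
          have : v / (w + 1) ≠ 0 := by omega
          exact_mod_cast this
        rw [div_eq_div_iff hq' hv]
        push_cast at hdm' ⊢
        linarith
      · simp [cfDigits, hq]
      · refine ⟨v / (w + 1), by simp [cfDigits], ?_⟩
        by_contra hlt
        have h1 : v / (w + 1) = 1 := by omega
        rw [h1] at hdm
        omega
    · have hlt : v % (w + 1) < w + 1 := Nat.mod_lt _ hu
      obtain ⟨h1, h2, a, ha, ha2⟩ := ih _ hlt (w + 1) hpos hlt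
      refine ⟨?_, ?_, a, ?_, ha2⟩
      · rw [cfValue, h1, ← hdm']
        field_simp
      · intro b hb
        rcases List.mem_cons.1 hb with rfl | hb
        · exact hq
        · exact h2 b hb
      · cases hl : cfDigits (v % (w + 1)) (w + 1) with
        | nil => rw [hl] at ha; simp at ha
        | cons x l => rw [hl] at ha; simpa using ha

/-- The total cost `C(u / v) = ∑ c(a_k)` over the digits of `u / v`. -/
def cost (c : ℕ → ℝ) (u v : ℕ) : ℝ := ((cfDigits u v).map c).sum

/-- `Ω_n`: the coprime pairs `(u, v)` with `1 ≤ u < v ≤ n`. -/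
def Omega (n : ℕ) : Finset (ℕ × ℕ) :=
  (Finset.Icc 1 n ×ˢ Finset.Icc 1 n).filter fun q => q.1 < q.2 ∧ Nat.Coprime q.1 q.2

/-! ### The Gauss map, its invariant density, and the constants `𝔥(T)` and `μ` -/

/-- The Gauss map `T(x) = 1/x - ⌊1/x⌋`. -/
def gaussMap (x : ℝ) : ℝ := 1 / x - ⌊1 / x⌋

/-- The invariant density `ξ(x) = 1 / ((log 2)(1 + x))`. -/
def xi (x : ℝ) : ℝ := 1 / (Real.log 2 * (1 + x))

/-- `𝔥(T) = ∫₀¹ log |T'(x)| ξ(x) dx`. -/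
def entropy : ℝ := ∫ x in (0 : ℝ)..1, Real.log |deriv gaussMap x| * xi x

/-- `μ = (2 / 𝔥(T)) ∑_{n ≥ 1} c(n) ∫_{1/(n+1)}^{1/n} ξ(x) dx`. -/
def mean (c : ℕ → ℝ) : ℝ :=
  2 / entropy * ∑' k : ℕ, c (k + 1) * ∫ x in (1 / ((k : ℝ) + 2))..(1 / ((k : ℝ) + 1)), xi x

/-! ### The Dirichlet series -/

/-- The coefficient `∑_{(u,v) ∈ Ω_n \ Ω_{n-1}} (C(u/v) - μ log v)^p` of `n^{-2s}`. -/
def dirichletCoeff (c : ℕ → ℝ) (p n : ℕ) : ℝ :=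
  ∑ q ∈ Omega n \ Omega (n - 1), (cost c q.1 q.2 - mean c * Real.log q.2) ^ p

/-- The `n`-th term of `D_p(s)`, for `n = k + 1 ≥ 1`. -/
def dirichletTerm (c : ℕ → ℝ) (p : ℕ) (s : ℂ) (k : ℕ) : ℂ :=
  1 / ((k + 1 : ℕ) : ℂ) ^ (2 * s) * (dirichletCoeff c p (k + 1) : ℂ)

/-- `D_p(s) = ∑_{n ≥ 1} n^{-2s} ∑_{(u,v) ∈ Ω_n \ Ω_{n-1}} (C(u/v) - μ log v)^p`. -/
def dirichletSeries (c : ℕ → ℝ) (p : ℕ) (s : ℂ) : ℂ := ∑' k : ℕ, dirichletTerm c p s k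

/-! ### The space `H^∞(𝔻)` -/

/-- The disc `𝔻 = {z : |z - 2/3| < 1}`. -/
def disc : Set ℂ := Metric.ball (2 / 3) 1

/-- Extension by zero of a function on `𝔻`; only its values on `𝔻` are ever used. -/
def ext (f : disc → ℂ) (z : ℂ) : ℂ :=
  open Classical in if h : z ∈ disc then f ⟨z, h⟩ else 0

theorem ext_of_mem (f : disc → ℂ) {z : ℂ} (h : z ∈ disc) : ext f z = f ⟨z, h⟩ := by
  simp [ext, h]

/-- `H^∞(𝔻)`, the bounded holomorphic functions on `𝔻`, with the supremum norm. -/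
def HInf : Submodule ℂ (disc →ᵇ ℂ) where
  carrier := {f | DifferentiableOn ℂ (ext f) disc}
  zero_mem' := by
    refine (differentiableOn_const (0 : ℂ)).congr fun z hz => ?_
    simp [ext_of_mem _ hz]
  add_mem' := by
    intro f g hf hg
    refine (DifferentiableOn.add hf hg).congr fun z hz => ?_
    simp [ext_of_mem _ hz]
  smul_mem' := by
    intro a f hf
    refine (DifferentiableOn.const_smul hf a).congr fun z hz => ?_
    simp [ext_of_mem _ hz]

/-- The value at `z` of `f ∈ H^∞(𝔻)` (for `z ∈ 𝔻`). -/
def value (f : HInf) (z : ℂ) : ℂ := ext f.1 z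

/-- The constant function `𝟏 ∈ H^∞(𝔻)`. -/
def oneH : HInf :=
  ⟨BoundedContinuousFunction.const disc 1, by
    refine (differentiableOn_const (1 : ℂ)).congr fun z hz => ?_
    simp [ext_of_mem _ hz]⟩

/-- The holomorphic extension of the density `ξ` to `𝔻`. -/
def xiC (z : ℂ) : ℂ := 1 / (Real.log 2 * (1 + z))

/-! ### The weighted transfer operators -/

/-- The `n`-th summand `e^{ω c(n)} (z + n)^{-(2s + μω)} f(1 / (z + n))`. -/
def branch (c : ℕ → ℝ) (s ω : ℂ) (n : ℕ) (f : HInf) (z : ℂ) : ℂ :=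
  Complex.exp (ω * c n) / (z + n) ^ (2 * s + mean c * ω) * value f (1 / (z + n))

/-- `A` is the bounded operator `f ↦ ∑_{n ≥ m} e^{ω c(n)} (z + n)^{-(2s + μω)} f(1 / (z + n))`. -/
def IsBranchSum (c : ℕ → ℝ) (m : ℕ) (s ω : ℂ) (A : HInf →L[ℂ] HInf) : Prop :=
  ∀ (f : HInf), ∀ z ∈ disc, HasSum (fun k : ℕ => branch c s ω (k + m) f z) (value (A f) z)

open Classical in
/-- The bounded operator on `H^∞(𝔻)` given by the sum over the branches `n ≥ m`. It exists as soon
as `c` is bounded, `m ≥ 1` and `Re (2s + μω) > 1`, see `isBranchSum_branchOp`; where there is no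
such operator the value is `0`. -/
def branchOp (c : ℕ → ℝ) (m : ℕ) (s ω : ℂ) : HInf →L[ℂ] HInf :=
  if h : ∃ A, IsBranchSum c m s ω A then h.choose else 0

/-- `𝓛_{s,ω}`, the sum over all `n ≥ 1`. -/
def opL (c : ℕ → ℝ) (s ω : ℂ) : HInf →L[ℂ] HInf := branchOp c 1 s ω

/-- `𝓕_{s,ω}`, the sum over all `n ≥ 2`. -/
def opF (c : ℕ → ℝ) (s ω : ℂ) : HInf →L[ℂ] HInf := branchOp c 2 s ω

theorem isOpen_disc : IsOpen disc := Metric.isOpen_ball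

theorem re_add_ge {z : ℂ} (hz : z ∈ disc) {n : ℕ} (hn : 1 ≤ n) :
    2 / 3 * (n : ℝ) < (z + n).re := by
  have h1 : |(z - 2 / 3).re| < 1 :=
    lt_of_le_of_lt (Complex.abs_re_le_norm _) (by simpa [disc, dist_eq_norm] using hz)
  have h2 : (z - 2 / 3).re = z.re - 2 / 3 := by
    have : (2 / 3 : ℂ) = ((2 / 3 : ℝ) : ℂ) := by push_cast; ring
    rw [this, Complex.sub_re, Complex.ofReal_re]
  rw [h2, abs_lt] at h1
  have hn' : (1 : ℝ) ≤ n := by exact_mod_cast hn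
  simp only [Complex.add_re, Complex.natCast_re]
  linarith [h1.1]

theorem inv_add_mem {z : ℂ} (hz : z ∈ disc) {n : ℕ} (hn : 1 ≤ n) : 1 / (z + n) ∈ disc := by
  have hre := re_add_ge hz hn
  have hn' : (1 : ℝ) ≤ n := by exact_mod_cast hn
  set w : ℂ := z + n with hw
  have hw0 : w ≠ 0 := by
    intro h
    rw [h, Complex.zero_re] at hre
    linarith
  have hpos : 0 < ‖w‖ := norm_pos_iff.2 hw0
  have e : 1 / w - 2 / 3 = (3 - 2 * w) / (3 * w) := by field_simp
  rw [disc, Metric.mem_ball, dist_eq_norm, e, norm_div, norm_mul]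
  have h3 : ‖(3 : ℂ)‖ = 3 := by simp
  rw [h3, div_lt_one (by positivity)]
  refine lt_of_pow_lt_pow_left₀ 2 (by positivity) ?_
  have a1 : ‖3 - 2 * w‖ ^ 2 = (3 - 2 * w.re) ^ 2 + (2 * w.im) ^ 2 := by
    rw [← Complex.normSq_eq_norm_sq, Complex.normSq_apply]
    simp; ring
  have a2 : ‖w‖ ^ 2 = w.re ^ 2 + w.im ^ 2 := by
    rw [← Complex.normSq_eq_norm_sq, Complex.normSq_apply]; ring
  rw [mul_pow, a1, a2]
  nlinarith [sq_nonneg w.im]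

theorem norm_value_le (f : HInf) (z : ℂ) : ‖value f z‖ ≤ ‖f‖ := by
  unfold value ext
  split_ifs with h
  · exact BoundedContinuousFunction.norm_coe_le_norm f.1 ⟨z, h⟩
  · rw [norm_zero]
    exact norm_nonneg f

theorem branch_bound (c : ℕ → ℝ) {M : ℝ} (s ω : ℂ)
    (hs : 1 < (2 * s + mean c * ω).re) {n : ℕ} (hn : 1 ≤ n) (hM : |c n| ≤ M) (f : HInf)
    {z : ℂ} (hz : z ∈ disc) :
    ‖branch c s ω n f z‖ ≤
      Real.exp (‖ω‖ * M) * Real.exp (Real.pi * |(2 * s + mean c * ω).im|) *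
        (2 / 3 : ℝ) ^ (-(2 * s + mean c * ω).re) * ‖f‖ * (n : ℝ) ^ (-(2 * s + mean c * ω).re) := by
  set a : ℂ := 2 * s + mean c * ω with ha
  have hre := re_add_ge hz hn
  have hn' : (1 : ℝ) ≤ n := by exact_mod_cast hn
  have hw0 : z + (n : ℂ) ≠ 0 := by
    intro h
    rw [h, Complex.zero_re] at hre
    linarith
  have hnorm : 2 / 3 * (n : ℝ) ≤ ‖z + (n : ℂ)‖ := hre.le.trans (Complex.re_le_norm _)
  have b1 : ‖Complex.exp (ω * c n)‖ ≤ Real.exp (‖ω‖ * M) := by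
    rw [Complex.norm_exp]
    apply Real.exp_le_exp.2
    calc (ω * (c n : ℂ)).re ≤ ‖ω * (c n : ℂ)‖ := Complex.re_le_norm _
      _ = ‖ω‖ * |c n| := by rw [norm_mul, Complex.norm_real, Real.norm_eq_abs]
      _ ≤ ‖ω‖ * M := by gcongr
  have b2 : ‖(z + (n : ℂ)) ^ a‖⁻¹ ≤ Real.exp (Real.pi * |a.im|) *
      ((2 / 3 : ℝ) ^ (-a.re) * (n : ℝ) ^ (-a.re)) := by
    rw [Complex.norm_cpow_of_ne_zero hw0, inv_div, div_eq_mul_inv, ← Real.rpow_neg (norm_nonneg _),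
      ← Real.mul_rpow (by norm_num) (by positivity)]
    gcongr ?_ * ?_
    · apply Real.exp_le_exp.2
      calc (z + (n : ℂ)).arg * a.im ≤ |(z + (n : ℂ)).arg * a.im| := le_abs_self _
        _ = |(z + (n : ℂ)).arg| * |a.im| := abs_mul _ _
        _ ≤ Real.pi * |a.im| := by gcongr; exact Complex.abs_arg_le_pi _
    · exact Real.rpow_le_rpow_of_nonpos (by positivity) hnorm (by linarith)
  unfold branch
  rw [norm_mul, norm_div, div_eq_mul_inv]
  calc ‖Complex.exp (ω * c n)‖ * ‖(z + (n : ℂ)) ^ a‖⁻¹ * ‖value f (1 / (z + n))‖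
      ≤ Real.exp (‖ω‖ * M) * (Real.exp (Real.pi * |a.im|) *
      ((2 / 3 : ℝ) ^ (-a.re) * (n : ℝ) ^ (-a.re))) * ‖f‖ := by
        gcongr
        exact norm_value_le f _
    _ = _ := by ring

theorem branch_differentiableOn (c : ℕ → ℝ) (s ω : ℂ) {n : ℕ} (hn : 1 ≤ n) (f : HInf) :
    DifferentiableOn ℂ (branch c s ω n f) disc := by
  have hn' : (1 : ℝ) ≤ n := by exact_mod_cast hn
  have hre : ∀ z ∈ disc, 0 < (z + (n : ℂ)).re := fun z hz => by
    have := re_add_ge hz hn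
    linarith
  have h0 : ∀ z ∈ disc, z + (n : ℂ) ≠ 0 := fun z hz h => by
    have := hre z hz; rw [h] at this; simp at this
  have hadd : DifferentiableOn ℂ (fun z : ℂ => z + (n : ℂ)) disc :=
    differentiableOn_id.add_const _
  unfold branch
  refine DifferentiableOn.mul (DifferentiableOn.div (differentiableOn_const _)
    (hadd.cpow (differentiableOn_const _) fun z hz => Or.inl (hre z hz)) fun z hz h => ?_) ?_
  · exact h0 z hz ((Complex.cpow_eq_zero_iff _ _).1 h).1
  · have hf : DifferentiableOn ℂ (value f) disc := f.2
    exact hf.comp (DifferentiableOn.div (differentiableOn_const _) hadd h0)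
      fun z hz => inv_add_mem hz hn

theorem exists_isBranchSum (c : ℕ → ℝ) {M : ℝ} (hM : ∀ n, 1 ≤ n → |c n| ≤ M) {m : ℕ} (hm : 1 ≤ m)
    (s ω : ℂ) (hs : 1 < (2 * s + mean c * ω).re) : ∃ A, IsBranchSum c m s ω A := by
  set K : ℝ := Real.exp (‖ω‖ * M) * Real.exp (Real.pi * |(2 * s + mean c * ω).im|) *
        (2 / 3 : ℝ) ^ (-(2 * s + mean c * ω).re) with hK
  set t : ℝ := -(2 * s + mean c * ω).re with ht
  have hK0 : 0 ≤ K := by positivity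
  have hsum0 : Summable fun k : ℕ => ((k + m : ℕ) : ℝ) ^ t :=
    (summable_nat_add_iff m).2 (Real.summable_nat_rpow.2 (by linarith))
  have hsum : ∀ f : HInf, Summable fun k : ℕ => K * ‖f‖ * ((k + m : ℕ) : ℝ) ^ t :=
    fun f => hsum0.mul_left _
  have hb : ∀ (f : HInf) (k : ℕ) (z : ℂ), z ∈ disc →
      ‖branch c s ω (k + m) f z‖ ≤ K * ‖f‖ * ((k + m : ℕ) : ℝ) ^ t := fun f k z hz =>
    branch_bound c s ω hs (by omega) (hM _ (by omega)) f hz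
  have hsummable : ∀ (f : HInf) (z : ℂ), z ∈ disc →
      Summable fun k : ℕ => branch c s ω (k + m) f z := fun f z hz =>
    Summable.of_norm_bounded (hsum f) fun k => hb f k z hz
  have hdiff : ∀ f : HInf,
      DifferentiableOn ℂ (fun z => ∑' k : ℕ, branch c s ω (k + m) f z) disc := fun f =>
    Complex.differentiableOn_tsum_of_summable_norm (hsum f)
      (fun k => branch_differentiableOn c s ω (by omega) f) isOpen_disc fun k z hz => hb f k z hz
  set S : ℝ := ∑' k : ℕ, ((k + m : ℕ) : ℝ) ^ t with hS
  have hS0 : 0 ≤ S := tsum_nonneg fun k => by positivity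
  have hbound : ∀ (f : HInf) (z : ℂ), z ∈ disc →
      ‖∑' k : ℕ, branch c s ω (k + m) f z‖ ≤ K * S * ‖f‖ := fun f z hz => by
    refine (tsum_of_norm_bounded (hsum f).hasSum fun k => hb f k z hz).trans ?_
    rw [tsum_mul_left]
    apply le_of_eq; ring
  let B : HInf → HInf := fun f =>
    ⟨BoundedContinuousFunction.ofNormedAddCommGroup
      (fun z : disc => ∑' k : ℕ, branch c s ω (k + m) f z)
      (continuousOn_iff_continuous_domRestrict.1 (hdiff f).continuousOn) (K * S * ‖f‖)
      (fun z => hbound f z z.2), by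
      refine (hdiff f).congr fun z hz => ?_
      rw [ext_of_mem _ hz]
      rfl⟩
  have hB : ∀ (f : HInf) (z : disc), (B f).1 z = ∑' k : ℕ, branch c s ω (k + m) f z :=
    fun f z => rfl
  have badd : ∀ (f g : HInf) (k : ℕ) (z : ℂ), z ∈ disc → branch c s ω (k + m) (f + g) z =
      branch c s ω (k + m) f z + branch c s ω (k + m) g z := fun f g k z hz => by
    have hmem := inv_add_mem hz (n := k + m) (by omega)
    simp only [branch, value, ext_of_mem _ hmem]
    simp [mul_add]
  have bsmul : ∀ (a : ℂ) (f : HInf) (k : ℕ) (z : ℂ), z ∈ disc → branch c s ω (k + m) (a • f) z =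
      a * branch c s ω (k + m) f z := fun a f k z hz => by
    have hmem := inv_add_mem hz (n := k + m) (by omega)
    simp only [branch, value, ext_of_mem _ hmem]
    simp only [SetLike.val_smul, BoundedContinuousFunction.coe_smul, smul_eq_mul]
    ring
  let L : HInf →ₗ[ℂ] HInf :=
    { toFun := B
      map_add' := fun f g => by
        apply Subtype.ext
        ext z
        change (B (f + g)).1 z = (B f).1 z + (B g).1 z
        rw [hB, hB, hB, ← (hsummable f z z.2).tsum_add (hsummable g z z.2)]
        exact tsum_congr fun k => badd f g k z z.2
      map_smul' := fun a f => by
        apply Subtype.ext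
        ext z
        change (B (a • f)).1 z = a * (B f).1 z
        rw [hB, hB, ← tsum_mul_left]
        exact tsum_congr fun k => bsmul a f k z z.2 }
  refine ⟨L.mkContinuous (K * S) fun f => ?_, fun f z hz => ?_⟩
  · change ‖(B f).1‖ ≤ _
    exact (BoundedContinuousFunction.norm_le (by positivity)).2 fun z => hbound f z z.2
  · have : value (L.mkContinuous (K * S) (fun f => by
        change ‖(B f).1‖ ≤ _
        exact (BoundedContinuousFunction.norm_le (by positivity)).2 fun z => hbound f z z.2) f) z =
        ∑' k : ℕ, branch c s ω (k + m) f z := by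
      change value (B f) z = _
      rw [value, ext_of_mem _ hz]
      exact hB f ⟨z, hz⟩
    rw [this]
    exact (hsummable f z hz).hasSum

theorem isBranchSum_branchOp (c : ℕ → ℝ) {M : ℝ} (hM : ∀ n, 1 ≤ n → |c n| ≤ M) {m : ℕ}
    (hm : 1 ≤ m) (s ω : ℂ) (hs : 1 < (2 * s + mean c * ω).re) :
    IsBranchSum c m s ω (branchOp c m s ω) := by
  have h := exists_isBranchSum c hM hm s ω hs
  rw [branchOp, dif_pos h]
  exact h.choose_spec

/-! ### The leading eigenvalue near `(s, ω) = (1, 0)` -/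

/-- `𝓛_{s,ω} = λ(s,ω) 𝓟_{s,ω} + 𝓝_{s,ω}` on the open neighbourhood `V` of `(1,0)`, where `𝓟` is a
projection onto a one-dimensional eigenspace, `𝓝` has spectral radius less than `1`,
`𝓟 𝓝 = 𝓝 𝓟 = 0`, everything depends holomorphically on `(s,ω)`, `λ(1,0) = 1` and
`𝓟_{1,0} f = (∫₀¹ f) ξ`. Such data exist and the germs of `λ`, `𝓟`, `𝓝` at `(1,0)` are unique. -/
structure IsSpectralDecomposition (c : ℕ → ℝ) (V : Set (ℂ × ℂ)) (lam : ℂ × ℂ → ℂ)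
    (P N : ℂ × ℂ → (HInf →L[ℂ] HInf)) : Prop where
  isOpen : IsOpen V
  mem : ((1, 0) : ℂ × ℂ) ∈ V
  re_gt : ∀ x ∈ V, 1 / 2 < x.1.re ∧ 1 < (2 * x.1 + mean c * x.2).re
  decomp : ∀ x ∈ V, opL c x.1 x.2 = lam x • P x + N x
  P_comp_N : ∀ x ∈ V, (P x).comp (N x) = 0
  N_comp_P : ∀ x ∈ V, (N x).comp (P x) = 0
  P_idem : ∀ x ∈ V, (P x).comp (P x) = P x
  P_rank : ∀ x ∈ V, Module.finrank ℂ (LinearMap.range (P x : HInf →ₗ[ℂ] HInf)) = 1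
  P_range : ∀ x ∈ V, LinearMap.range (P x : HInf →ₗ[ℂ] HInf) =
    Module.End.eigenspace (opL c x.1 x.2 : HInf →ₗ[ℂ] HInf) (lam x)
  N_radius : ∀ x ∈ V, spectralRadius ℂ (N x) < 1
  lam_analytic : AnalyticOnNhd ℂ lam V
  P_analytic : AnalyticOnNhd ℂ P V
  N_analytic : AnalyticOnNhd ℂ N V
  lam_one_zero : lam (1, 0) = 1
  P_one_zero : ∀ (f : HInf), ∀ z ∈ disc,
    value (P (1, 0) f) z = (∫ x in (0 : ℝ)..1, value f (x : ℂ)) * xiC z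

end EuclidCost

end

open Filter Topology Set

noncomputable section

namespace EuclidCost

set_option maxSynthPendingDepth 3

/-! ### The Banach space `H^∞(𝔻)` -/

/-! The Euclidean algorithm is a renewal process. Every coprime pair `(u, v)` is either a root `(1,
k + 2)` or the child `(v', u' + (k + 1) v')` of a unique smaller pair, and passing to a child
applies the inverse branch `x ↦ 1 / (x + k + 1)` to the quotient. Hence the sum `S(f)` of `e^{ω
C(u/v)} v^{-(2s + μω)} f(u/v)` over all pairs satisfies `S(f) = S(𝓛 f) + (𝓕 f)(0)`
(`tsum_fullWeight_value`). Taking `f = (1 - 𝓛)⁻¹ 𝟏` gives `S(𝟏) = (𝓕 (1 - 𝓛)⁻¹ 𝟏)(0)`, and `D_p(s)`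
is the `p`-th `ω`-derivative of this expression at `ω = 0` (`dirichletSeries_eq_resolventDeriv`).
The problem is thereby reduced to the resolvent of `𝓛` near the line `Re s = 1`.

Away from `s = 1` the operator `1 - 𝓛_{s,0}` is invertible (`isUnit_one_sub_opL`). The branches map
the disc into a smaller disc, so `𝓛` is compact and only the eigenvalue `1` must be excluded. On
`[0, 1]`, after multiplication by `1 + x`, the operator `𝓛_{1,0}` is a Markov average and `𝓛_{s,0}`
is this average with the factors `(x + k + 1)^{-2(s-1)}` inserted. At a maximum of the modulus of an
eigenfunction all averaged terms coincide, which would force `2^{it} = 3^{it} = 1` with `t ≠ 0`.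

At `(1, 0)` the same maximum principle shows that `1` is a simple isolated dominant eigenvalue; the
splitting persists analytically nearby (`exists_dominantSplitting`). With it, `(1 - λ)` times the
resolvent expression is an analytic function `η` (`exists_resolvent_numerator`). The eigenvalue has
`∂_s λ = -𝔥(T)`, `∂_ω λ = 0` (this is what the choice of `μ` achieves, see `integralL_deriv_opLine`)
and `∂²_ω λ = v > 0`. The last inequality holds because `v` is the integral of a sum of squares
(`second_derivative_pos`), whose vanishing would bound `c(k + 1) - μ log(k + 1)`.

So the resolvent expression behaves like `𝔣₀ / (𝔥 (s - 1) - v ω² / 2)`, a geometric series in `v ω²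
/ (2 𝔥 (s - 1))`. Its `p`-th `ω`-derivative has a pole of order at most `1 + ⌊p/2⌋`, with top
coefficient `p! (v / 2𝔥)^{p/2} 𝔣₀ / 𝔥` for even `p`; since `σ² = 2v / 𝔥`, this is the asserted
constant. `exists_pole_coefficient` makes this rigorous through the Leibniz recursion. -/

theorem differentiableOn_value (f : HInf) : DifferentiableOn ℂ (value f) disc := f.2

theorem value_coe (f : HInf) (z : disc) : value f z = f.1 z := ext_of_mem _ z.2

theorem value_of_notMem (f : HInf) {z : ℂ} (hz : z ∉ disc) : value f z = 0 := by
  simp [value, ext, hz]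

theorem value_add (f g : HInf) (z : ℂ) : value (f + g) z = value f z + value g z := by
  by_cases hz : z ∈ disc
  · simp [value, ext_of_mem _ hz]
  · simp [value_of_notMem _ hz]

theorem value_smul (a : ℂ) (f : HInf) (z : ℂ) : value (a • f) z = a * value f z := by
  by_cases hz : z ∈ disc
  · simp [value, ext_of_mem _ hz]
  · simp [value_of_notMem _ hz]

/-- Evaluation at a point as a continuous functional. -/
def evalL (z : ℂ) : HInf →L[ℂ] ℂ :=
  LinearMap.mkContinuous
    ({ toFun := fun f => value f z
       map_add' := fun f g => value_add f g z
       map_smul' := fun a f => value_smul a f z } : HInf →ₗ[ℂ] ℂ) 1 fun f => by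
    rw [one_mul]
    exact norm_value_le f z

@[simp] theorem evalL_apply (z : ℂ) (f : HInf) : evalL z f = value f z := rfl

theorem value_sub (f g : HInf) (z : ℂ) : value (f - g) z = value f z - value g z :=
  map_sub (evalL z) f g

theorem value_zero (z : ℂ) : value 0 z = 0 := map_zero (evalL z)

theorem HInf.ext_value {f g : HInf} (h : ∀ z ∈ disc, value f z = value g z) : f = g := by
  apply Subtype.ext
  ext z
  rw [← value_coe, ← value_coe]
  exact h z z.2

theorem norm_le_of_value {f : HInf} {C : ℝ} (hC : 0 ≤ C) (h : ∀ z ∈ disc, ‖value f z‖ ≤ C) :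
    ‖f‖ ≤ C :=
  (BoundedContinuousFunction.norm_le hC).2 fun z => by
    change ‖f.1 z‖ ≤ C
    rw [← value_coe]; exact h z z.2

/-- The element of `H^∞(𝔻)` given by a bounded holomorphic function. -/
def mkH (g : ℂ → ℂ) (hd : DifferentiableOn ℂ g disc) (C : ℝ) (hC : ∀ z ∈ disc, ‖g z‖ ≤ C) : HInf :=
  ⟨BoundedContinuousFunction.ofNormedAddCommGroup (fun z : disc => g z)
      (continuousOn_iff_continuous_domRestrict.1 hd.continuousOn) C (fun z => hC z z.2), by
      refine hd.congr fun z hz => ?_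
      rw [ext_of_mem _ hz]
      rfl⟩

theorem value_mkH {g : ℂ → ℂ} {hd : DifferentiableOn ℂ g disc} {C : ℝ}
    {hC : ∀ z ∈ disc, ‖g z‖ ≤ C} {z : ℂ} (hz : z ∈ disc) : value (mkH g hd C hC) z = g z := by
  rw [value, ext_of_mem _ hz]; rfl

theorem value_oneH {z : ℂ} (hz : z ∈ disc) : value oneH z = 1 := by
  rw [value, ext_of_mem _ hz]; rfl

/-- A uniform limit of holomorphic functions is holomorphic, so the subspace is closed. Completeness
is needed for operator-valued analyticity, for the spectral radius formula and for the Fredholm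
alternative. -/
instance : CompleteSpace HInf := by
  have hcl : IsClosed (HInf : Set (disc →ᵇ ℂ)) := by
    refine isClosed_of_closure_subset fun f hf => ?_
    obtain ⟨u, hu, hlim⟩ := mem_closure_iff_seq_limit.1 hf
    have h2 : TendstoUniformlyOn (fun n => ext (u n)) (ext f) atTop disc := by
      rw [Metric.tendstoUniformlyOn_iff]
      intro ε hε
      have := (Metric.tendsto_nhds.1 hlim) ε hε
      filter_upwards [this] with n hn z hz
      rw [ext_of_mem _ hz, ext_of_mem _ hz, dist_comm]
      exact (BoundedContinuousFunction.dist_coe_le_dist _).trans_lt hn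
    exact h2.tendstoLocallyUniformlyOn.differentiableOn (Eventually.of_forall fun n => hu n)
      isOpen_disc
  exact hcl.completeSpace_coe

theorem ofReal_mem_disc {x : ℝ} (h0 : -(1 / 3) < x) (h1 : x < 5 / 3) : (x : ℂ) ∈ disc := by
  have : (x : ℂ) - 2 / 3 = ((x - 2 / 3 : ℝ) : ℂ) := by push_cast; ring
  rw [disc, Metric.mem_ball, dist_eq_norm, this, Complex.norm_real, Real.norm_eq_abs, abs_lt]
  constructor <;> linarith

theorem ofReal_mem_disc_of_mem_Icc {x : ℝ} (hx : x ∈ Icc (0 : ℝ) 1) : (x : ℂ) ∈ disc :=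
  ofReal_mem_disc (by linarith [hx.1]) (by linarith [hx.2])

theorem continuousOn_value_ofReal (f : HInf) :
    ContinuousOn (fun x : ℝ => value f (x : ℂ)) (Icc 0 1) :=
  (differentiableOn_value f).continuousOn.comp Complex.continuous_ofReal.continuousOn
    fun _ hx => ofReal_mem_disc_of_mem_Icc hx

/-- The identity theorem, with zeros accumulating at `0`. Eigenfunctions on the disc can therefore
be studied on `[0, 1]`, where the branch weights at `s = 1` are positive. -/
theorem HInf.eq_zero_of_eqOn_Icc {f : HInf} (h : ∀ x ∈ Icc (0 : ℝ) 1, value f (x : ℂ) = 0) :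
    f = 0 := by
  have han : AnalyticOnNhd ℂ (value f) disc :=
    (differentiableOn_value f).analyticOnNhd isOpen_disc
  have hpre : IsPreconnected disc := (convex_ball _ _).isPreconnected
  have h0 : (0 : ℂ) ∈ disc := by
    simpa using ofReal_mem_disc (x := 0) (by norm_num) (by norm_num)
  have hfreq : ∃ᶠ z in 𝓝[≠] (0 : ℂ), value f z = 0 := by
    have ht : Tendsto (fun n : ℕ => ((1 / ((n : ℝ) + 1) : ℝ) : ℂ)) atTop (𝓝[≠] 0) := by
      rw [tendsto_nhdsWithin_iff]
      constructor
      · have := (Complex.continuous_ofReal.tendsto 0).comp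
          (tendsto_one_div_add_atTop_nhds_zero_nat (𝕜 := ℝ))
        simpa [Function.comp_def] using this
      · refine Eventually.of_forall fun n => ?_
        have : (1 / ((n : ℝ) + 1)) ≠ 0 := by positivity
        simpa using (Complex.ofReal_ne_zero.2 this)
    refine ht.frequently (Eventually.of_forall fun n => h _ ⟨by positivity, ?_⟩).frequently
    rw [div_le_one (by positivity)]
    linarith [Nat.cast_nonneg (α := ℝ) n]
  refine HInf.ext_value fun z hz => ?_
  rw [value_zero]
  exact han.eqOn_zero_of_preconnected_of_frequently_eq_zero hpre h0 hfreq hz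

theorem norm_integral_value_le (f : HInf) : ‖∫ x in (0 : ℝ)..1, value f (x : ℂ)‖ ≤ ‖f‖ := by
  have := intervalIntegral.norm_integral_le_of_norm_le_const (a := (0 : ℝ)) (b := 1)
    (f := fun x : ℝ => value f (x : ℂ)) (C := ‖f‖) fun x _ => norm_value_le f _
  refine this.trans_eq ?_
  rw [sub_zero, abs_one, mul_one]

/-- Integration over `[0, 1]` as a linear functional on `H^∞(𝔻)`. -/
def integralₗ : HInf →ₗ[ℂ] ℂ :=
    { toFun := fun f => ∫ x in (0 : ℝ)..1, value f (x : ℂ)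
      map_add' := fun f g => by
        simp only [value_add]
        refine intervalIntegral.integral_add ?_ ?_ <;>
        · refine ContinuousOn.intervalIntegrable ?_
          rw [uIcc_of_le zero_le_one]
          exact continuousOn_value_ofReal _
      map_smul' := fun a f => by
        simp only [value_smul]
        exact intervalIntegral.integral_const_mul _ _ }

/-- Integration over `[0, 1]` as a continuous functional on `H^∞(𝔻)`. -/
def integralL : HInf →L[ℂ] ℂ :=
  integralₗ.mkContinuous 1 fun f => by
    rw [one_mul]
    exact norm_integral_value_le f

theorem integralL_apply (f : HInf) : integralL f = ∫ x in (0 : ℝ)..1, value f (x : ℂ) := rfl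

/-! ### Single branches as bounded operators -/

theorem add_succ_re_pos {z : ℂ} (hz : z ∈ disc) (k : ℕ) : 0 < (z + (k + 1 : ℕ)).re := by
  have h := re_add_ge hz (Nat.succ_pos k : 1 ≤ k + 1)
  have h' : (0 : ℝ) < ((k + 1 : ℕ) : ℝ) := by positivity
  linarith

theorem add_succ_ne_zero {z : ℂ} (hz : z ∈ disc) (k : ℕ) : z + (k + 1 : ℕ) ≠ 0 := fun h => by
  have := add_succ_re_pos hz k
  rw [h] at this
  simp at this

theorem add_succ_mem_slitPlane {z : ℂ} (hz : z ∈ disc) (k : ℕ) :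
    z + (k + 1 : ℕ) ∈ Complex.slitPlane := Or.inl (add_succ_re_pos hz k)

theorem norm_add_succ_ge {z : ℂ} (hz : z ∈ disc) (k : ℕ) :
    2 / 3 * ((k : ℝ) + 1) ≤ ‖z + (k + 1 : ℕ)‖ := by
  have h := re_add_ge hz (Nat.succ_pos k : 1 ≤ k + 1)
  push_cast at h ⊢
  exact h.le.trans (by simpa using Complex.re_le_norm (z + ((k : ℂ) + 1)))

theorem norm_add_succ_le {z : ℂ} (hz : z ∈ disc) (k : ℕ) :
    ‖z + (k + 1 : ℕ)‖ ≤ 8 / 3 * ((k : ℝ) + 1) := by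
  have h1 : ‖z - 2 / 3‖ < 1 := by simpa [disc, dist_eq_norm] using hz
  have h2 : z + (k + 1 : ℕ) = (z - 2 / 3) + ((2 / 3 + (k + 1) : ℝ) : ℂ) := by push_cast; ring
  have h3 : ‖((2 / 3 + (k + 1) : ℝ) : ℂ)‖ = 2 / 3 + (k + 1) := by
    rw [Complex.norm_real, Real.norm_eq_abs, abs_of_nonneg (by positivity)]
  rw [h2]
  refine (norm_add_le _ _).trans ?_
  rw [h3]
  linarith [Nat.cast_nonneg (α := ℝ) k]

/-- A bound for `|log (z + k + 1)|` on the disc. -/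
def logBound (k : ℕ) : ℝ := Real.log (k + 1) + 1 + Real.pi

theorem logBound_nonneg (k : ℕ) : 0 ≤ logBound k := by
  have : 0 ≤ Real.log ((k : ℝ) + 1) := Real.log_nonneg (by linarith [Nat.cast_nonneg (α := ℝ) k])
  have := Real.pi_pos
  unfold logBound
  linarith

theorem norm_log_add_succ_le {z : ℂ} (hz : z ∈ disc) (k : ℕ) :
    ‖Complex.log (z + (k + 1 : ℕ))‖ ≤ logBound k := by
  set w := z + (k + 1 : ℕ)
  have hk : (0 : ℝ) < (k : ℝ) + 1 := by positivity
  have h1 := norm_add_succ_ge hz k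
  have h2 := norm_add_succ_le hz k
  have hw : 0 < ‖w‖ := lt_of_lt_of_le (by positivity) h1
  -- The modulus lies between `2/3` and `8/3` times `k + 1`; since `e > 8/3`, the summand `1` in
  -- `logBound` absorbs both factors.
  have he := Real.exp_one_gt_d9
  have hl1 : Real.log ‖w‖ ≤ Real.log (k + 1) + 1 := by
    calc Real.log ‖w‖ ≤ Real.log (Real.exp 1 * (k + 1)) :=
          Real.log_le_log hw (h2.trans (by nlinarith))
      _ = _ := by rw [Real.log_mul (by positivity) hk.ne', Real.log_exp]; ring
  have hl2 : -(Real.log (k + 1) + 1) ≤ Real.log ‖w‖ := by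
    have : Real.log (Real.exp (-1)) ≤ Real.log ‖w‖ := by
      refine Real.log_le_log (Real.exp_pos _) (le_trans ?_ h1)
      rw [Real.exp_neg]
      refine (inv_anti₀ (by norm_num) (by linarith : (3 / 2 : ℝ) ≤ Real.exp 1)).trans ?_
      norm_num
    rw [Real.log_exp] at this
    have h0 : 0 ≤ Real.log ((k : ℝ) + 1) :=
      Real.log_nonneg (by linarith [Nat.cast_nonneg (α := ℝ) k])
    linarith
  refine (Complex.norm_le_abs_re_add_abs_im _).trans ?_
  rw [Complex.log_re, Complex.log_im]
  exact add_le_add (abs_le.2 ⟨hl2, hl1⟩) (Complex.abs_arg_le_pi _)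

theorem differentiableOn_log_add_succ (k : ℕ) :
    DifferentiableOn ℂ (fun z : ℂ => Complex.log (z + (k + 1 : ℕ))) disc :=
  (differentiableOn_id.add_const _).clog fun _ hz => add_succ_mem_slitPlane hz k

theorem differentiableOn_comp_branch (k : ℕ) (f : HInf) :
    DifferentiableOn ℂ (fun z : ℂ => value f (1 / (z + (k + 1 : ℕ)))) disc :=
  (differentiableOn_value f).comp ((differentiableOn_const _).div (differentiableOn_id.add_const _)
    fun _ hz => add_succ_ne_zero hz k) fun _ hz => inv_add_mem hz (Nat.succ_pos k)

/-- The operator `f ↦ m(z) f(1 / (z + k + 1))` for a bounded holomorphic function `m`, as a linear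
map. -/
def weightedCompₗ (k : ℕ) (m : ℂ → ℂ) (hm : DifferentiableOn ℂ m disc) (C : ℝ)
    (hC : ∀ z ∈ disc, ‖m z‖ ≤ C) : HInf →ₗ[ℂ] HInf where
  toFun f := mkH (fun z => m z * value f (1 / (z + (k + 1 : ℕ))))
      (hm.mul (differentiableOn_comp_branch k f)) (C * ‖f‖) fun z hz => by
    rw [norm_mul]
    exact mul_le_mul (hC z hz) (norm_value_le f _) (norm_nonneg _)
      ((norm_nonneg _).trans (hC z hz))
  map_add' f g := by
    refine HInf.ext_value fun z hz => ?_
    rw [value_add, value_mkH hz, value_mkH hz, value_mkH hz, value_add, mul_add]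
  map_smul' a f := by
    refine HInf.ext_value fun z hz => ?_
    rw [RingHom.id_apply, value_smul, value_mkH hz, value_mkH hz, value_smul]
    ring

theorem two_thirds_mem : (2 / 3 : ℂ) ∈ disc := by simp [disc]

theorem value_weightedCompₗ {k : ℕ} {m : ℂ → ℂ} {hm : DifferentiableOn ℂ m disc} {C : ℝ}
    {hC : ∀ z ∈ disc, ‖m z‖ ≤ C} (f : HInf) {z : ℂ} (hz : z ∈ disc) :
    value (weightedCompₗ k m hm C hC f) z = m z * value f (1 / (z + (k + 1 : ℕ))) :=
  value_mkH hz

/-- The operator `f ↦ m(z) f(1 / (z + k + 1))` for a bounded holomorphic function `m`. -/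
def weightedComp (k : ℕ) (m : ℂ → ℂ) (hm : DifferentiableOn ℂ m disc) (C : ℝ)
    (hC : ∀ z ∈ disc, ‖m z‖ ≤ C) : HInf →L[ℂ] HInf :=
  (weightedCompₗ k m hm C hC).mkContinuous C fun f => by
    have hC0 : 0 ≤ C := (norm_nonneg _).trans (hC _ two_thirds_mem)
    refine norm_le_of_value (by positivity) fun z hz => ?_
    rw [value_weightedCompₗ f hz, norm_mul]
    exact mul_le_mul (hC z hz) (norm_value_le f _) (norm_nonneg _) hC0

theorem value_weightedComp {k : ℕ} {m : ℂ → ℂ} {hm : DifferentiableOn ℂ m disc} {C : ℝ}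
    {hC : ∀ z ∈ disc, ‖m z‖ ≤ C} (f : HInf) {z : ℂ} (hz : z ∈ disc) :
    value (weightedComp k m hm C hC f) z = m z * value f (1 / (z + (k + 1 : ℕ))) :=
  value_mkH hz

theorem opNorm_le_of_value {A : HInf →L[ℂ] HInf} {C : ℝ} (hC : 0 ≤ C)
    (h : ∀ f, ∀ z ∈ disc, ‖value (A f) z‖ ≤ C * ‖f‖) : ‖A‖ ≤ C :=
  A.opNorm_le_bound hC fun f => norm_le_of_value (by positivity) (h f)

/-- The weight `(z + k + 1)^{-a}`. -/
def weight (k : ℕ) (a z : ℂ) : ℂ := Complex.exp (-(a * Complex.log (z + (k + 1 : ℕ))))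

theorem weight_eq {z : ℂ} (hz : z ∈ disc) (k : ℕ) (a : ℂ) :
    weight k a z = 1 / (z + (k + 1 : ℕ)) ^ a := by
  rw [weight, Complex.cpow_def_of_ne_zero (add_succ_ne_zero hz k), Complex.exp_neg, one_div,
    mul_comm a]

theorem norm_weight_le_exp {z : ℂ} (hz : z ∈ disc) (k : ℕ) (a : ℂ) :
    ‖weight k a z‖ ≤ Real.exp (‖a‖ * logBound k) := by
  rw [weight, Complex.norm_exp]
  refine Real.exp_le_exp.2 ((Complex.re_le_norm _).trans ?_)
  rw [norm_neg, norm_mul]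
  exact mul_le_mul_of_nonneg_left (norm_log_add_succ_le hz k) (norm_nonneg _)

theorem differentiableOn_weight (k : ℕ) (a : ℂ) : DifferentiableOn ℂ (weight k a) disc :=
  (((differentiableOn_log_add_succ k).const_mul a).neg).cexp

theorem norm_weight_le {z : ℂ} (hz : z ∈ disc) (k : ℕ) {a : ℂ} (ha : 0 ≤ a.re) :
    ‖weight k a z‖ ≤ Real.exp (Real.pi * |a.im|) * (2 / 3 : ℝ) ^ (-a.re) *
      ((k : ℝ) + 1) ^ (-a.re) := by
  have hw := add_succ_ne_zero hz k
  rw [weight_eq hz, norm_div, norm_one, Complex.norm_cpow_of_ne_zero hw, one_div, inv_div,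
    div_eq_mul_inv, ← Real.rpow_neg (norm_nonneg _), mul_assoc, ← Real.mul_rpow (by norm_num)
    (by positivity)]
  gcongr ?_ * ?_
  · apply Real.exp_le_exp.2
    refine (le_abs_self _).trans ?_
    rw [abs_mul]
    gcongr
    exact Complex.abs_arg_le_pi _
  · exact Real.rpow_le_rpow_of_nonpos (by positivity) (norm_add_succ_ge hz k) (by linarith)

/-- The operator `f ↦ (z + k + 1)^{-a} f(1 / (z + k + 1))`. -/
def branchCLM (k : ℕ) (a : ℂ) : HInf →L[ℂ] HInf :=
  weightedComp k (weight k a) (differentiableOn_weight k a) _ fun _ hz => norm_weight_le_exp hz k a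

theorem value_branchCLM (k : ℕ) (a : ℂ) (f : HInf) {z : ℂ} (hz : z ∈ disc) :
    value (branchCLM k a f) z = weight k a z * value f (1 / (z + (k + 1 : ℕ))) :=
  value_weightedComp f hz

theorem norm_branchCLM_le (k : ℕ) {a : ℂ} (ha : 0 ≤ a.re) :
    ‖branchCLM k a‖ ≤ Real.exp (Real.pi * |a.im|) * (2 / 3 : ℝ) ^ (-a.re) *
      ((k : ℝ) + 1) ^ (-a.re) :=
  opNorm_le_of_value (by positivity) fun f z hz => by
    rw [value_branchCLM k a f hz, norm_mul]
    exact mul_le_mul (norm_weight_le hz k ha) (norm_value_le f _) (norm_nonneg _) (by positivity)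

theorem differentiableAt_of_norm_le_sq {F : Type*} [NormedAddCommGroup F] [NormedSpace ℂ F]
    {f : ℂ → F} {f' : F} {a : ℂ} {C : ℝ}
    (h : ∀ᶠ h : ℂ in 𝓝 0, ‖f (a + h) - f a - h • f'‖ ≤ C * ‖h ^ 2‖) : DifferentiableAt ℂ f a := by
  refine HasDerivAt.differentiableAt (f' := f') ?_
  rw [hasDerivAt_iff_isLittleO_nhds_zero]
  exact (Asymptotics.IsBigO.of_bound C h).trans_isLittleO (Asymptotics.isLittleO_pow_id one_lt_two)

/-- For a fixed branch the logarithm is bounded on the disc, so the second order remainder of the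
exponential is `O(‖h‖²)` uniformly in the point and in `f`. This gives differentiability in operator
norm. -/
theorem differentiable_branchCLM (k : ℕ) : Differentiable ℂ (branchCLM k) := by
  intro a
  set Λ := logBound k
  have hΛ : 0 ≤ Λ := logBound_nonneg k
  have hB : ∀ z ∈ disc, ‖-Complex.log (z + (k + 1 : ℕ)) * weight k a z‖ ≤
      Λ * Real.exp (‖a‖ * Λ) := fun z hz => by
    rw [norm_mul, norm_neg]
    exact mul_le_mul (norm_log_add_succ_le hz k) (norm_weight_le_exp hz k a) (norm_nonneg _) hΛ
  obtain ⟨B', hB'⟩ : ∃ B' : HInf →L[ℂ] HInf, ∀ f, ∀ z ∈ disc, value (B' f) z =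
      -Complex.log (z + (k + 1 : ℕ)) * weight k a z * value f (1 / (z + (k + 1 : ℕ))) :=
    ⟨weightedComp k _ ((differentiableOn_log_add_succ k).neg.mul (differentiableOn_weight k a)) _
      hB, fun f z hz => value_weightedComp f hz⟩
  refine differentiableAt_of_norm_le_sq (C := Real.exp (‖a‖ * Λ) * Λ ^ 2) (f' := B') ?_
  have hsmall : ∀ᶠ h : ℂ in 𝓝 0, ‖h‖ * Λ < 1 := by
    have : Tendsto (fun h : ℂ => ‖h‖ * Λ) (𝓝 0) (𝓝 (‖(0 : ℂ)‖ * Λ)) :=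
      (continuous_norm.mul continuous_const).tendsto 0
    rw [norm_zero, zero_mul] at this
    exact this.eventually_lt_const one_pos
  filter_upwards [hsmall] with h hh
  refine opNorm_le_of_value (by positivity) fun f z hz => ?_
  have hlog := norm_log_add_succ_le hz k
  set ℓ := Complex.log (z + (k + 1 : ℕ)) with hℓ
  have e1 : value ((branchCLM k (a + h) - branchCLM k a - h • B') f) z =
      weight k a z * (Complex.exp (-(h * ℓ)) - 1 - (-(h * ℓ))) *
        value f (1 / (z + (k + 1 : ℕ))) := by
    rw [sub_apply, sub_apply,
      smul_apply, value_sub, value_sub, value_smul, value_branchCLM _ _ _ hz,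
      value_branchCLM _ _ _ hz, hB' _ _ hz]
    have : weight k (a + h) z = weight k a z * Complex.exp (-(h * ℓ)) := by
      rw [weight, weight, ← Complex.exp_add, ← hℓ]
      ring_nf
    rw [this]
    ring
  have hhl : ‖-(h * ℓ)‖ ≤ ‖h‖ * Λ := by
    rw [norm_neg, norm_mul]; gcongr
  have h2 := Complex.norm_exp_sub_one_sub_id_le (x := -(h * ℓ)) (hhl.trans hh.le)
  rw [e1, norm_mul, norm_mul, norm_pow]
  calc ‖weight k a z‖ * ‖Complex.exp (-(h * ℓ)) - 1 - (-(h * ℓ))‖ *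
        ‖value f (1 / (z + (k + 1 : ℕ)))‖
      ≤ Real.exp (‖a‖ * Λ) * (‖h‖ * Λ) ^ 2 * ‖f‖ := by
        gcongr
        · exact norm_weight_le_exp hz k a
        · exact h2.trans (by gcongr)
        · exact norm_value_le f _
    _ = _ := by ring

/-! ### The transfer operators as a holomorphic family -/

/-- The summand of `transfer` belonging to the branch `k`. -/
def transferTerm (k : ℕ) (a : ℂ) : (ℕ →ᵇ ℂ) →L[ℂ] HInf →L[ℂ] HInf :=
  (BoundedContinuousFunction.evalCLM ℂ k).smulRight (branchCLM k a)

theorem norm_transferTerm_le (k : ℕ) (a : ℂ) : ‖transferTerm k a‖ ≤ ‖branchCLM k a‖ := by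
  refine ContinuousLinearMap.opNorm_le_bound _ (norm_nonneg _) fun g => ?_
  change ‖g k • branchCLM k a‖ ≤ _
  rw [norm_smul, mul_comm]
  exact mul_le_mul_of_nonneg_left (g.norm_coe_le_norm k) (norm_nonneg _)

theorem differentiable_transferTerm (k : ℕ) : Differentiable ℂ (transferTerm k) := by
  have h : transferTerm k = fun a => ContinuousLinearMap.smulRightL ℂ (ℕ →ᵇ ℂ) (HInf →L[ℂ] HInf)
      (BoundedContinuousFunction.evalCLM ℂ k) (branchCLM k a) := rfl
  rw [h]
  exact (ContinuousLinearMap.differentiable _).comp (differentiable_branchCLM k)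

/-- The operator `f ↦ ∑ₖ gₖ (z + k + 1)^{-a} f(1 / (z + k + 1))`, linear in the bounded
sequence `g` of weights. -/
def transfer (a : ℂ) : (ℕ →ᵇ ℂ) →L[ℂ] HInf →L[ℂ] HInf := ∑' k, transferTerm k a

theorem summable_rpow_succ {t : ℝ} (ht : 1 < t) :
    Summable fun k : ℕ => ((k : ℝ) + 1) ^ (-t) := by
  have := (summable_nat_add_iff 1).2 (Real.summable_nat_rpow.2 (by linarith : -t < -1))
  simpa using this

theorem summable_transferTerm {a : ℂ} (ha : 1 < a.re) : Summable fun k => transferTerm k a :=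
  Summable.of_norm_bounded ((summable_rpow_succ ha).mul_left _) fun k =>
    (norm_transferTerm_le k a).trans (norm_branchCLM_le k (by linarith))

/-- Weierstrass' theorem for operator-valued series: on a bounded part of a half plane `Re w > 1 +
δ` the norms of the terms are dominated by a multiple of `(k + 1)^{-(1 + δ)}`. -/
theorem differentiableOn_transfer :  DifferentiableOn ℂ transfer {b : ℂ | 1 < b.re} := by
  intro b hb
  set δ := (b.re - 1) / 2 with hδ
  have hb' : 1 < b.re := hb
  have hδ0 : 0 < δ := by rw [hδ]; linarith
  set U : Set ℂ := {w | 1 + δ < w.re} ∩ Metric.ball 0 (‖b‖ + 1) with hU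
  have hUo : IsOpen U :=
    (isOpen_lt continuous_const Complex.continuous_re).inter Metric.isOpen_ball
  have hbU : b ∈ U := ⟨by change 1 + δ < b.re; rw [hδ]; linarith, by simp⟩
  set R := ‖b‖ + 1
  have key : DifferentiableOn ℂ (fun w => ∑' k, transferTerm k w) U := by
    refine Complex.differentiableOn_tsum_of_summable_norm
      (u := fun k : ℕ => Real.exp (Real.pi * R) * (2 / 3 : ℝ) ^ (-R) * ((k : ℝ) + 1) ^ (-(1 + δ)))
      ((summable_rpow_succ (by linarith)).mul_left _)
      (fun k => (differentiable_transferTerm k).differentiableOn) hUo fun k w hw => ?_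
    have h1 : 1 + δ < w.re := hw.1
    have h2 : ‖w‖ < R := by simpa using hw.2
    refine (norm_transferTerm_le k w).trans ((norm_branchCLM_le k (by linarith)).trans ?_)
    have hk : (1 : ℝ) ≤ (k : ℝ) + 1 := by linarith [Nat.cast_nonneg (α := ℝ) k]
    gcongr ?_ * ?_ * ?_
    · exact Real.exp_le_exp.2 (mul_le_mul_of_nonneg_left
        ((Complex.abs_im_le_norm w).trans h2.le) Real.pi_pos.le)
    · exact Real.rpow_le_rpow_of_exponent_ge (by norm_num) (by norm_num)
        (by linarith [Complex.re_le_norm w])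
    · exact Real.rpow_le_rpow_of_exponent_le hk (by linarith)
  exact (key.differentiableAt (hUo.mem_nhds hbU)).differentiableWithinAt

theorem analyticAt_transfer {a : ℂ} (ha : 1 < a.re) : AnalyticAt ℂ transfer a :=
  differentiableOn_transfer.analyticAt
    ((isOpen_lt continuous_const Complex.continuous_re).mem_nhds ha)

theorem hasSum_transfer_apply {a : ℂ} (ha : 1 < a.re) (g : ℕ →ᵇ ℂ) :
    HasSum (fun k => g k • branchCLM k a) (transfer a g) := by
  have h := (summable_transferTerm ha).hasSum
  exact h.mapL (ContinuousLinearMap.apply ℂ (HInf →L[ℂ] HInf) g)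

theorem hasSum_value_transfer {a : ℂ} (ha : 1 < a.re) (g : ℕ →ᵇ ℂ) (f : HInf) {z : ℂ}
    (hz : z ∈ disc) :
    HasSum (fun k => g k * (weight k a z * value f (1 / (z + (k + 1 : ℕ)))))
      (value (transfer a g f) z) := by
  have h := ((hasSum_transfer_apply ha g).mapL (ContinuousLinearMap.apply ℂ HInf f)).mapL (evalL z)
  refine h.congr_fun fun k => ?_
  change _ = value (g k • branchCLM k a f) z
  rw [value_smul, value_branchCLM k a f hz]

/-- The cost function as a bounded sequence. -/
def costSeq (c : ℕ → ℝ) (M : ℝ) (hM : ∀ n, 1 ≤ n → |c n| ≤ M) : ℕ →ᵇ ℂ :=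
  BoundedContinuousFunction.ofNormedAddCommGroupDiscrete (fun k => (c (k + 1) : ℂ)) M fun k => by
    rw [Complex.norm_real]; exact hM _ (Nat.succ_pos k)

/-- Evaluation at `k` is a continuous ring homomorphism, hence commutes with the exponential. The
factors `e^{ω c(n)}` thus form the exponential of `ω c` in the Banach algebra of bounded sequences,
which is entire in `ω`; this separates the `ω`-dependence from the exponent handled by `transfer`.
-/
theorem exp_smul_costSeq_apply (c : ℕ → ℝ) (M : ℝ) (hM : ∀ n, 1 ≤ n → |c n| ≤ M) (ω : ℂ) (k : ℕ) :
    NormedSpace.exp (ω • costSeq c M hM) k = Complex.exp (ω * c (k + 1)) := by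
  let φ : (ℕ →ᵇ ℂ) →+* ℂ :=
    { toFun := fun g => g k
      map_one' := rfl
      map_mul' := fun _ _ => rfl
      map_zero' := rfl
      map_add' := fun _ _ => rfl }
  have hφ : Continuous φ := (BoundedContinuousFunction.evalCLM ℂ k).continuous
  have h := NormedSpace.map_exp φ hφ (ω • costSeq c M hM)
  rw [← Complex.exp_eq_exp_ℂ] at h
  exact h

/-- The indicator sequence of the branches `n ≥ 2`. -/
def tailSeq : ℕ →ᵇ ℂ :=
  BoundedContinuousFunction.ofNormedAddCommGroupDiscrete (fun k => if k = 0 then 0 else 1) 1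
    fun k => by split_ifs <;> simp

theorem IsBranchSum.unique {c : ℕ → ℝ} {m : ℕ} {s ω : ℂ} {A B : HInf →L[ℂ] HInf}
    (hA : IsBranchSum c m s ω A) (hB : IsBranchSum c m s ω B) : A = B := by
  refine ContinuousLinearMap.ext fun f => HInf.ext_value fun z hz => ?_
  exact (hA f z hz).unique (hB f z hz)

theorem opL_eq_transfer {c : ℕ → ℝ} {M : ℝ} (hM : ∀ n, 1 ≤ n → |c n| ≤ M) {s ω : ℂ}
    (hs : 1 < (2 * s + mean c * ω).re) :
    opL c s ω = transfer (2 * s + mean c * ω) (NormedSpace.exp (ω • costSeq c M hM)) := by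
  refine IsBranchSum.unique (isBranchSum_branchOp c hM le_rfl s ω hs) fun f z hz => ?_
  refine (hasSum_value_transfer hs _ f hz).congr_fun fun k => ?_
  rw [exp_smul_costSeq_apply, weight_eq hz, branch]
  ring

theorem opF_eq_transfer {c : ℕ → ℝ} {M : ℝ} (hM : ∀ n, 1 ≤ n → |c n| ≤ M) {s ω : ℂ}
    (hs : 1 < (2 * s + mean c * ω).re) :
    opF c s ω = transfer (2 * s + mean c * ω) (tailSeq * NormedSpace.exp (ω • costSeq c M hM)) := by
  refine IsBranchSum.unique (isBranchSum_branchOp c hM one_le_two s ω hs) fun f z hz => ?_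
  have h := hasSum_value_transfer hs (tailSeq * NormedSpace.exp (ω • costSeq c M hM)) f hz
  -- `tailSeq` kills the term of index `0`, that is the branch `n = 1`; after the shift the index
  -- `k` stands for `n = k + 2`.
  rw [← hasSum_nat_add_iff' 1] at h
  simp only [Finset.range_one, Finset.sum_singleton] at h
  have h0 : (tailSeq * NormedSpace.exp (ω • costSeq c M hM)) 0 = 0 := by
    rw [BoundedContinuousFunction.mul_apply]
    simp [tailSeq]
  rw [h0, zero_mul, sub_zero] at h
  refine h.congr_fun fun k => ?_
  have h1 : tailSeq (k + 1) = 1 := rfl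
  rw [BoundedContinuousFunction.mul_apply, exp_smul_costSeq_apply, weight_eq hz, branch, h1,
    one_mul, show k + 1 + 1 = k + 2 from rfl]
  ring

theorem hasSum_value_opL {c : ℕ → ℝ} {M : ℝ} (hM : ∀ n, 1 ≤ n → |c n| ≤ M) {s ω : ℂ}
    (hs : 1 < (2 * s + mean c * ω).re) (f : HInf) {z : ℂ} (hz : z ∈ disc) :
    HasSum (fun k : ℕ => branch c s ω (k + 1) f z) (value (opL c s ω f) z) :=
  isBranchSum_branchOp c hM le_rfl s ω hs f z hz

theorem hasSum_value_opF {c : ℕ → ℝ} {M : ℝ} (hM : ∀ n, 1 ≤ n → |c n| ≤ M) {s ω : ℂ}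
    (hs : 1 < (2 * s + mean c * ω).re) (f : HInf) {z : ℂ} (hz : z ∈ disc) :
    HasSum (fun k : ℕ => branch c s ω (k + 2) f z) (value (opF c s ω f) z) :=
  isBranchSum_branchOp c hM one_le_two s ω hs f z hz

theorem analyticAt_transfer_family {c : ℕ → ℝ} {M : ℝ} (hM : ∀ n, 1 ≤ n → |c n| ≤ M) {s ω : ℂ}
    (hs : 1 < (2 * s + mean c * ω).re) (T : ℕ →ᵇ ℂ) :
    AnalyticAt ℂ (fun x : ℂ × ℂ => transfer (2 * x.1 + mean c * x.2)
      (T * NormedSpace.exp (x.2 • costSeq c M hM))) (s, ω) := by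
  have h1 : AnalyticAt ℂ (fun x : ℂ × ℂ => 2 * x.1 + mean c * x.2) (s, ω) :=
    (analyticAt_const.mul analyticAt_fst).add (analyticAt_const.mul analyticAt_snd)
  have h2 : AnalyticAt ℂ (fun x : ℂ × ℂ => transfer (2 * x.1 + mean c * x.2)) (s, ω) :=
    AnalyticAt.comp (f := fun x : ℂ × ℂ => 2 * x.1 + mean c * x.2) (analyticAt_transfer hs) h1
  have h3 : AnalyticAt ℂ (fun x : ℂ × ℂ => x.2 • costSeq c M hM) (s, ω) :=
    analyticAt_snd.smul analyticAt_const
  have h4 : AnalyticAt ℂ (fun x : ℂ × ℂ => T * NormedSpace.exp (x.2 • costSeq c M hM)) (s, ω) :=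
    analyticAt_const.mul (AnalyticAt.comp (f := fun x : ℂ × ℂ => x.2 • costSeq c M hM)
      (NormedSpace.exp_analytic (𝕂 := ℂ) _) h3)
  exact (ContinuousLinearMap.analyticAt_bilinear
    (ContinuousLinearMap.id ℂ ((ℕ →ᵇ ℂ) →L[ℂ] HInf →L[ℂ] HInf)) _).comp₂ h2 h4

theorem eventually_re_gt {c : ℕ → ℝ} {s ω : ℂ} (hs : 1 < (2 * s + mean c * ω).re) :
    ∀ᶠ x : ℂ × ℂ in 𝓝 (s, ω), 1 < (2 * x.1 + mean c * x.2).re :=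
  (Complex.continuous_re.comp (by fun_prop : Continuous fun x : ℂ × ℂ =>
    2 * x.1 + mean c * x.2)).continuousAt.eventually_const_lt hs

theorem analyticAt_opL {c : ℕ → ℝ} {M : ℝ} (hM : ∀ n, 1 ≤ n → |c n| ≤ M) {s ω : ℂ}
    (hs : 1 < (2 * s + mean c * ω).re) : AnalyticAt ℂ (fun x : ℂ × ℂ => opL c x.1 x.2) (s, ω) := by
  refine (analyticAt_transfer_family hM hs 1).congr ?_
  filter_upwards [eventually_re_gt hs] with x hx
  rw [one_mul, opL_eq_transfer hM hx]

theorem analyticAt_opF {c : ℕ → ℝ} {M : ℝ} (hM : ∀ n, 1 ≤ n → |c n| ≤ M) {s ω : ℂ}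
    (hs : 1 < (2 * s + mean c * ω).re) : AnalyticAt ℂ (fun x : ℂ × ℂ => opF c x.1 x.2) (s, ω) := by
  refine (analyticAt_transfer_family hM hs tailSeq).congr ?_
  filter_upwards [eventually_re_gt hs] with x hx
  rw [opF_eq_transfer hM hx]

/-! ### Compactness -/

theorem value_coe_add (f g : HInf) : value (f + g) = value f + value g :=
  funext fun z => value_add f g z

theorem value_coe_smul (a : ℂ) (f : HInf) : value (a • f) = a • value f :=
  funext fun z => value_smul a f z

theorem contDiffAt_value (f : HInf) {z : ℂ} (hz : z ∈ disc) (n : WithTop ℕ∞) :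
    ContDiffAt ℂ n (value f) z :=
  ((differentiableOn_value f).analyticAt (isOpen_disc.mem_nhds hz)).contDiffAt

/-- Cauchy's estimate. The radius `11/12` is below `1`, so that the closed disc fits into the
domain, and above the `5/6` of `norm_inv_add_sub_le`, so that Taylor series decay on the branch
images with ratio `(5/6) / (11/12) = 10/11`. -/
theorem norm_iteratedDeriv_center_le (f : HInf) (j : ℕ) :
    ‖iteratedDeriv j (value f) (2 / 3)‖ ≤ j.factorial * ‖f‖ / (11 / 12) ^ j := by
  have hsub : Metric.closedBall (2 / 3 : ℂ) (11 / 12) ⊆ disc :=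
    Metric.closedBall_subset_ball (by norm_num)
  refine Complex.norm_iteratedDeriv_le_of_forall_mem_sphere_norm_le j (by norm_num) ?_
    fun z _ => norm_value_le f z
  exact ((differentiableOn_value f).mono hsub).diffContOnCl_ball subset_rfl

/-- The functional sending `f` to its `j`-th Taylor coefficient at the centre of the disc. -/
def taylorCoeff (j : ℕ) : HInf →L[ℂ] ℂ :=
  LinearMap.mkContinuous
    ({ toFun := fun f => (j.factorial : ℂ)⁻¹ * iteratedDeriv j (value f) (2 / 3)
       map_add' := fun f g => by
        rw [value_coe_add, iteratedDeriv_add (contDiffAt_value f two_thirds_mem _)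
          (contDiffAt_value g two_thirds_mem _), mul_add]
       map_smul' := fun a f => by
        rw [value_coe_smul, iteratedDeriv_const_smul_field]
        simp only [smul_eq_mul, RingHom.id_apply]
        ring } : HInf →ₗ[ℂ] ℂ) (((12 : ℝ) / 11) ^ j) fun f => by
    change ‖(j.factorial : ℂ)⁻¹ * iteratedDeriv j (value f) (2 / 3)‖ ≤ _
    have hj : (0 : ℝ) < j.factorial := by exact_mod_cast j.factorial_pos
    rw [norm_mul, norm_inv, Complex.norm_natCast, inv_mul_le_iff₀ hj]
    refine (norm_iteratedDeriv_center_le f j).trans (le_of_eq ?_)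
    rw [div_eq_mul_inv, ← inv_pow, show ((11 : ℝ) / 12)⁻¹ = 12 / 11 by norm_num]
    ring

theorem norm_taylorCoeff_apply_le (j : ℕ) (f : HInf) :
    ‖taylorCoeff j f‖ ≤ ((12 : ℝ) / 11) ^ j * ‖f‖ :=
  (taylorCoeff j).le_of_opNorm_le (LinearMap.mkContinuous_norm_le _ (by positivity) _) f

theorem hasSum_taylorCoeff (f : HInf) {w : ℂ} (hw : w ∈ disc) :
    HasSum (fun j => taylorCoeff j f * (w - 2 / 3) ^ j) (value f w) := by
  have h := Complex.hasSum_taylorSeries_on_ball (f := value f) (c := 2 / 3) (r := 1)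
    (differentiableOn_value f) (z := w) hw
  refine h.congr_fun fun j => ?_
  change (j.factorial : ℂ)⁻¹ * iteratedDeriv j (value f) (2 / 3) * (w - 2 / 3) ^ j = _
  simp only [smul_eq_mul]
  ring

/-- The function `z ↦ (z - 2/3)^j`. -/
def centeredPow (j : ℕ) : HInf :=
  mkH (fun z => (z - 2 / 3) ^ j) (by fun_prop) 1 fun z hz => by
    have h1 : ‖z - 2 / 3‖ < 1 := by simpa [disc, dist_eq_norm] using hz
    rw [norm_pow]
    exact pow_le_one₀ (norm_nonneg _) h1.le

/-- The Taylor polynomial of degree less than `J`. -/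
def taylorPoly (J : ℕ) : HInf →L[ℂ] HInf :=
  ∑ j ∈ Finset.range J, (taylorCoeff j).smulRight (centeredPow j)

theorem value_taylorPoly (J : ℕ) (f : HInf) {w : ℂ} (hw : w ∈ disc) :
    value (taylorPoly J f) w = ∑ j ∈ Finset.range J, taylorCoeff j f * (w - 2 / 3) ^ j := by
  rw [taylorPoly, sum_apply, ← evalL_apply, map_sum]
  refine Finset.sum_congr rfl fun j _ => ?_
  rw [ContinuousLinearMap.smulRight_apply, evalL_apply, value_smul, centeredPow, value_mkH hw]

theorem isCompactOperator_smulRight {X Y : Type*} [NormedAddCommGroup X] [NormedSpace ℂ X]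
    [NormedAddCommGroup Y] [NormedSpace ℂ Y] (φ : X →L[ℂ] ℂ) (y : Y) :
    IsCompactOperator (φ.smulRight y) :=
  (isCompactOperator_of_locallyCompactSpace_rng
    ((ContinuousLinearMap.id ℂ ℂ).smulRight y)).comp_clm φ

theorem isCompactOperator_sum {X Y ι : Type*} [NormedAddCommGroup X] [NormedSpace ℂ X]
    [NormedAddCommGroup Y] [NormedSpace ℂ Y] (s : Finset ι) (T : ι → X →L[ℂ] Y)
    (hT : ∀ i, IsCompactOperator (T i)) : IsCompactOperator (∑ i ∈ s, T i : X →L[ℂ] Y) :=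
  Submodule.sum_mem (compactOperator (RingHom.id ℂ) X Y) (t := s)
    (f := fun i => (T i : X →L[ℂ] Y)) fun i _ => hT i

/-- The source of compactness: all branches map the disc into one concentric disc of smaller radius.
From `Re w > 2/3` the point `1/w` lies in the disc with diameter `[0, 3/2]`, whose points have
distance at most `5/6` from `2/3`. -/
theorem norm_inv_add_sub_le {z : ℂ} (hz : z ∈ disc) (k : ℕ) :
    ‖1 / (z + (k + 1 : ℕ)) - 2 / 3‖ ≤ 5 / 6 := by
  have hre := re_add_ge hz (Nat.succ_pos k : 1 ≤ k + 1)
  have hn' : (1 : ℝ) ≤ (k + 1 : ℕ) := by exact_mod_cast Nat.succ_pos k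
  have hw0 := add_succ_ne_zero hz k
  set w : ℂ := z + (k + 1 : ℕ) with hw
  have hpos : 0 < ‖w‖ := norm_pos_iff.2 hw0
  have e : 1 / w - 2 / 3 = (3 - 2 * w) / (3 * w) := by field_simp
  rw [e, norm_div, norm_mul]
  have h3 : ‖(3 : ℂ)‖ = 3 := by simp
  rw [h3, div_le_iff₀ (by positivity)]
  refine le_of_sq_le_sq ?_ (by positivity)
  have a1 : ‖3 - 2 * w‖ ^ 2 = (3 - 2 * w.re) ^ 2 + (2 * w.im) ^ 2 := by
    rw [← Complex.normSq_eq_norm_sq, Complex.normSq_apply]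
    simp; ring
  have a2 : ‖w‖ ^ 2 = w.re ^ 2 + w.im ^ 2 := by
    rw [← Complex.normSq_eq_norm_sq, Complex.normSq_apply]; ring
  have : (5 / 6 * (3 * ‖w‖)) ^ 2 = 25 / 4 * ‖w‖ ^ 2 := by ring
  rw [this, a1, a2]
  nlinarith [sq_nonneg w.im, sq_nonneg (w.re - 2 / 3)]

theorem norm_sub_taylorPoly_le (J : ℕ) (f : HInf) {w : ℂ} (hw : w ∈ disc)
    (hw' : ‖w - 2 / 3‖ ≤ 5 / 6) :
    ‖value (f - taylorPoly J f) w‖ ≤ 11 * (10 / 11) ^ J * ‖f‖ := by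
  have h := (hasSum_nat_add_iff' J).2 (hasSum_taylorCoeff f hw)
  rw [← value_taylorPoly J f hw, ← value_sub] at h
  have hg : HasSum (fun j : ℕ => (10 / 11 : ℝ) ^ J * ‖f‖ * (10 / 11) ^ j)
      ((10 / 11 : ℝ) ^ J * ‖f‖ * (1 - 10 / 11)⁻¹) :=
    (hasSum_geometric_of_lt_one (by norm_num) (by norm_num)).mul_left _
  have hle := h.norm_le_of_bounded hg fun j => by
    rw [norm_mul, norm_pow]
    calc ‖taylorCoeff (j + J) f‖ * ‖w - 2 / 3‖ ^ (j + J)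
        ≤ ((12 : ℝ) / 11) ^ (j + J) * ‖f‖ * (5 / 6) ^ (j + J) := by
          gcongr
          exact norm_taylorCoeff_apply_le _ f
      _ = ((12 : ℝ) / 11 * (5 / 6)) ^ (j + J) * ‖f‖ := by rw [mul_pow]; ring
      _ = _ := by
          rw [show ((12 : ℝ) / 11 * (5 / 6)) = 10 / 11 by norm_num, pow_add]; ring
  refine hle.trans (le_of_eq ?_)
  rw [show ((1 : ℝ) - 10 / 11)⁻¹ = 11 by norm_num]
  generalize ‖f‖ = t
  ring

/-- Replacing `f` by its Taylor polynomial gives finite rank operators converging in norm, because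
the branch evaluates `f` only where the Taylor series converges geometrically. -/
theorem isCompactOperator_branchCLM (k : ℕ) (a : ℂ) : IsCompactOperator (branchCLM k a) := by
  have hT : Tendsto (fun J => branchCLM k a ∘L taylorPoly J) atTop (𝓝 (branchCLM k a)) := by
    rw [tendsto_iff_norm_sub_tendsto_zero]
    have hC : Tendsto (fun J : ℕ => Real.exp (‖a‖ * logBound k) * (11 * (10 / 11 : ℝ) ^ J)) atTop
        (𝓝 (Real.exp (‖a‖ * logBound k) * (11 * 0))) :=
      ((tendsto_pow_atTop_nhds_zero_of_lt_one (by norm_num) (by norm_num)).const_mul _).const_mul _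
    rw [mul_zero, mul_zero] at hC
    refine squeeze_zero (fun _ => norm_nonneg _) (fun J => ?_) hC
    rw [norm_sub_rev]
    refine opNorm_le_of_value (by positivity) fun f z hz => ?_
    have e : (branchCLM k a - branchCLM k a ∘L taylorPoly J) f =
        branchCLM k a (f - taylorPoly J f) := by
      rw [sub_apply, map_sub, ContinuousLinearMap.comp_apply]
    rw [e, value_branchCLM _ _ _ hz, norm_mul, mul_assoc]
    exact mul_le_mul (norm_weight_le_exp hz k a) (norm_sub_taylorPoly_le J f
      (inv_add_mem hz (Nat.succ_pos k)) (norm_inv_add_sub_le hz k)) (norm_nonneg _)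
      (Real.exp_pos _).le
  refine isCompactOperator_of_tendsto hT (Eventually.of_forall fun J => ?_)
  exact (isCompactOperator_sum _ _ fun j => isCompactOperator_smulRight _ _).clm_comp
    (branchCLM k a)

theorem isCompactOperator_transfer {a : ℂ} (ha : 1 < a.re) (g : ℕ →ᵇ ℂ) :
    IsCompactOperator (transfer a g) :=
  isCompactOperator_of_tendsto (hasSum_transfer_apply ha g) (Eventually.of_forall fun s =>
    isCompactOperator_sum s _ fun k => (isCompactOperator_branchCLM k a).smul (g k))

theorem isCompactOperator_opL {c : ℕ → ℝ} {M : ℝ} (hM : ∀ n, 1 ≤ n → |c n| ≤ M) {s ω : ℂ}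
    (hs : 1 < (2 * s + mean c * ω).re) : IsCompactOperator (opL c s ω) := by
  rw [opL_eq_transfer hM hs]
  exact isCompactOperator_transfer hs _

/-! ### A maximum principle on the unit interval -/

/-- The transition probability `(1 + x) / ((x + k + 1)(x + k + 2))` of the branch `k`. -/
def gaussWeight (k : ℕ) (x : ℝ) : ℝ := (1 + x) / ((x + k + 1) * (x + k + 2))

theorem gaussWeight_pos (k : ℕ) {x : ℝ} (hx : 0 ≤ x) : 0 < gaussWeight k x := by
  unfold gaussWeight; positivity

/-- The sum telescopes, as `1/((x+k+1)(x+k+2))` is a difference of consecutive reciprocals. -/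
theorem hasSum_gaussWeight {x : ℝ} (hx : 0 ≤ x) : HasSum (fun k => gaussWeight k x) 1 := by
  rw [hasSum_iff_tendsto_nat_of_nonneg fun k => (gaussWeight_pos k hx).le]
  have h : ∀ K : ℕ, ∑ k ∈ Finset.range K, gaussWeight k x = 1 - (1 + x) * (1 / (x + K + 1)) := by
    intro K
    induction K with
    | zero =>
      have : 1 + x ≠ 0 := by positivity
      simp only [Finset.range_zero, Finset.sum_empty, Nat.cast_zero, add_zero]
      rw [add_comm x 1, mul_one_div_cancel this, sub_self]
    | succ K ih =>
      rw [Finset.sum_range_succ, ih, gaussWeight]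
      push_cast
      have h1 : x + K + 1 ≠ 0 := by positivity
      have h2 : x + K + 2 ≠ 0 := by positivity
      have h3 : x + (K + 1) + 1 = x + K + 2 := by ring
      rw [h3]
      field_simp
      ring
  simp only [h]
  have ht : Tendsto (fun K : ℕ => 1 / (x + K + 1)) atTop (𝓝 0) := by
    simp only [one_div]
    refine tendsto_inv_atTop_zero.comp (tendsto_atTop_mono (f := fun K : ℕ => (K : ℝ)) ?_
      tendsto_natCast_atTop_atTop)
    intro K
    linarith
  have := (ht.const_mul (1 + x)).const_sub 1
  simpa using this

theorem inv_add_mem_Icc {x : ℝ} (hx : x ∈ Icc (0 : ℝ) 1) (k : ℕ) :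
    1 / (x + k + 1) ∈ Icc (0 : ℝ) 1 := by
  have h0 : 0 ≤ x := hx.1
  refine ⟨by positivity, ?_⟩
  rw [div_le_one (by positivity)]
  linarith [Nat.cast_nonneg (α := ℝ) k]

/-- If a convex combination of vectors of norm at most `‖b‖` is `b`, all of them are `b`. -/
theorem eq_of_hasSum_convex {p : ℕ → ℝ} (hp : ∀ k, 0 < p k) (hp1 : HasSum p 1) {a : ℕ → ℂ} {b : ℂ}
    (ha : ∀ k, ‖a k‖ ≤ ‖b‖) (h : HasSum (fun k => (p k : ℂ) * a k) b) (k : ℕ) : a k = b := by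
  -- The numbers `Re (conj b · a k)` are at most `‖b‖²` and average to `‖b‖²`, so each equals it;
  -- this is the equality case of Cauchy–Schwarz.
  have hre : HasSum (fun k => p k * (‖b‖ ^ 2 - ((starRingEnd ℂ) b * a k).re)) 0 := by
    have h1 : HasSum (fun k => p k * ‖b‖ ^ 2) (1 * ‖b‖ ^ 2) := hp1.mul_right _
    have h2 := (h.mul_left ((starRingEnd ℂ) b)).mapL Complex.reCLM
    have h3 := h1.sub h2
    have e0 : 1 * ‖b‖ ^ 2 - Complex.reCLM ((starRingEnd ℂ) b * b) = 0 := by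
      rw [mul_comm, mul_comm _ b, Complex.mul_conj, Complex.normSq_eq_norm_sq, Complex.reCLM_apply,
        Complex.ofReal_re, mul_one, sub_self]
    rw [e0] at h3
    refine h3.congr_fun fun k => ?_
    have : (starRingEnd ℂ) b * ((p k : ℂ) * a k) = (p k : ℂ) * ((starRingEnd ℂ) b * a k) := by ring
    rw [this, Complex.reCLM_apply, Complex.re_ofReal_mul]
    ring
  have hle : ∀ k, ((starRingEnd ℂ) b * a k).re ≤ ‖b‖ ^ 2 := fun k => by
    refine (Complex.re_le_norm _).trans ?_
    rw [norm_mul, RCLike.norm_conj, sq]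
    exact mul_le_mul_of_nonneg_left (ha k) (norm_nonneg _)
  have hz := (hasSum_zero_iff_of_nonneg fun k => mul_nonneg (hp k).le (sub_nonneg.2 (hle k))).1 hre
  have hk : ‖b‖ ^ 2 - ((starRingEnd ℂ) b * a k).re = 0 :=
    (mul_eq_zero.1 (congrFun hz k)).resolve_left (hp k).ne'
  have e : ‖a k - b‖ ^ 2 = ‖a k‖ ^ 2 + ‖b‖ ^ 2 - 2 * ((starRingEnd ℂ) b * a k).re := by
    simp only [← Complex.normSq_eq_norm_sq, Complex.normSq_apply]
    simp
    ring
  have h2 : ‖a k‖ ^ 2 ≤ ‖b‖ ^ 2 := pow_le_pow_left₀ (norm_nonneg _) (ha k) 2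
  have h3 : ‖a k - b‖ ^ 2 ≤ 0 := by rw [e]; linarith
  have h4 : ‖a k - b‖ = 0 := by nlinarith [norm_nonneg (a k - b)]
  exact sub_eq_zero.1 (norm_eq_zero.1 h4)

/-- At a point where `‖g‖` is maximal, `lam * g x` is a convex combination of vectors no longer than
itself, and strict convexity of the disc makes all of them equal to it. -/
theorem max_principle {g : ℝ → ℂ} (hg : ContinuousOn g (Icc 0 1)) {lam : ℂ} (hlam : 1 ≤ ‖lam‖)
    {θ : ℕ → ℝ → ℂ} (hθ : ∀ k, ∀ x ∈ Icc (0 : ℝ) 1, ‖θ k x‖ ≤ 1)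
    (h : ∀ x ∈ Icc (0 : ℝ) 1,
      HasSum (fun k => (gaussWeight k x : ℂ) * (θ k x * g (1 / (x + k + 1)))) (lam * g x)) :
    (∀ x ∈ Icc (0 : ℝ) 1, g x = 0) ∨ ∃ x ∈ Icc (0 : ℝ) 1, g x ≠ 0 ∧
      (∀ y ∈ Icc (0 : ℝ) 1, ‖g y‖ ≤ ‖g x‖) ∧ ∀ k, θ k x * g (1 / (x + k + 1)) = lam * g x := by
  obtain ⟨x, hx, hmax⟩ := isCompact_Icc.exists_isMaxOn ⟨0, by simp⟩ hg.norm
  have hmax' : ∀ y ∈ Icc (0 : ℝ) 1, ‖g y‖ ≤ ‖g x‖ := fun y hy => hmax hy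
  by_cases h0 : g x = 0
  · left
    intro y hy
    have := hmax' y hy
    rw [h0, norm_zero] at this
    exact norm_le_zero_iff.1 this
  · right
    refine ⟨x, hx, h0, hmax', fun k => ?_⟩
    refine eq_of_hasSum_convex (fun k => gaussWeight_pos k hx.1) (hasSum_gaussWeight hx.1)
      (fun k => ?_) (h x hx) k
    rw [norm_mul, norm_mul]
    calc ‖θ k x‖ * ‖g (1 / (x + k + 1))‖ ≤ 1 * ‖g x‖ := by
          gcongr
          · exact hθ k x hx
          · exact hmax' _ (inv_add_mem_Icc hx k)
      _ ≤ ‖lam‖ * ‖g x‖ := by gcongr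

theorem tendsto_inv_add {x : ℝ} : Tendsto (fun k : ℕ => 1 / (x + k + 1)) atTop (𝓝 0) := by
  simp only [one_div]
  refine tendsto_inv_atTop_zero.comp ?_
  exact tendsto_atTop_add_const_right _ _
    (tendsto_atTop_add_const_left _ _ tendsto_natCast_atTop_atTop)

theorem tendsto_comp_inv_add {g : ℝ → ℂ} (hg : ContinuousOn g (Icc 0 1)) {x : ℝ}
    (hx : x ∈ Icc (0 : ℝ) 1) :
    Tendsto (fun k : ℕ => g (1 / (x + k + 1))) atTop (𝓝 (g 0)) := by
  have h0 : ContinuousWithinAt g (Icc 0 1) 0 := hg 0 (by simp)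
  refine h0.tendsto.comp (tendsto_nhdsWithin_iff.2 ⟨tendsto_inv_add, ?_⟩)
  exact Eventually.of_forall fun k => inv_add_mem_Icc hx k

/-- Continuous harmonic functions of the Gauss transition operator are constant. -/
theorem eq_const_of_harmonic {g : ℝ → ℂ} (hg : ContinuousOn g (Icc 0 1))
    (h : ∀ x ∈ Icc (0 : ℝ) 1,
      HasSum (fun k => (gaussWeight k x : ℂ) * g (1 / (x + k + 1))) (g x)) :
    ∀ x ∈ Icc (0 : ℝ) 1, g x = g 0 := by
  have hg' : ContinuousOn (fun x => g x - g 0) (Icc 0 1) := hg.sub continuousOn_const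
  have key := max_principle hg' (lam := 1) (by simp) (θ := fun _ _ => 1) (by simp) fun x hx => by
    have h1 := (h x hx).sub
      ((Complex.hasSum_ofReal.2 (hasSum_gaussWeight hx.1)).mul_right (g 0))
    rw [Complex.ofReal_one, one_mul] at h1
    rw [one_mul]
    refine h1.congr_fun fun k => ?_
    ring
  rcases key with h0 | ⟨x, hx, hne, -, hk⟩
  · exact fun x hx => sub_eq_zero.1 (h0 x hx)
  · exfalso
    -- The branch images of `x` tend to `0`, where `g - g 0` vanishes, although its values along
    -- them are constantly `g x - g 0 ≠ 0`.
    have ht := tendsto_comp_inv_add hg' hx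
    have hc : (fun k : ℕ => g (1 / (x + k + 1)) - g 0) = fun _ => g x - g 0 := by
      funext k
      simpa using hk k
    rw [hc, sub_self] at ht
    exact hne (tendsto_nhds_unique tendsto_const_nhds ht)

/-- The operator has no eigenvalue `λ ≠ 1` of modulus at least `1`. -/
theorem eq_zero_of_eigenvalue {g : ℝ → ℂ} (hg : ContinuousOn g (Icc 0 1)) {lam : ℂ}
    (hlam : 1 ≤ ‖lam‖) (hne : lam ≠ 1) (h : ∀ x ∈ Icc (0 : ℝ) 1,
      HasSum (fun k => (gaussWeight k x : ℂ) * g (1 / (x + k + 1))) (lam * g x)) :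
    ∀ x ∈ Icc (0 : ℝ) 1, g x = 0 := by
  rcases max_principle hg hlam (θ := fun _ _ => 1) (by simp) (by simpa using h) with
    h0 | ⟨x, hx, hx0, hmax, hk⟩
  · exact h0
  exfalso
  have hk' : ∀ k : ℕ, g (1 / (x + k + 1)) = lam * g x := fun k => by simpa using hk k
  have hg0 : g 0 = lam * g x := by
    have ht := tendsto_comp_inv_add hg hx
    simp only [hk'] at ht
    exact tendsto_nhds_unique ht tendsto_const_nhds
  have h0mem : (0 : ℝ) ∈ Icc (0 : ℝ) 1 := by simp
  have hpx : 0 < ‖g x‖ := norm_pos_iff.2 hx0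
  have hl1 : ‖lam‖ = 1 := by
    have := hmax 0 h0mem
    rw [hg0, norm_mul] at this
    nlinarith
  -- Since `g 0 = lam * g x` and `‖lam‖ = 1`, the point `0` is again a maximum. Applying the
  -- equality case there and letting `k → ∞` gives `g 0 = lam * g 0`.
  have hgz : ∀ k : ℕ, g (1 / ((0 : ℝ) + k + 1)) = lam * g 0 := fun k => by
    have := eq_of_hasSum_convex (fun k => gaussWeight_pos k le_rfl) (hasSum_gaussWeight le_rfl)
      (a := fun k : ℕ => g (1 / ((0 : ℝ) + k + 1))) (fun k => ?_) (h 0 h0mem) k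
    · exact this
    · rw [norm_mul, hg0, norm_mul, hl1, one_mul, one_mul]
      exact hmax _ (inv_add_mem_Icc h0mem k)
  have hfin : g 0 = lam * g 0 := by
    have ht := tendsto_comp_inv_add hg h0mem
    simp only [hgz] at ht
    exact (tendsto_nhds_unique ht tendsto_const_nhds)
  have hg00 : g 0 ≠ 0 := by
    rw [hg0]
    exact mul_ne_zero (fun h => by simp [h] at hl1) hx0
  apply hne
  have : (lam - 1) * g 0 = 0 := by rw [sub_mul, one_mul, ← hfin, sub_self]
  exact sub_eq_zero.1 ((mul_eq_zero.1 this).resolve_right hg00)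

/-- With the twist `(x + n)^{-τ}`, `Re τ ≥ 0`, `τ ≠ 0`, there is no eigenvalue `1`. -/
theorem eq_zero_of_twisted {g : ℝ → ℂ} (hg : ContinuousOn g (Icc 0 1)) {τ : ℂ} (hτ : 0 ≤ τ.re)
    (hτ0 : τ ≠ 0) (h : ∀ x ∈ Icc (0 : ℝ) 1,
      HasSum (fun k : ℕ => (gaussWeight k x : ℂ) *
        (Complex.exp (-(τ * Real.log (x + k + 1))) * g (1 / (x + k + 1)))) (g x)) :
    ∀ x ∈ Icc (0 : ℝ) 1, g x = 0 := by
  have hnorm : ∀ (k : ℕ) (x : ℝ), ‖Complex.exp (-(τ * Real.log (x + k + 1)))‖ =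
      Real.exp (-(τ.re * Real.log (x + k + 1))) := fun k x => by
    rw [Complex.norm_exp]; simp
  rcases max_principle hg (lam := 1) (by simp)
    (θ := fun k x => Complex.exp (-(τ * Real.log (x + k + 1))))
    (fun k x hx => by
      rw [hnorm]
      apply Real.exp_le_one_iff.2
      have : 0 ≤ Real.log (x + k + 1) :=
        Real.log_nonneg (by linarith [hx.1, Nat.cast_nonneg (α := ℝ) k])
      have := mul_nonneg hτ this
      linarith) (by simpa using h) with h0 | ⟨x, hx, hx0, hmax, hk⟩
  · exact h0
  exfalso
  simp only [one_mul] at hk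
  have hx' : 0 ≤ x := hx.1
  have ht := tendsto_comp_inv_add hg hx
  have hpx : 0 < ‖g x‖ := norm_pos_iff.2 hx0
  -- the values of `g` are determined by the phases
  have hval : ∀ k : ℕ, g (1 / (x + k + 1)) = Complex.exp (τ * Real.log (x + k + 1)) * g x := by
    intro k
    rw [← hk k, ← mul_assoc, ← Complex.exp_add, add_neg_cancel, Complex.exp_zero, one_mul]
  -- For `Re τ > 0` the branch `k = 1`, where `x + k + 1 ≥ 2`, would carry a value of modulus
  -- exceeding the maximum.
  have hre : τ.re = 0 := by
    have h1 := hmax _ (inv_add_mem_Icc hx 1)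
    rw [hval 1, norm_mul, Complex.norm_exp] at h1
    have h2 : Real.exp (τ * Real.log (x + (1 : ℕ) + 1)).re ≤ 1 := by
      by_contra hcon
      push Not at hcon
      nlinarith
    rw [Real.exp_le_one_iff] at h2
    have h3 : (τ * Real.log (x + (1 : ℕ) + 1)).re = τ.re * Real.log (x + (1 : ℕ) + 1) := by simp
    rw [h3] at h2
    have h4 : 0 < Real.log (x + (1 : ℕ) + 1) := Real.log_pos (by push_cast; linarith)
    nlinarith
  set t := τ.im with ht_def
  have ht0 : t ≠ 0 := fun h => hτ0 (Complex.ext hre h)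
  have hτt : τ = t * Complex.I := by
    apply Complex.ext <;> simp [hre, ht_def]
  have hconv : Tendsto (fun k : ℕ => Complex.exp (τ * Real.log (x + k + 1))) atTop
      (𝓝 (g 0 / g x)) := by
    have := ht.div_const (g x)
    refine this.congr fun k => ?_
    rw [hval, mul_div_cancel_right₀ _ hx0]
  set L := g 0 / g x
  have hL : ‖L‖ = 1 := by
    have h1 := hconv.norm
    have h2 : ∀ k : ℕ, ‖Complex.exp (τ * Real.log (x + k + 1))‖ = 1 := fun k => by
      rw [Complex.norm_exp]; simp [hre]
    simp only [h2] at h1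
    exact tendsto_nhds_unique h1 tendsto_const_nhds |>.symm ▸ rfl
  have hL0 : L ≠ 0 := fun h => by simp [h] at hL
  -- The phases `(x + k + 1)^τ` converge to a nonzero limit. Along `k ↦ mk + m - 1` the argument
  -- becomes `x + m(k + 1)`, so the quotient of the two phases tends both to `1` and to `m^τ`.
  have hpow : ∀ m : ℕ, 1 ≤ m → Complex.exp (τ * Real.log m) = 1 := by
    intro m hm
    have hm0 : (0 : ℝ) < m := by exact_mod_cast hm
    have hm1 : (1 : ℝ) ≤ m := by exact_mod_cast hm
    have hsub : Tendsto (fun k : ℕ => m * k + (m - 1)) atTop atTop :=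
      tendsto_atTop_mono (fun k => (Nat.le_mul_of_pos_left k hm).trans (Nat.le_add_right _ _))
        tendsto_id
    have h1 := hconv.comp hsub
    have h2 := h1.div hconv hL0
    rw [div_self hL0] at h2
    have h3 : Tendsto (fun k : ℕ => Complex.exp (τ * Real.log ((x + m * (k + 1)) / (x + k + 1))))
        atTop (𝓝 1) := by
      refine h2.congr fun k => ?_
      have hk0 : (0 : ℝ) ≤ k := Nat.cast_nonneg k
      have e : x + ((m * k + (m - 1) : ℕ) : ℝ) + 1 = x + m * (k + 1) := by
        push_cast [Nat.cast_sub hm]; ring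
      simp only [Function.comp_apply, Pi.div_apply]
      rw [e, ← Complex.exp_sub, Real.log_div (by positivity) (by positivity)]
      push_cast
      ring_nf
    have h4 : Tendsto (fun k : ℕ => (x + m * ((k : ℝ) + 1)) / (x + k + 1)) atTop (𝓝 m) := by
      have h5 : Tendsto (fun k : ℕ => (m : ℝ) - (m - 1) * x * (1 / (x + k + 1))) atTop
          (𝓝 (m - (m - 1) * x * 0)) := (tendsto_inv_add.const_mul _).const_sub _
      rw [mul_zero, sub_zero] at h5
      refine h5.congr fun k => ?_
      have hk0 : (0 : ℝ) ≤ k := Nat.cast_nonneg k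
      have : x + k + 1 ≠ 0 := by positivity
      field_simp
      ring
    have h6 : Tendsto (fun k : ℕ => Complex.exp (τ * Real.log ((x + m * (k + 1)) / (x + k + 1))))
        atTop (𝓝 (Complex.exp (τ * Real.log m))) := by
      have h7 := (Real.continuousAt_log hm0.ne').tendsto.comp h4
      have h8 := (Complex.continuous_ofReal.tendsto _).comp h7
      exact (Complex.continuous_exp.tendsto _).comp (h8.const_mul τ)
    exact tendsto_nhds_unique h6 h3
  -- The cases `m = 2` and `m = 3` make `t log 2` and `t log 3` integral multiples `a`, `b` of `2π`.
  -- Eliminating `t` gives `2^|b| = 3^|a|` with `a ≠ 0`, against unique factorisation.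
  obtain ⟨a, ha⟩ := Complex.exp_eq_one_iff.1 (hpow 2 (by norm_num))
  obtain ⟨b, hb⟩ := Complex.exp_eq_one_iff.1 (hpow 3 (by norm_num))
  have hl2 : 0 < Real.log 2 := Real.log_pos (by norm_num)
  have hl3 : 0 < Real.log 3 := Real.log_pos (by norm_num)
  have him : ∀ (r : ℝ) (m : ℤ), τ * r = m * (2 * Real.pi * Complex.I) →
      t * r = m * (2 * Real.pi) := fun r m h => by
    rw [hτt] at h
    simpa using congrArg Complex.im h
  have ha' : t * Real.log 2 = a * (2 * Real.pi) := by exact_mod_cast him _ a ha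
  have hb' : t * Real.log 3 = b * (2 * Real.pi) := by exact_mod_cast him _ b hb
  have ha0 : a ≠ 0 := by
    rintro rfl
    have : t * Real.log 2 = 0 := by rw [ha']; simp
    exact (mul_ne_zero ht0 hl2.ne') this
  have hab : (b : ℝ) * Real.log 2 = a * Real.log 3 := by
    have h1 : t * ((b : ℝ) * Real.log 2 - a * Real.log 3) = 0 := by
      have : t * ((b : ℝ) * Real.log 2 - a * Real.log 3) =
        b * (t * Real.log 2) - a * (t * Real.log 3) := by ring
      rw [this, ha', hb']; ring
    exact sub_eq_zero.1 ((mul_eq_zero.1 h1).resolve_left ht0)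
  have hnat : (b.natAbs : ℝ) * Real.log 2 = a.natAbs * Real.log 3 := by
    rw [Nat.cast_natAbs, Nat.cast_natAbs, Int.cast_abs, Int.cast_abs]
    have h1 := congrArg abs hab
    rwa [abs_mul, abs_mul, abs_of_pos hl2, abs_of_pos hl3] at h1
  rw [← Real.log_pow, ← Real.log_pow] at hnat
  have hpows : (2 : ℝ) ^ b.natAbs = 3 ^ a.natAbs :=
    Real.log_injOn_pos (by simp) (by simp) hnat
  have hpowsN : 2 ^ b.natAbs = 3 ^ a.natAbs := by exact_mod_cast hpows
  have ha1 : a.natAbs ≠ 0 := Int.natAbs_ne_zero.2 ha0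
  have h3dvd : 3 ∣ 2 ^ b.natAbs := hpowsN ▸ dvd_pow_self 3 ha1
  have := Nat.Prime.dvd_of_dvd_pow Nat.prime_three h3dvd
  omega

/-! ### Analytic perturbation of a simple dominant eigenvalue -/

section Perturbation

open scoped ContDiff

variable {X : Type*} [NormedAddCommGroup X] [NormedSpace ℂ X] [CompleteSpace X]

/-- Gelfand's formula. Smallness of the norm of one fixed power is an open condition, which survives
perturbation and gives back the spectral radius bound through `spectralRadius_lt_one_of_norm_pow`.
-/
theorem exists_norm_pow_lt_one {a : X →L[ℂ] X} (ha : spectralRadius ℂ a < 1) :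
    ∃ k : ℕ, k ≠ 0 ∧ ‖a ^ k‖ < 1 := by
  have h := spectrum.pow_nnnorm_pow_one_div_tendsto_nhds_spectralRadius a
  obtain ⟨k, hk, hk0⟩ := ((h.eventually_lt_const ha).and (eventually_ne_atTop 0)).exists
  refine ⟨k, hk0, ?_⟩
  by_contra hcon
  push Not at hcon
  have h1 : (1 : ENNReal) ≤ ‖a ^ k‖₊ := by exact_mod_cast hcon
  have := ENNReal.one_le_rpow h1 (z := 1 / (k : ℝ)) (by positivity)
  exact absurd hk (not_lt.2 this)

theorem spectralRadius_lt_one_of_norm_pow [Nontrivial X] {a : X →L[ℂ] X} {k : ℕ} (hk : k ≠ 0)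
    (h : ‖a ^ k‖ < 1) : spectralRadius ℂ a < 1 := by
  refine spectrum.spectralRadius_lt_of_forall_lt (r := 1) a fun z hz => ?_
  have h1 : ‖z ^ k‖ ≤ ‖a ^ k‖ := spectrum.norm_le_norm_of_mem (spectrum.pow_mem_pow a k hz)
  rw [norm_pow] at h1
  have h2 : ‖z‖ ^ k < 1 := h1.trans_lt h
  exact_mod_cast (pow_lt_one_iff_of_nonneg (norm_nonneg _) hk).1 h2

/-- The eigenvalue, eigenprojection and remainder at a point of a perturbed family. -/
structure IsDominantSplitting (L : X →L[ℂ] X) (lam : ℂ) (P N : X →L[ℂ] X) : Prop where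
  decomp : L = lam • P + N
  P_comp_N : P.comp N = 0
  N_comp_P : N.comp P = 0
  P_idem : P.comp P = P
  P_rank : Module.finrank ℂ (LinearMap.range (P : X →ₗ[ℂ] X)) = 1
  P_range : LinearMap.range (P : X →ₗ[ℂ] X) = Module.End.eigenspace (L : X →ₗ[ℂ] X) lam
  N_radius : spectralRadius ℂ N < 1

/-- A right eigenvector `h` and a left eigenvector `φ` with `φ h = 1` determine the rank one
projection. It exhausts the eigenspace: for an eigenvector `f` the difference `f - P f` satisfies `N
g = lam • g`, and `g ≠ 0` would give `‖lam‖ ^ k ≤ ‖N ^ k‖ < ρ`. -/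
theorem isDominantSplitting_of_eigen {L : X →L[ℂ] X} {lam : ℂ} {h : X} {φ : X →L[ℂ] ℂ}
    (hh : L h = lam • h) (hφ : ∀ y, φ (L y) = lam * φ y) (hφh : φ h = 1) {k : ℕ} (hk : k ≠ 0) {ρ : ℝ}
    (hρ : ρ < 1) (hN : ‖(L - lam • φ.smulRight h) ^ k‖ < ρ) (hlam : ρ < ‖lam‖ ^ k) :
    IsDominantSplitting L lam (φ.smulRight h) (L - lam • φ.smulRight h) := by
  have hne : h ≠ 0 := fun h0 => by simp [h0] at hφh
  have : Nontrivial X := ⟨h, 0, hne⟩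
  set P := φ.smulRight h with hP
  set N := L - lam • P with hNdef
  have hPy : ∀ y, P y = φ y • h := fun y => rfl
  have hNy : ∀ y, N y = L y - lam • φ y • h := fun y => rfl
  have hrange : LinearMap.range (P : X →ₗ[ℂ] X) = Submodule.span ℂ {h} := by
    ext y
    rw [LinearMap.mem_range, Submodule.mem_span_singleton]
    constructor
    · rintro ⟨x, rfl⟩; exact ⟨φ x, rfl⟩
    · rintro ⟨a, rfl⟩
      refine ⟨a • h, ?_⟩
      change φ (a • h) • h = a • h
      rw [map_smul, hφh, smul_eq_mul, mul_one]
  have hNP : ∀ y, N (P y) = 0 := fun y => by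
    rw [hNy, hPy, map_smul, map_smul, hh, hφh, smul_eq_mul, mul_one, smul_comm, sub_self]
  have hPN : ∀ y, P (N y) = 0 := fun y => by
    rw [hPy, hNy, map_sub, hφ, map_smul, map_smul, hφh, smul_eq_mul, smul_eq_mul, mul_one, sub_self,
      zero_smul]
  refine ⟨by rw [hNdef]; abel, ContinuousLinearMap.ext hPN, ContinuousLinearMap.ext hNP, ?_, ?_, ?_,
    spectralRadius_lt_one_of_norm_pow hk (hN.trans hρ)⟩
  · ext y
    rw [ContinuousLinearMap.comp_apply, hPy, hPy, map_smul, hφh, smul_eq_mul, mul_one]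
  · rw [hrange, finrank_span_singleton hne]
  · rw [hrange]
    apply le_antisymm
    · rw [Submodule.span_singleton_le_iff_mem, Module.End.mem_eigenspace_iff]
      exact hh
    · intro f hf
      rw [Module.End.mem_eigenspace_iff] at hf
      have hf' : L f = lam • f := hf
      set g := f - P f with hg
      have hNg : N g = lam • g := by
        rw [hg, map_sub, hNP, sub_zero, hNy, hf', hPy, smul_sub]
      have hNkg : ∀ j : ℕ, (N ^ j) g = lam ^ j • g := by
        intro j
        induction j with
        | zero => simp
        | succ j ih =>
          rw [pow_succ, mul_apply_eq_comp, hNg, map_smul, ih, smul_smul, pow_succ,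
            mul_comm]
      have hg0 : g = 0 := by
        by_contra hg0
        have hpos : 0 < ‖g‖ := norm_pos_iff.2 hg0
        have h1 := (N ^ k).le_opNorm g
        rw [hNkg, norm_smul, norm_pow] at h1
        have h2 : ‖lam‖ ^ k ≤ ‖N ^ k‖ := le_of_mul_le_mul_right h1 hpos
        linarith
      rw [Submodule.mem_span_singleton]
      exact ⟨φ f, by rw [← hPy]; exact (sub_eq_zero.1 hg0).symm⟩

/-- Instead of contour integrals, a bordering argument is used. The operator `A = z - L x + ℓ ⊗ ξ`
is invertible near `(x₀, 1)`. If `A h = ξ` and `ℓ h = 1`, the rank one term cancels and `L x h = z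
h`. So an eigenvalue is obtained by solving the scalar equation `ℓ (A⁻¹ ξ) = 1` for `z`, with right
eigenvector `A⁻¹ ξ` and left eigenvector `ℓ ∘ A⁻¹`. -/
theorem exists_dominantSplitting {E : Type*} [NormedAddCommGroup E] [NormedSpace ℂ E]
    [CompleteSpace E] {L : E → X →L[ℂ] X} {x₀ : E} (hL : AnalyticAt ℂ L x₀) {ξ : X} {ℓ : X →L[ℂ] ℂ}
    (hℓξ : ℓ ξ = 1) (hLξ : L x₀ ξ = ξ) (hℓL : ∀ y, ℓ (L x₀ y) = ℓ y)
    (hrad : spectralRadius ℂ (L x₀ - ℓ.smulRight ξ) < 1) :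
    ∃ (lam : E → ℂ) (P N : E → X →L[ℂ] X), AnalyticAt ℂ lam x₀ ∧ AnalyticAt ℂ P x₀ ∧
      AnalyticAt ℂ N x₀ ∧ lam x₀ = 1 ∧ P x₀ = ℓ.smulRight ξ ∧
      ∀ᶠ x in 𝓝 x₀, IsDominantSplitting (L x) (lam x) (P x) (N x) := by
  set P₀ := ℓ.smulRight ξ with hP₀
  set A : E × ℂ → X →L[ℂ] X := fun u => u.2 • (1 : X →L[ℂ] X) - L u.1 + P₀ with hA
  have hAan : AnalyticAt ℂ A (x₀, 1) := by
    have h1 : AnalyticAt ℂ (fun u : E × ℂ => L u.1) (x₀, 1) :=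
      AnalyticAt.comp (f := fun u : E × ℂ => u.1) hL analyticAt_fst
    exact ((analyticAt_snd.smul analyticAt_const).sub h1).add analyticAt_const
  have hA1 : A (x₀, 1) = 1 - (L x₀ - P₀) := by simp only [hA, one_smul]; abel
  have hunit : IsUnit (A (x₀, 1)) := by
    rw [hA1]
    have h1 : (1 : ℂ) ∈ resolventSet ℂ (L x₀ - P₀) :=
      spectrum.mem_resolventSet_of_spectralRadius_lt (by simpa using hrad)
    simpa [resolventSet] using h1
  set R : E × ℂ → X →L[ℂ] X := fun u => Ring.inverse (A u) with hR
  have hRan : AnalyticAt ℂ R (x₀, 1) := by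
    obtain ⟨w, hw⟩ := hunit
    have h1 : AnalyticAt ℂ (Ring.inverse : (X →L[ℂ] X) → _) (A (x₀, 1)) := by
      rw [← hw]; exact analyticAt_inverse w
    exact h1.comp hAan
  have hevξ : AnalyticAt ℂ (fun u => R u ξ) (x₀, 1) :=
    AnalyticAt.comp (g := ContinuousLinearMap.apply ℂ X ξ)
      (ContinuousLinearMap.analyticAt _ _) hRan
  set d : E × ℂ → ℂ := fun u => ℓ (R u ξ) with hd
  have hdan : AnalyticAt ℂ d (x₀, 1) :=
    AnalyticAt.comp (g := ℓ) (ContinuousLinearMap.analyticAt _ _) hevξ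
  have hunit_ev : ∀ᶠ u in 𝓝 (x₀, (1 : ℂ)), IsUnit (A u) :=
    hAan.continuousAt.eventually (Units.isOpen.mem_nhds hunit)
  -- At `x₀` the vector `ξ` is an eigenvector of `A` with eigenvalue `z`. Hence the partial
  -- derivative of `d` in `z` is `-1` at `z = 1`, as the implicit function theorem requires.
  have hRξ : ∀ᶠ z in 𝓝 (1 : ℂ), d (x₀, z) = z⁻¹ := by
    have hc : Tendsto (fun z : ℂ => (x₀, z)) (𝓝 1) (𝓝 (x₀, 1)) :=
      (Continuous.prodMk_right x₀).tendsto 1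
    filter_upwards [hc.eventually hunit_ev, eventually_ne_nhds (one_ne_zero)] with z hz hz0
    have h1 : A (x₀, z) ξ = z • ξ := by
      change z • ξ - L x₀ ξ + ℓ ξ • ξ = _
      rw [hLξ, hℓξ, one_smul, sub_add_cancel]
    have h2 : R (x₀, z) (A (x₀, z) ξ) = ξ := by
      rw [← mul_apply_eq_comp, hR, Ring.inverse_mul_cancel _ hz]; rfl
    rw [h1, map_smul] at h2
    have h3 : z * d (x₀, z) = 1 := by
      have := congrArg ℓ h2
      rwa [map_smul, smul_eq_mul, hℓξ] at this
    exact eq_inv_of_mul_eq_one_right h3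
  have hd1 : d (x₀, 1) = 1 := by rw [hRξ.self_of_nhds, inv_one]
  have hcd : ContDiffAt ℂ ω d (x₀, 1) := hdan.contDiffAt
  have hder : (fderiv ℂ d (x₀, 1) ∘L ContinuousLinearMap.inr ℂ E ℂ) 1 = -1 := by
    have h1 : HasFDerivAt (fun z : ℂ => d (x₀, z))
        (fderiv ℂ d (x₀, 1) ∘L ContinuousLinearMap.inr ℂ E ℂ) 1 :=
      HasFDerivAt.comp (f := fun z : ℂ => (x₀, z)) 1 hdan.differentiableAt.hasFDerivAt
        (hasFDerivAt_prodMk_right x₀ 1)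
    have h2 : HasDerivAt (fun z : ℂ => d (x₀, z)) (-(1 ^ 2)⁻¹) 1 :=
      (hasDerivAt_inv one_ne_zero).congr_of_eventuallyEq hRξ
    have h3 := h1.hasDerivAt.unique h2
    simpa using h3
  have hinv : (fderiv ℂ d (x₀, 1) ∘L ContinuousLinearMap.inr ℂ E ℂ).IsInvertible := by
    refine ⟨ContinuousLinearEquiv.unitsEquivAut ℂ (-1), ?_⟩
    ext
    simpa using hder.symm
  set lam := hcd.implicitFunction (by simp) hinv with hlam
  have hlan : AnalyticAt ℂ lam x₀ :=
    (hcd.contDiffAt_implicitFunction (by simp) hinv).analyticAt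
  have hl0 : lam x₀ = 1 := hcd.implicitFunction_apply_self (by simp) hinv
  have hlev : ∀ᶠ x in 𝓝 x₀, d (x, lam x) = 1 := by
    have := hcd.eventually_apply_implicitFunction (by simp) hinv
    rwa [hd1] at this
  have hpair : AnalyticAt ℂ (fun x => (x, lam x)) x₀ := analyticAt_id.prod hlan
  have hpair0 : (x₀, lam x₀) = (x₀, 1) := by rw [hl0]
  set S : E → X →L[ℂ] X := fun x => R (x, lam x) with hS
  have hSan : AnalyticAt ℂ S x₀ := by
    refine AnalyticAt.comp (g := R) (f := fun x => (x, lam x)) ?_ hpair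
    rw [hpair0]; exact hRan
  have hSu : ∀ᶠ x in 𝓝 x₀, IsUnit (A (x, lam x)) := by
    have h1 : Tendsto (fun x => (x, lam x)) (𝓝 x₀) (𝓝 (x₀, 1)) := by
      rw [← hpair0]; exact hpair.continuousAt
    exact h1.eventually hunit_ev
  set h : E → X := fun x => S x ξ with hh
  set φ : E → X →L[ℂ] ℂ := fun x => ℓ ∘L S x with hφ
  have hhan : AnalyticAt ℂ h x₀ :=
    AnalyticAt.comp (g := ContinuousLinearMap.apply ℂ X ξ)
      (ContinuousLinearMap.analyticAt _ _) hSan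
  have hφan : AnalyticAt ℂ φ x₀ :=
    AnalyticAt.comp (g := ContinuousLinearMap.compL ℂ X X ℂ ℓ) (f := S)
      (ContinuousLinearMap.analyticAt _ _) hSan
  -- Off `x₀` the pairing of the two eigenvectors need not be `1`; dividing by it makes `P`
  -- idempotent.
  set θ : E → ℂ := fun x => φ x (h x) with hθ
  have hθan : AnalyticAt ℂ θ x₀ :=
    ((ContinuousLinearMap.analyticAt_bilinear
      (ContinuousLinearMap.id ℂ (X →L[ℂ] ℂ)) _).comp₂ hφan hhan)
  have hS0 : S x₀ ξ = ξ := by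
    have h1 : A (x₀, 1) ξ = ξ := by
      change (1 : ℂ) • ξ - L x₀ ξ + ℓ ξ • ξ = _
      rw [hLξ, hℓξ, one_smul, sub_add_cancel]
    have h2 : R (x₀, 1) (A (x₀, 1) ξ) = ξ := by
      rw [← mul_apply_eq_comp, hR, Ring.inverse_mul_cancel _ hunit]; rfl
    rw [h1] at h2
    rw [hS]
    simp only [hl0]
    exact h2
  have hφ0 : φ x₀ = ℓ := by
    have h1 : ∀ y, ℓ (A (x₀, 1) y) = ℓ y := fun y => by
      change ℓ ((1 : ℂ) • y - L x₀ y + ℓ y • ξ) = _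
      rw [map_add, map_sub, hℓL, one_smul, sub_self, zero_add, map_smul, hℓξ, smul_eq_mul, mul_one]
    ext y
    change ℓ (R (x₀, lam x₀) y) = ℓ y
    rw [hl0, ← h1, ← mul_apply_eq_comp, hR, Ring.mul_inverse_cancel _ hunit]; rfl
  have hθ0 : θ x₀ = 1 := by
    simp only [hθ, hφ0, hh, hS0, hℓξ]
  have hθinv : AnalyticAt ℂ (fun x => (θ x)⁻¹) x₀ := hθan.inv (by rw [hθ0]; exact one_ne_zero)
  set P : E → X →L[ℂ] X := fun x => ((θ x)⁻¹ • φ x).smulRight (h x) with hP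
  have hPan : AnalyticAt ℂ P x₀ :=
    (ContinuousLinearMap.analyticAt_bilinear (ContinuousLinearMap.smulRightL ℂ X X) _).comp₂
      (hθinv.smul hφan) hhan
  have hP0 : P x₀ = P₀ := by
    simp only [hP, hθ0, inv_one, one_smul, hφ0, hh, hS0]; rfl
  set N : E → X →L[ℂ] X := fun x => L x - lam x • P x with hN
  have hNan : AnalyticAt ℂ N x₀ := hL.sub (hlan.smul hPan)
  have hN0 : N x₀ = L x₀ - P₀ := by simp only [hN, hl0, hP0, one_smul]
  obtain ⟨k, hk0, hk⟩ := exists_norm_pow_lt_one hrad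
  obtain ⟨ρ, hρ1, hρ2⟩ := exists_between hk
  have hNev : ∀ᶠ x in 𝓝 x₀, ‖N x ^ k‖ < ρ := by
    have : ContinuousAt (fun x => ‖N x ^ k‖) x₀ := (hNan.continuousAt.pow k).norm
    exact this.eventually_lt_const (by simpa only [hN0] using hρ1)
  have hlev2 : ∀ᶠ x in 𝓝 x₀, ρ < ‖lam x‖ ^ k := by
    have : ContinuousAt (fun x => ‖lam x‖ ^ k) x₀ := hlan.continuousAt.norm.pow k
    exact this.eventually_const_lt (by simpa [hl0] using hρ2)
  have hθev : ∀ᶠ x in 𝓝 x₀, θ x ≠ 0 :=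
    hθan.continuousAt.eventually_ne (by rw [hθ0]; exact one_ne_zero)
  refine ⟨lam, P, N, hlan, hPan, hNan, hl0, hP0, ?_⟩
  filter_upwards [hSu, hlev, hNev, hlev2, hθev] with x hu hdx hNx hlx hθx
  have hAh : A (x, lam x) (h x) = ξ := by
    simp only [hh, hS, hR]
    rw [← mul_apply_eq_comp, Ring.mul_inverse_cancel _ hu]; rfl
  have hℓh : ℓ (h x) = 1 := hdx
  have hLh : L x (h x) = lam x • h x := by
    have : lam x • h x - L x (h x) + ℓ (h x) • ξ = ξ := hAh
    rw [hℓh, one_smul, add_eq_right, sub_eq_zero] at this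
    exact this.symm
  have hφA : ∀ y, φ x (A (x, lam x) y) = ℓ y := fun y => by
    simp only [hφ, hS, hR]
    rw [ContinuousLinearMap.comp_apply, ← mul_apply_eq_comp,
      Ring.inverse_mul_cancel _ hu]; rfl
  have hφL : ∀ y, φ x (L x y) = lam x * φ x y := fun y => by
    have h1 : φ x (lam x • y - L x y + ℓ y • ξ) = ℓ y := hφA y
    have h2 : φ x ξ = 1 := hdx
    rw [map_add, map_sub, map_smul, map_smul, h2, smul_eq_mul, smul_eq_mul, mul_one, add_eq_right,
      sub_eq_zero] at h1
    exact h1.symm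
  refine isDominantSplitting_of_eigen hLh (fun y => ?_) ?_ hk0 hρ2 hNx hlx
  · rw [smul_apply, smul_apply, hφL, smul_eq_mul, smul_eq_mul]; ring
  · rw [smul_apply, smul_eq_mul]; exact inv_mul_cancel₀ hθx

end Perturbation

/-! ### The unperturbed operator on the unit interval -/

theorem weight_ofReal (k : ℕ) (a : ℂ) {x : ℝ} (hx : 0 ≤ x) :
    weight k a x = Complex.exp (-(a * Real.log (x + k + 1))) := by
  rw [weight]
  have : (x : ℂ) + (k + 1 : ℕ) = ((x + k + 1 : ℝ) : ℂ) := by push_cast; ring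
  rw [this, Complex.ofReal_log (by positivity)]

theorem ofReal_inv_add (k : ℕ) (x : ℝ) :
    (1 / ((x : ℂ) + (k + 1 : ℕ)) : ℂ) = ((1 / (x + k + 1) : ℝ) : ℂ) := by
  push_cast; ring_nf

theorem weight_two_add (k : ℕ) (τ : ℂ) {x : ℝ} (hx : 0 ≤ x) :
    weight k (2 + τ) x = Complex.exp (-(τ * Real.log (x + k + 1))) * ((1 / (x + k + 1) ^ 2 : ℝ) : ℂ)
      := by
  have hp : 0 < x + k + 1 := by positivity
  rw [weight_ofReal k _ hx]
  have h2 : ((1 / (x + k + 1) ^ 2 : ℝ) : ℂ) = Complex.exp (-(2 * Real.log (x + k + 1))) := by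
    have : (1 / (x + k + 1) ^ 2 : ℝ) = Real.exp (-(2 * Real.log (x + k + 1))) := by
      rw [Real.exp_neg, two_mul, Real.exp_add, Real.exp_log hp, one_div, sq]
    rw [this]; push_cast; rfl
  rw [h2, ← Complex.exp_add]
  ring_nf

/-- Conjugation by `1 + x` turns the weights `(x + k + 1)^{-2}` of `𝓛_{1,0}` into the probabilities
`gaussWeight`, to which the maximum principle applies. -/
theorem one_add_mul_branch (k : ℕ) {x : ℝ} (hx : 0 ≤ x) (v : ℂ) :
    ((1 + x : ℝ) : ℂ) * (((1 / (x + k + 1) ^ 2 : ℝ) : ℂ) * v) =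
      (gaussWeight k x : ℂ) * (((1 + 1 / (x + k + 1) : ℝ) : ℂ) * v) := by
  rw [← mul_assoc, ← mul_assoc, ← Complex.ofReal_mul, ← Complex.ofReal_mul]
  congr 2
  rw [gaussWeight]
  have h1 : x + k + 1 ≠ 0 := by positivity
  have h2 : x + k + 2 ≠ 0 := by positivity
  field_simp
  ring

/-- `(1 + x) f(x)` on the unit interval. -/
def normalized (f : HInf) (x : ℝ) : ℂ := ((1 + x : ℝ) : ℂ) * value f x

theorem normalized_smul (a : ℂ) (f : HInf) (x : ℝ) :
    normalized (a • f) x = a * normalized f x := by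
  rw [normalized, value_smul, normalized]; ring

theorem continuousOn_normalized (f : HInf) : ContinuousOn (normalized f) (Icc 0 1) :=
  (Complex.continuous_ofReal.comp (by fun_prop : Continuous fun x : ℝ => 1 + x)).continuousOn.mul
    (continuousOn_value_ofReal f)

theorem HInf.eq_zero_of_normalized {f : HInf} (h : ∀ x ∈ Icc (0 : ℝ) 1, normalized f x = 0) :
    f = 0 := by
  refine HInf.eq_zero_of_eqOn_Icc fun x hx => ?_
  have h1 : ((1 + x : ℝ) : ℂ) ≠ 0 := Complex.ofReal_ne_zero.2 (by linarith [hx.1])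
  exact (mul_eq_zero.1 (h x hx)).resolve_left h1

theorem hasSum_opL_ofReal {c : ℕ → ℝ} {M : ℝ} (hM : ∀ n, 1 ≤ n → |c n| ≤ M) {τ : ℂ}
    (hτ : 0 ≤ τ.re) (f : HInf) {x : ℝ} (hx : x ∈ Icc (0 : ℝ) 1) :
    HasSum (fun k : ℕ => (gaussWeight k x : ℂ) * (Complex.exp (-(τ * Real.log (x + k + 1))) *
      normalized f (1 / (x + k + 1)))) (normalized (opL c (1 + τ / 2) 0 f) x) := by
  have hs : 1 < (2 * (1 + τ / 2) + mean c * 0).re := by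
    have : 2 * (1 + τ / 2) + mean c * 0 = 2 + τ := by ring
    rw [this]; simp; linarith
  have h := (hasSum_value_transfer hs (NormedSpace.exp ((0 : ℂ) • costSeq c M hM)) f
    (ofReal_mem_disc_of_mem_Icc hx)).mul_left ((1 + x : ℝ) : ℂ)
  rw [← opL_eq_transfer hM hs] at h
  refine h.congr_fun fun k => ?_
  have e : 2 * (1 + τ / 2) + mean c * 0 = 2 + τ := by ring
  rw [exp_smul_costSeq_apply, zero_mul, Complex.exp_zero, one_mul, e, weight_two_add k τ hx.1,
    ofReal_inv_add, normalized]
  have := one_add_mul_branch k hx.1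
    (Complex.exp (-(τ * Real.log (x + k + 1))) * value f ((1 / (x + k + 1) : ℝ) : ℂ))
  rw [mul_comm (Complex.exp _) (((1 / (x + k + 1) ^ 2 : ℝ)) : ℂ), mul_assoc, this]
  ring

theorem hasSum_opL_one_ofReal {c : ℕ → ℝ} {M : ℝ} (hM : ∀ n, 1 ≤ n → |c n| ≤ M) (f : HInf) {x : ℝ}
    (hx : x ∈ Icc (0 : ℝ) 1) :
    HasSum (fun k : ℕ => (gaussWeight k x : ℂ) * normalized f (1 / (x + k + 1)))
      (normalized (opL c 1 0 f) x) := by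
  have h := hasSum_opL_ofReal hM (τ := 0) le_rfl f hx
  simpa using h

theorem two_mul_re {c : ℕ → ℝ} {s : ℂ} (hs : 1 ≤ s.re) : 1 < (2 * s + mean c * 0).re := by
  simp
  linarith

/-- For `Re s ≥ 1`, `s ≠ 1`, the operator `1 - 𝓛_{s,0}` is invertible. -/
theorem isUnit_one_sub_opL {c : ℕ → ℝ} {M : ℝ} (hM : ∀ n, 1 ≤ n → |c n| ≤ M) {s : ℂ}
    (hs : 1 ≤ s.re) (hs1 : s ≠ 1) : IsUnit (1 - opL c s 0) := by
  have hc := isCompactOperator_opL hM (two_mul_re (c := c) hs)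
  -- Fredholm alternative for a compact operator: either `1` is an eigenvalue or `1 - 𝓛_{s,0}` is
  -- invertible.
  rcases hc.hasEigenvalue_or_mem_resolventSet (one_ne_zero (α := ℂ)) with h | h
  · exfalso
    obtain ⟨f, hf⟩ := h.exists_hasEigenvector
    have hLf : opL c s 0 f = f := by
      have := hf.apply_eq_smul
      rwa [one_smul] at this
    apply hf.2
    set τ := 2 * (s - 1) with hτ
    have hsτ : s = 1 + τ / 2 := by rw [hτ]; ring
    have hτre : 0 ≤ τ.re := by rw [hτ]; simp; linarith
    have hτ0 : τ ≠ 0 := by rw [hτ]; exact mul_ne_zero two_ne_zero (sub_ne_zero.2 hs1)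
    refine HInf.eq_zero_of_normalized
      (eq_zero_of_twisted (continuousOn_normalized f) hτre hτ0 fun x hx => ?_)
    have := hasSum_opL_ofReal hM hτre f hx
    rwa [← hsτ, hLf] at this
  · simpa [resolventSet] using h

/-- The density `ξ` as an element of `H^∞(𝔻)`. -/
theorem exists_xiH : ∃ f : HInf, ∀ z ∈ disc, value f z = xiC z := by
  have hre : ∀ z ∈ disc, 2 / 3 ≤ ‖1 + z‖ := fun z hz => by
    have := norm_add_succ_ge hz 0
    simpa [add_comm] using this
  have hl : 0 < Real.log 2 := Real.log_pos (by norm_num)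
  have hl' : (Real.log 2 : ℂ) ≠ 0 := Complex.ofReal_ne_zero.2 hl.ne'
  have h0 : ∀ z ∈ disc, 1 + z ≠ 0 := fun z hz h => by
    have := hre z hz; rw [h, norm_zero] at this; norm_num at this
  refine ⟨mkH xiC ?_ (1 / (Real.log 2 * (2 / 3))) fun z hz => ?_, fun z hz => value_mkH hz⟩
  · exact (differentiableOn_const _).div ((differentiableOn_const _).mul
      ((differentiableOn_const _).add differentiableOn_id)) fun z hz => mul_ne_zero hl' (h0 z hz)
  · rw [xiC, norm_div, norm_one, norm_mul, Complex.norm_real, Real.norm_eq_abs, abs_of_pos hl]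
    exact one_div_le_one_div_of_le (by positivity)
      (mul_le_mul_of_nonneg_left (hre z hz) hl.le)

/-- The density `ξ` as an element of `H^∞(𝔻)`. -/
def xiH : HInf := exists_xiH.choose

theorem value_xiH {z : ℂ} (hz : z ∈ disc) : value xiH z = xiC z := exists_xiH.choose_spec z hz

theorem xiC_ofReal (x : ℝ) : xiC x = (xi x : ℂ) := by
  rw [xiC, xi]; push_cast; rfl

theorem log_two_pos : 0 < Real.log 2 := Real.log_pos (by norm_num)

theorem normalized_xiH {x : ℝ} (hx : x ∈ Icc (0 : ℝ) 1) :
    normalized xiH x = ((1 / Real.log 2 : ℝ) : ℂ) := by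
  rw [normalized, value_xiH (ofReal_mem_disc_of_mem_Icc hx), xiC_ofReal, ← Complex.ofReal_mul, xi]
  congr 1
  have h1 : 1 + x ≠ 0 := by linarith [hx.1]
  have h2 := log_two_pos.ne'
  field_simp

theorem HInf.eq_of_normalized {f g : HInf}
    (h : ∀ x ∈ Icc (0 : ℝ) 1, normalized f x = normalized g x) : f = g := by
  refine sub_eq_zero.1 (HInf.eq_zero_of_normalized fun x hx => ?_)
  have := h x hx
  unfold normalized at this ⊢
  rw [value_sub, mul_sub, this, sub_self]

/-- After multiplication by `1 + x` the density is constant, and the transition probabilities sum to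
`1`. -/
theorem opL_one_xiH {c : ℕ → ℝ} {M : ℝ} (hM : ∀ n, 1 ≤ n → |c n| ≤ M) : opL c 1 0 xiH = xiH := by
  refine HInf.eq_of_normalized fun x hx => ?_
  have h := hasSum_opL_one_ofReal hM xiH hx
  simp only [normalized_xiH (inv_add_mem_Icc hx _)] at h
  have h2 := (Complex.hasSum_ofReal.2 (hasSum_gaussWeight hx.1)).mul_right
    (((1 / Real.log 2 : ℝ)) : ℂ)
  rw [h.unique h2, normalized_xiH hx, Complex.ofReal_one, one_mul]

theorem integral_xi : ∫ x in (0 : ℝ)..1, xi x = 1 := by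
  have hd : ∀ x ∈ uIcc (0 : ℝ) 1, HasDerivAt (fun x => Real.log (1 + x) / Real.log 2) (xi x) x := by
    intro x hx
    rw [uIcc_of_le zero_le_one] at hx
    have h1 : 1 + x ≠ 0 := by linarith [hx.1]
    have := ((((hasDerivAt_id x).const_add 1).log h1)).div_const (Real.log 2)
    refine this.congr_deriv ?_
    rw [xi]; simp [div_eq_mul_inv, mul_comm]
  have hcont : ContinuousOn xi (uIcc 0 1) := by
    rw [uIcc_of_le zero_le_one]
    refine continuousOn_const.div (by fun_prop) fun x hx => ?_
    exact mul_ne_zero log_two_pos.ne' (by linarith [hx.1])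
  rw [intervalIntegral.integral_eq_sub_of_hasDerivAt hd hcont.intervalIntegrable]
  norm_num

theorem integralL_xiH : integralL xiH = 1 := by
  rw [integralL_apply]
  have : ∫ x in (0 : ℝ)..1, value xiH (x : ℂ) = ∫ x in (0 : ℝ)..1, ((xi x : ℝ) : ℂ) := by
    refine intervalIntegral.integral_congr fun x hx => ?_
    rw [uIcc_of_le zero_le_one] at hx
    rw [value_xiH (ofReal_mem_disc_of_mem_Icc hx), xiC_ofReal]
  rw [this, intervalIntegral.integral_ofReal, integral_xi, Complex.ofReal_one]

/-- Substitution `y = 1/(x + k + 1)`, which reverses orientation. -/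
theorem integral_branch (k : ℕ) {φ : ℝ → ℂ}
    (hφ : ContinuousOn φ (Icc (1 / ((k : ℝ) + 2)) (1 / ((k : ℝ) + 1)))) :
    ∫ x in (0 : ℝ)..1, ((1 / (x + k + 1) ^ 2 : ℝ) : ℂ) * φ (1 / (x + k + 1)) =
      ∫ y in (1 / ((k : ℝ) + 2))..(1 / ((k : ℝ) + 1)), φ y := by
  have hd : ∀ x ∈ uIcc (0 : ℝ) 1,
      HasDerivAt (fun x : ℝ => 1 / (x + k + 1)) (-(1 / (x + k + 1) ^ 2)) x := by
    intro x hx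
    rw [uIcc_of_le zero_le_one] at hx
    have h1 : x + k + 1 ≠ 0 := by have := hx.1; positivity
    have h2 := (((hasDerivAt_id x).add_const (k : ℝ)).add_const 1).inv h1
    simp only [one_div]
    refine h2.congr_deriv ?_
    rw [neg_div, one_div]; rfl
  have hc : ContinuousOn (fun x : ℝ => -(1 / (x + k + 1) ^ 2)) (uIcc 0 1) := by
    rw [uIcc_of_le zero_le_one]
    refine (continuousOn_const.div (by fun_prop) fun x hx => ?_).neg
    have := hx.1
    positivity
  have himg : (fun x : ℝ => 1 / (x + k + 1)) '' uIcc 0 1 ⊆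
      Icc (1 / ((k : ℝ) + 2)) (1 / ((k : ℝ) + 1)) := by
    rintro _ ⟨x, hx, rfl⟩
    rw [uIcc_of_le zero_le_one] at hx
    have := hx.1
    exact ⟨one_div_le_one_div_of_le (by positivity) (by linarith [hx.2]),
      one_div_le_one_div_of_le (by positivity) (by linarith)⟩
  have h := intervalIntegral.integral_deriv_smul_comp'' (g := φ)
    (fun x hx => (hd x hx).continuousAt.continuousWithinAt)
    (fun x hx => (hd x (Ioo_subset_Icc_self hx)).hasDerivWithinAt) hc (hφ.mono himg)
  rw [show (1 : ℝ) + k + 1 = k + 2 by ring, zero_add] at h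
  rw [intervalIntegral.integral_symm (1 / ((k : ℝ) + 1)) (1 / ((k : ℝ) + 2)), ← h,
    ← intervalIntegral.integral_neg]
  refine intervalIntegral.integral_congr fun x _ => ?_
  simp

theorem one_div_mem_Icc (k : ℕ) : 1 / ((k : ℝ) + 1) ∈ Icc (0 : ℝ) 1 := by
  refine ⟨by positivity, ?_⟩
  rw [div_le_one (by positivity)]
  linarith [Nat.cast_nonneg (α := ℝ) k]

theorem Icc_branch_subset (k : ℕ) :
    Icc (1 / ((k : ℝ) + 2)) (1 / ((k : ℝ) + 1)) ⊆ Ioc (0 : ℝ) 1 := fun y hy =>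
  ⟨lt_of_lt_of_le (by positivity) hy.1, hy.2.trans (one_div_mem_Icc k).2⟩

theorem integralL_branchCLM (k : ℕ) (f : HInf) : integralL (branchCLM k 2 f) =
    ∫ y in (1 / ((k : ℝ) + 2))..(1 / ((k : ℝ) + 1)), value f y := by
  rw [← integral_branch k ((continuousOn_value_ofReal f).mono
    ((Icc_branch_subset k).trans Ioc_subset_Icc_self)), integralL_apply]
  refine intervalIntegral.integral_congr fun x hx => ?_
  rw [uIcc_of_le zero_le_one] at hx
  have := weight_two_add k 0 hx.1
  rw [add_zero] at this
  simp only [value_branchCLM k 2 f (ofReal_mem_disc_of_mem_Icc hx), this, ofReal_inv_add]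
  simp

/-- The branch intervals tile `(0, 1]` and the ordered partial sums telescope. Telescoping alone
does not give unconditional summability, which is therefore a hypothesis. -/
theorem hasSum_integral_branches {φ : ℝ → ℂ} (hφ : IntervalIntegrable φ MeasureTheory.volume 0 1)
    (hs : Summable fun k : ℕ => ∫ y in (1 / ((k : ℝ) + 2))..(1 / ((k : ℝ) + 1)), φ y) :
    HasSum (fun k : ℕ => ∫ y in (1 / ((k : ℝ) + 2))..(1 / ((k : ℝ) + 1)), φ y)
      (∫ y in (0 : ℝ)..1, φ y) := by
  have hint : ∀ k : ℕ, IntervalIntegrable φ MeasureTheory.volume 0 (1 / ((k : ℝ) + 1)) := fun k =>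
    hφ.mono_set (by
      rw [uIcc_of_le zero_le_one, uIcc_of_le (one_div_mem_Icc k).1]
      exact Icc_subset_Icc_right (one_div_mem_Icc k).2)
  have hpart : ∀ K : ℕ, ∑ k ∈ Finset.range K, ∫ y in (1 / ((k : ℝ) + 2))..(1 / ((k : ℝ) + 1)), φ y =
      (∫ y in (0 : ℝ)..1, φ y) - ∫ y in (0 : ℝ)..(1 / ((K : ℝ) + 1)), φ y := by
    intro K
    induction K with
    | zero => simp
    | succ K ih =>
      have e : 1 / (((K + 1 : ℕ) : ℝ) + 1) = 1 / ((K : ℝ) + 2) := by push_cast; ring_nf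
      have h1 := intervalIntegral.integral_interval_sub_left (hint K) (hint (K + 1))
      rw [e] at h1 ⊢
      rw [Finset.sum_range_succ, ih, ← h1]
      ring
  have htend : Tendsto (fun K : ℕ => ∫ y in (0 : ℝ)..(1 / ((K : ℝ) + 1)), φ y) atTop (𝓝 0) := by
    have hc : ContinuousOn (fun b : ℝ => ∫ y in (0 : ℝ)..b, φ y) (uIcc 0 1) :=
      intervalIntegral.continuousOn_primitive_interval' hφ (by simp)
    have h0 := hc 0 (by simp)
    have h1 : Tendsto (fun K : ℕ => 1 / ((K : ℝ) + 1)) atTop (𝓝[uIcc 0 1] 0) := by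
      refine tendsto_nhdsWithin_iff.2 ⟨tendsto_one_div_add_atTop_nhds_zero_nat,
        Eventually.of_forall fun K => ?_⟩
      rw [uIcc_of_le zero_le_one]; exact one_div_mem_Icc K
    have h2 := h0.tendsto.comp h1
    simpa [Function.comp_def] using h2
  have h3 := hs.hasSum.tendsto_sum_nat
  simp only [hpart] at h3
  have h4 := htend.const_sub (∫ y in (0 : ℝ)..1, φ y)
  rw [sub_zero] at h4
  rw [← tendsto_nhds_unique h3 h4]
  exact hs.hasSum

theorem intervalIntegrable_value (f : HInf) :
    IntervalIntegrable (fun x : ℝ => value f x) MeasureTheory.volume 0 1 := by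
  refine ContinuousOn.intervalIntegrable ?_
  rw [uIcc_of_le zero_le_one]
  exact continuousOn_value_ofReal f

/-- `𝓛_{1,0}` is the transfer operator of the Gauss map with respect to Lebesgue measure: each
branch contributes the integral over its own interval. -/
theorem integralL_opL_one {c : ℕ → ℝ} {M : ℝ} (hM : ∀ n, 1 ≤ n → |c n| ≤ M) (f : HInf) :
    integralL (opL c 1 0 f) = integralL f := by
  have hs : 1 < (2 * (1 : ℂ) + mean c * 0).re := two_mul_re (by simp)
  have h := ((hasSum_transfer_apply hs (NormedSpace.exp ((0 : ℂ) • costSeq c M hM))).mapL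
    (ContinuousLinearMap.apply ℂ HInf f)).mapL integralL
  rw [← opL_eq_transfer hM hs] at h
  have h' : HasSum (fun k : ℕ => ∫ y in (1 / ((k : ℝ) + 2))..(1 / ((k : ℝ) + 1)), value f y)
      (integralL (opL c 1 0 f)) := by
    refine h.congr_fun fun k => ?_
    rw [← integralL_branchCLM]
    have e : 2 * (1 : ℂ) + mean c * 0 = 2 := by ring
    rw [e, exp_smul_costSeq_apply, zero_mul, Complex.exp_zero, one_smul]
    rfl
  rw [h'.unique (hasSum_integral_branches (intervalIntegrable_value f) h'.summable)]
  rfl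

instance : Nontrivial HInf := ⟨xiH, 0, fun h => by simpa [h] using integralL_xiH⟩

/-- The limiting projection `f ↦ (∫ f) ξ`. -/
def projXi : HInf →L[ℂ] HInf := integralL.smulRight xiH

/-- By compactness, a spectral value of modulus at least `1` is an eigenvalue. Integrating the
eigenvalue equation shows that the eigenvector has integral `0`, so it is an eigenvector of
`𝓛_{1,0}` itself. For eigenvalue `1` it is a multiple of `ξ` by harmonicity, hence zero; any other
eigenvalue is excluded by `eq_zero_of_eigenvalue`. -/
theorem spectralRadius_opL_sub_lt {c : ℕ → ℝ} {M : ℝ} (hM : ∀ n, 1 ≤ n → |c n| ≤ M) :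
    spectralRadius ℂ (opL c 1 0 - projXi) < 1 := by
  have hcomp : IsCompactOperator (opL c 1 0 - projXi) :=
    (isCompactOperator_opL hM (two_mul_re (by simp))).sub (isCompactOperator_smulRight _ _)
  refine spectrum.spectralRadius_lt_of_forall_lt (r := 1) _ fun lam hlam => ?_
  by_contra hcon
  have h1 : 1 ≤ ‖lam‖ := by exact_mod_cast not_lt.1 hcon
  have hl0 : lam ≠ 0 := fun h => by rw [h, norm_zero] at h1; linarith
  obtain ⟨f, hf⟩ := ((hcomp.hasEigenvalue_iff_mem_spectrum hl0).2 hlam).exists_hasEigenvector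
  have hNf : opL c 1 0 f - integralL f • xiH = lam • f := hf.apply_eq_smul
  have hint : integralL f = 0 := by
    have h2 := congrArg integralL hNf
    rw [map_sub, integralL_opL_one hM, map_smul, integralL_xiH, smul_eq_mul, mul_one, sub_self,
      map_smul, smul_eq_mul] at h2
    exact (mul_eq_zero.1 h2.symm).resolve_left hl0
  rw [hint, zero_smul, sub_zero] at hNf
  apply hf.2
  have hsum : ∀ x ∈ Icc (0 : ℝ) 1,
      HasSum (fun k : ℕ => (gaussWeight k x : ℂ) * normalized f (1 / (x + k + 1)))
        (lam * normalized f x) := fun x hx => by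
    have := hasSum_opL_one_ofReal hM f hx
    rw [hNf] at this
    rwa [normalized_smul] at this
  by_cases hl1 : lam = 1
  · subst hl1
    simp only [one_mul] at hsum
    have hconst := eq_const_of_harmonic (continuousOn_normalized f) hsum
    have hf' : f = (normalized f 0 * Real.log 2) • xiH := by
      refine HInf.eq_of_normalized fun x hx => ?_
      rw [normalized_smul, normalized_xiH hx, hconst x hx, mul_assoc, ← Complex.ofReal_mul,
        mul_one_div_cancel log_two_pos.ne', Complex.ofReal_one, mul_one]
    have h3 := hint
    rw [hf', map_smul, integralL_xiH, smul_eq_mul, mul_one] at h3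
    rw [hf', h3, zero_smul]
  · exact HInf.eq_zero_of_normalized
      (eq_zero_of_eigenvalue (continuousOn_normalized f) h1 hl1 hsum)

theorem exists_isSpectralDecomposition {c : ℕ → ℝ} {M : ℝ} (hM : ∀ n, 1 ≤ n → |c n| ≤ M) :
    ∃ V lam P N, IsSpectralDecomposition c V lam P N := by
  have hs : 1 < (2 * (1 : ℂ) + mean c * 0).re := two_mul_re (by simp)
  obtain ⟨lam, P, N, h1, h2, h3, h4, h5, h6⟩ := exists_dominantSplitting (x₀ := ((1, 0) : ℂ × ℂ))
    (L := fun x : ℂ × ℂ => opL c x.1 x.2) (analyticAt_opL hM hs) integralL_xiH (opL_one_xiH hM)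
    (integralL_opL_one hM) (spectralRadius_opL_sub_lt hM)
  have h7 : ∀ᶠ x : ℂ × ℂ in 𝓝 (1, 0), 1 / 2 < x.1.re :=
    (Complex.continuous_re.comp continuous_fst).continuousAt.eventually_const_lt
      (by norm_num)
  have hev := (((((h6.and h7).and (eventually_re_gt hs)).and h1.eventually_analyticAt).and
    h2.eventually_analyticAt).and h3.eventually_analyticAt)
  obtain ⟨V, hV, hVo, hVm⟩ := eventually_nhds_iff.1 hev
  refine ⟨V, lam, P, N, ⟨hVo, hVm, ?_, ?_, ?_, ?_, ?_, ?_, ?_, ?_, ?_, ?_, ?_, h4, ?_⟩⟩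
  · exact fun x hx => ⟨(hV x hx).1.1.1.1.2, (hV x hx).1.1.1.2⟩
  · exact fun x hx => (hV x hx).1.1.1.1.1.decomp
  · exact fun x hx => (hV x hx).1.1.1.1.1.P_comp_N
  · exact fun x hx => (hV x hx).1.1.1.1.1.N_comp_P
  · exact fun x hx => (hV x hx).1.1.1.1.1.P_idem
  · exact fun x hx => (hV x hx).1.1.1.1.1.P_rank
  · exact fun x hx => (hV x hx).1.1.1.1.1.P_range
  · exact fun x hx => (hV x hx).1.1.1.1.1.N_radius
  · exact fun x hx => (hV x hx).1.1.2
  · exact fun x hx => (hV x hx).1.2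
  · exact fun x hx => (hV x hx).2
  · intro f z hz
    rw [h5, ContinuousLinearMap.smulRight_apply, value_smul, value_xiH hz, integralL_apply]

/-! ### Exponential sums and their derivatives -/

/-- The gap `r - t` in the exponent absorbs any power of `‖g i‖`. -/
theorem summable_mul_pow_of_exp {ι : Type*} {w g : ι → ℂ} {r : ℝ}
    (h : Summable fun i => ‖w i‖ * Real.exp (r * ‖g i‖)) (p : ℕ) {t : ℝ} (ht : t < r) :
    Summable fun i => ‖w i‖ * ‖g i‖ ^ p * Real.exp (t * ‖g i‖) := by
  have hd : 0 < r - t := sub_pos.2 ht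
  refine Summable.of_nonneg_of_le (fun i => by positivity) (fun i => ?_)
    (h.mul_left ((p.factorial : ℝ) / (r - t) ^ p))
  have h1 := Real.pow_div_factorial_le_exp ((r - t) * ‖g i‖) (by positivity) p
  have hp : (0 : ℝ) < p.factorial := by exact_mod_cast p.factorial_pos
  have h2 : ‖g i‖ ^ p ≤ (p.factorial : ℝ) / (r - t) ^ p * Real.exp ((r - t) * ‖g i‖) := by
    rw [div_le_iff₀ hp, mul_pow] at h1
    rw [div_mul_eq_mul_div, le_div_iff₀ (by positivity)]
    linarith
  calc ‖w i‖ * ‖g i‖ ^ p * Real.exp (t * ‖g i‖)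
      ≤ ‖w i‖ * ((p.factorial : ℝ) / (r - t) ^ p * Real.exp ((r - t) * ‖g i‖)) *
        Real.exp (t * ‖g i‖) := by gcongr
    _ = (p.factorial : ℝ) / (r - t) ^ p *
        (‖w i‖ * (Real.exp ((r - t) * ‖g i‖) * Real.exp (t * ‖g i‖))) := by ring
    _ = _ := by rw [← Real.exp_add]; ring_nf

theorem norm_exp_mul_le {z a : ℂ} {r : ℝ} (hz : ‖z‖ ≤ r) :
    ‖Complex.exp (z * a)‖ ≤ Real.exp (r * ‖a‖) := by
  rw [Complex.norm_exp]
  refine Real.exp_le_exp.2 ((Complex.re_le_norm _).trans ?_)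
  rw [norm_mul]
  gcongr

theorem hasDerivAt_tsum_exp {ι : Type*} {w g : ι → ℂ} {r : ℝ} (hr : 0 < r)
    (h : Summable fun i => ‖w i‖ * Real.exp (r * ‖g i‖)) (p : ℕ) {z : ℂ} (hz : ‖z‖ < r / 2) :
    HasDerivAt (fun z => ∑' i, w i * g i ^ p * Complex.exp (z * g i))
      (∑' i, w i * g i ^ (p + 1) * Complex.exp (z * g i)) z := by
  set U := Metric.ball (0 : ℂ) (r / 2)
  have hzU : z ∈ U := by simpa [U] using hz
  have hu := summable_mul_pow_of_exp h p (by linarith : r / 2 < r)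
  have hd : ∀ i, ∀ z, HasDerivAt (fun z => w i * g i ^ p * Complex.exp (z * g i))
      (w i * g i ^ (p + 1) * Complex.exp (z * g i)) z := fun i z => by
    have := ((((hasDerivAt_id z).mul_const (g i)).cexp).const_mul (w i * g i ^ p))
    refine this.congr_deriv ?_
    simp only [id]
    ring
  have hb : ∀ i, ∀ z ∈ U, ‖w i * g i ^ p * Complex.exp (z * g i)‖ ≤
      ‖w i‖ * ‖g i‖ ^ p * Real.exp (r / 2 * ‖g i‖) := fun i z hz => by
    rw [norm_mul, norm_mul, norm_pow]
    have : ‖z‖ < r / 2 := by simpa [U] using hz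
    gcongr
    exact norm_exp_mul_le this.le
  have hdo : ∀ i, DifferentiableOn ℂ (fun z => w i * g i ^ p * Complex.exp (z * g i)) U :=
    fun i z _ => (hd i z).differentiableAt.differentiableWithinAt
  have h1 := Complex.hasSum_deriv_of_summable_norm hu hdo Metric.isOpen_ball hb hzU
  have h2 := (Complex.differentiableOn_tsum_of_summable_norm hu hdo Metric.isOpen_ball
    hb).differentiableAt (Metric.isOpen_ball.mem_nhds hzU)
  refine h2.hasDerivAt.congr_deriv ?_
  rw [← h1.tsum_eq]
  exact tsum_congr fun i => (hd i z).deriv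

theorem iteratedDeriv_tsum_exp {ι : Type*} {w g : ι → ℂ} {r : ℝ} (hr : 0 < r)
    (h : Summable fun i => ‖w i‖ * Real.exp (r * ‖g i‖)) (p : ℕ) {z : ℂ} (hz : ‖z‖ < r / 2) :
    iteratedDeriv p (fun z => ∑' i, w i * Complex.exp (z * g i)) z =
      ∑' i, w i * g i ^ p * Complex.exp (z * g i) := by
  induction p generalizing z with
  | zero => simp
  | succ p ih =>
    rw [iteratedDeriv_succ]
    have hev : iteratedDeriv p (fun z => ∑' i, w i * Complex.exp (z * g i)) =ᶠ[𝓝 z]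
        fun z => ∑' i, w i * g i ^ p * Complex.exp (z * g i) := by
      have : ∀ᶠ y in 𝓝 z, ‖y‖ < r / 2 := continuous_norm.continuousAt.eventually_lt_const hz
      filter_upwards [this] with y hy using ih hy
    rw [hev.deriv_eq]
    exact (hasDerivAt_tsum_exp hr h p hz).deriv

theorem iteratedDeriv_tsum_exp_zero {ι : Type*} {w g : ι → ℂ} {r : ℝ} (hr : 0 < r)
    (h : Summable fun i => ‖w i‖ * Real.exp (r * ‖g i‖)) (p : ℕ) :
    HasSum (fun i => w i * g i ^ p)
      (iteratedDeriv p (fun z => ∑' i, w i * Complex.exp (z * g i)) 0) := by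
  rw [iteratedDeriv_tsum_exp hr h p (by simpa using hr)]
  have hs : Summable fun i => w i * g i ^ p := by
    refine Summable.of_norm ?_
    have := summable_mul_pow_of_exp h p hr
    simpa using this
  simpa using hs.hasSum

/-! ### Derivatives of a simple eigenvalue -/

/-- The eigenvector is rescaled to `k` with `ℓ (k t) = 1`. Then the derivatives of `k` at `0` lie in
the kernel of `ℓ`, and since `ℓ ∘ L 0 = ℓ` they drop out whenever `L 0` is applied to them. The
vector `u` is `k'(0)`, and differentiating `lam = ℓ (L k)` gives both formulas. -/
theorem eigenvalue_derivatives {X : Type*} [NormedAddCommGroup X] [NormedSpace ℂ X]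
    [CompleteSpace X] {L : ℂ → X →L[ℂ] X} {h : ℂ → X} {lam : ℂ → ℂ} {ξ : X} {ℓ : X →L[ℂ] ℂ}
    (hL : AnalyticAt ℂ L 0) (hh : AnalyticAt ℂ h 0) (hlam : AnalyticAt ℂ lam 0)
    (heig : ∀ᶠ t in 𝓝 0, L t (h t) = lam t • h t) (hlam0 : lam 0 = 1) (hh0 : h 0 = ξ)
    (hℓξ : ℓ ξ = 1) (hℓL : ∀ y, ℓ (L 0 y) = ℓ y) :
    deriv lam 0 = ℓ (deriv L 0 ξ) ∧ ∃ u : X, ℓ u = 0 ∧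
      deriv L 0 ξ + L 0 u = deriv lam 0 • ξ + u ∧
      iteratedDeriv 2 lam 0 = ℓ (iteratedDeriv 2 L 0 ξ) + 2 * ℓ (deriv L 0 u) := by
  have hℓh : AnalyticAt ℂ (fun t => ℓ (h t)) 0 :=
    AnalyticAt.comp (g := ℓ) (ContinuousLinearMap.analyticAt _ _) hh
  have hℓh0 : ℓ (h 0) ≠ 0 := by rw [hh0, hℓξ]; exact one_ne_zero
  have hne : ∀ᶠ t in 𝓝 (0 : ℂ), ℓ (h t) ≠ 0 := hℓh.continuousAt.eventually_ne hℓh0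
  set k : ℂ → X := fun t => (ℓ (h t))⁻¹ • h t with hk
  have hkan : AnalyticAt ℂ k 0 := (hℓh.inv hℓh0).smul hh
  have hk0 : k 0 = ξ := by simp only [hk, hh0, hℓξ, inv_one, one_smul]
  have hℓk : ∀ᶠ t in 𝓝 (0 : ℂ), ℓ (k t) = 1 := by
    filter_upwards [hne] with t ht
    rw [hk, map_smul, smul_eq_mul, inv_mul_cancel₀ ht]
  have heigk : ∀ᶠ t in 𝓝 (0 : ℂ), L t (k t) = lam t • k t := by
    filter_upwards [heig] with t ht
    rw [hk, map_smul, ht, smul_comm]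
  have hD : ∀ᶠ t in 𝓝 (0 : ℂ), HasDerivAt (fun t => L t (k t))
      (deriv L t (k t) + L t (deriv k t)) t := by
    filter_upwards [hL.eventually_analyticAt, hkan.eventually_analyticAt] with t h1 h2
    exact h1.differentiableAt.hasDerivAt.clm_apply h2.differentiableAt.hasDerivAt
  have hℓk' : ∀ᶠ t in 𝓝 (0 : ℂ), ℓ (deriv k t) = 0 := by
    filter_upwards [hℓk.eventually_nhds, hkan.eventually_analyticAt] with t h1 h2
    have h3 : HasDerivAt (fun t => ℓ (k t)) (ℓ (deriv k t)) t :=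
      ℓ.hasFDerivAt.comp_hasDerivAt t h2.differentiableAt.hasDerivAt
    have h4 : HasDerivAt (fun t => ℓ (k t)) 0 t :=
      (hasDerivAt_const t (1 : ℂ)).congr_of_eventuallyEq h1
    exact h3.unique h4
  have hlameq : lam =ᶠ[𝓝 0] fun t => ℓ (L t (k t)) := by
    filter_upwards [hℓk, heigk] with t h1 h2
    rw [h2, map_smul, h1, smul_eq_mul, mul_one]
  have hderlam : deriv lam =ᶠ[𝓝 0] fun t => ℓ (deriv L t (k t) + L t (deriv k t)) := by
    filter_upwards [hlameq.eventually_nhds, hD] with t h1 h2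
    have h1' : lam =ᶠ[𝓝 t] fun t => ℓ (L t (k t)) := h1
    rw [h1'.deriv_eq]
    exact (ℓ.hasFDerivAt.comp_hasDerivAt t h2).deriv
  refine ⟨?_, deriv k 0, hℓk'.self_of_nhds, ?_, ?_⟩
  · rw [hderlam.self_of_nhds]
    change ℓ (deriv L 0 (k 0) + L 0 (deriv k 0)) = _
    rw [map_add, hℓL, hℓk'.self_of_nhds, add_zero, hk0]
  · have h1 := hD.self_of_nhds
    have h2 : HasDerivAt (fun t => lam t • k t) (lam 0 • deriv k 0 + deriv lam 0 • k 0) 0 :=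
      hlam.differentiableAt.hasDerivAt.smul hkan.differentiableAt.hasDerivAt
    have h3 := h1.unique (h2.congr_of_eventuallyEq heigk)
    rw [hk0, hlam0, one_smul] at h3
    rw [h3, add_comm]
  · have hL' : AnalyticAt ℂ (deriv L) 0 := hL.deriv
    have hk' : AnalyticAt ℂ (deriv k) 0 := hkan.deriv
    have h1 : HasDerivAt (fun t => deriv L t (k t))
        (deriv (deriv L) 0 (k 0) + deriv L 0 (deriv k 0)) 0 :=
      hL'.differentiableAt.hasDerivAt.clm_apply hkan.differentiableAt.hasDerivAt
    have h2 : HasDerivAt (fun t => L t (deriv k t))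
        (deriv L 0 (deriv k 0) + L 0 (deriv (deriv k) 0)) 0 :=
      hL.differentiableAt.hasDerivAt.clm_apply hk'.differentiableAt.hasDerivAt
    have h3 := ℓ.hasFDerivAt.comp_hasDerivAt 0 (h1.add h2)
    have h4 : ℓ (deriv (deriv k) 0) = 0 := by
      have h5 : HasDerivAt (fun t => ℓ (deriv k t)) (ℓ (deriv (deriv k) 0)) 0 :=
        ℓ.hasFDerivAt.comp_hasDerivAt 0 hk'.differentiableAt.hasDerivAt
      exact h5.unique ((hasDerivAt_const (0 : ℂ) (0 : ℂ)).congr_of_eventuallyEq hℓk')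
    rw [iteratedDeriv_succ, iteratedDeriv_one, hderlam.deriv_eq, iteratedDeriv_succ,
      iteratedDeriv_one]
    refine h3.deriv.trans ?_
    rw [map_add, map_add, map_add, hℓL, h4, hk0]
    ring

/-! ### The entropy and the mean -/

theorem deriv_gaussMap {x : ℝ} (hx : 0 < x) (hx' : ∀ n : ℤ, (n : ℝ) ≠ 1 / x) :
    deriv gaussMap x = -(1 / x ^ 2) := by
  have hfl : ∀ᶠ y in 𝓝 x, ⌊1 / y⌋ = ⌊1 / x⌋ := by
    have hc : ContinuousAt (fun y : ℝ => 1 / y) x := continuousAt_const.div continuousAt_id hx.ne'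
    have h1 : (⌊1 / x⌋ : ℝ) < 1 / x := lt_of_le_of_ne (Int.floor_le _) (hx' _)
    filter_upwards [hc.eventually_const_lt h1, hc.eventually_lt_const (Int.lt_floor_add_one (1 / x))]
      with y hy1 hy2
    exact Int.floor_eq_iff.2 ⟨hy1.le, hy2⟩
  have hev : gaussMap =ᶠ[𝓝 x] fun y => 1 / y - (⌊1 / x⌋ : ℝ) := by
    filter_upwards [hfl] with y hy
    rw [gaussMap, hy]
  rw [hev.deriv_eq]
  have := (hasDerivAt_inv hx.ne').sub_const (⌊1 / x⌋ : ℝ)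
  rw [one_div (x ^ 2), ← this.deriv]
  simp only [one_div]

theorem intervalIntegrable_log_mul_xi :
    IntervalIntegrable (fun x => Real.log x * xi x) MeasureTheory.volume 0 1 := by
  refine intervalIntegral.intervalIntegrable_log'.mul_continuousOn ?_
  rw [uIcc_of_le zero_le_one]
  refine continuousOn_const.div (by fun_prop) fun x hx => ?_
  exact mul_ne_zero log_two_pos.ne' (by linarith [hx.1])

theorem entropy_eq : entropy = -2 * ∫ x in (0 : ℝ)..1, Real.log x * xi x := by
  rw [entropy, ← intervalIntegral.integral_const_mul]
  refine intervalIntegral.integral_congr_ae ?_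
  -- Only at these points can the derivative of the Gauss map differ from `-1/x²`; they form a null
  -- set.
  have hcount : {x : ℝ | ∃ n : ℤ, (n : ℝ) = 1 / x}.Countable := by
    refine (countable_range fun n : ℤ => 1 / (n : ℝ)).mono ?_
    rintro x ⟨n, hn⟩
    exact ⟨n, by simp only [hn, one_div_one_div]⟩
  filter_upwards [hcount.ae_notMem MeasureTheory.volume] with x hx hx01
  rw [uIoc_of_le zero_le_one] at hx01
  have hne : ∀ n : ℤ, (n : ℝ) ≠ 1 / x := fun n hn => hx ⟨n, hn⟩
  rw [deriv_gaussMap hx01.1 hne, abs_neg, Real.log_abs, one_div, Real.log_inv, Real.log_pow]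
  push_cast
  ring

theorem xi_pos {x : ℝ} (hx : 0 ≤ x) : 0 < xi x := by
  have := log_two_pos
  unfold xi
  positivity

theorem entropy_pos : 0 < entropy := by
  rw [entropy_eq, ← intervalIntegral.integral_const_mul]
  refine intervalIntegral.intervalIntegral_pos_of_pos_on
    (intervalIntegrable_log_mul_xi.const_mul _) (fun x hx => ?_) one_pos
  have h1 := Real.log_neg hx.1 hx.2
  have h2 := xi_pos hx.1.le
  nlinarith

theorem continuousOn_xi : ContinuousOn xi (Icc 0 1) := by
  refine continuousOn_const.div (by fun_prop) fun x hx => ?_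
  exact mul_ne_zero log_two_pos.ne' (by linarith [hx.1])

/-- The Gauss measure of the cylinder of the branch `k`. -/
def cylinder (k : ℕ) : ℝ := ∫ x in (1 / ((k : ℝ) + 2))..(1 / ((k : ℝ) + 1)), xi x

theorem cylinder_pos (k : ℕ) : 0 < cylinder k := by
  have hlt : 1 / ((k : ℝ) + 2) < 1 / ((k : ℝ) + 1) :=
    one_div_lt_one_div_of_lt (by positivity) (by linarith)
  refine intervalIntegral.intervalIntegral_pos_of_pos_on ?_ (fun x hx => ?_) hlt
  · refine ContinuousOn.intervalIntegrable ?_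
    rw [uIcc_of_le hlt.le]
    exact continuousOn_xi.mono ((Icc_branch_subset k).trans Ioc_subset_Icc_self)
  · exact xi_pos (le_trans (by positivity) hx.1.le)

theorem summable_cylinder : Summable cylinder := by
  refine summable_of_sum_range_le (c := ∫ x in (0 : ℝ)..1, xi x) (fun k => (cylinder_pos k).le)
    fun K => ?_
  have hint : IntervalIntegrable xi MeasureTheory.volume 0 1 := by
    refine ContinuousOn.intervalIntegrable ?_
    rw [uIcc_of_le zero_le_one]; exact continuousOn_xi
  have key : ∑ k ∈ Finset.range K, cylinder k = ∫ x in (1 / ((K : ℝ) + 1))..1, xi x := by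
    have := intervalIntegral.sum_integral_adjacent_intervals (μ := MeasureTheory.volume)
      (f := xi) (a := fun k : ℕ => 1 / ((k : ℝ) + 1)) (n := K) fun k _ => ?_
    · rw [Nat.cast_zero, zero_add, div_one] at this
      rw [intervalIntegral.integral_symm, ← this, ← Finset.sum_neg_distrib]
      refine Finset.sum_congr rfl fun k _ => ?_
      rw [cylinder, intervalIntegral.integral_symm]
      push_cast
      ring_nf
    · refine hint.mono_set ?_
      rw [uIcc_of_le zero_le_one]
      exact uIcc_subset_Icc (one_div_mem_Icc k) (one_div_mem_Icc (k + 1))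
  rw [key, ← intervalIntegral.integral_add_adjacent_intervals (a := 0) (b := 1 / ((K : ℝ) + 1))]
  · have : 0 ≤ ∫ x in (0 : ℝ)..(1 / ((K : ℝ) + 1)), xi x :=
      intervalIntegral.integral_nonneg (one_div_mem_Icc K).1 fun x hx => (xi_pos hx.1).le
    linarith
  · refine hint.mono_set ?_
    rw [uIcc_of_le zero_le_one]
    exact uIcc_subset_Icc (by simp) (one_div_mem_Icc K)
  · refine hint.mono_set ?_
    rw [uIcc_of_le zero_le_one]
    exact uIcc_subset_Icc (one_div_mem_Icc K) (by simp)

theorem summable_mul_cylinder {c : ℕ → ℝ} {M : ℝ} (hM : ∀ n, 1 ≤ n → |c n| ≤ M) :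
    Summable fun k => c (k + 1) * cylinder k := by
  refine Summable.of_norm_bounded (summable_cylinder.mul_left M) fun k => ?_
  rw [norm_mul, Real.norm_eq_abs, Real.norm_eq_abs, abs_of_pos (cylinder_pos k)]
  exact mul_le_mul_of_nonneg_right (hM _ (Nat.succ_pos k)) (cylinder_pos k).le

theorem mean_eq (c : ℕ → ℝ) : mean c = 2 / entropy * ∑' k, c (k + 1) * cylinder k := rfl

theorem mean_pos {c : ℕ → ℝ} {M : ℝ} (hM : ∀ n, 1 ≤ n → |c n| ≤ M) (hc : ∀ n, 1 ≤ n → 0 ≤ c n)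
    (hne : ∃ n, 1 ≤ n ∧ c n ≠ 0) : 0 < mean c := by
  obtain ⟨n, hn, hcn⟩ := hne
  rw [mean_eq]
  refine mul_pos (div_pos two_pos entropy_pos) ?_
  refine (summable_mul_cylinder hM).tsum_pos (fun k => ?_) (n - 1) ?_
  · exact mul_nonneg (hc _ (Nat.succ_pos k)) (cylinder_pos k).le
  · rw [Nat.sub_add_cancel hn]
    exact mul_pos (lt_of_le_of_ne (hc n hn) hcn.symm) (cylinder_pos _)

/-! ### Directional derivatives of the transfer operators -/

theorem iteratedDeriv_clm_comp {X Y : Type*} [NormedAddCommGroup X] [NormedSpace ℂ X]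
    [CompleteSpace X] [NormedAddCommGroup Y] [NormedSpace ℂ Y] (φ : X →L[ℂ] Y) {L : ℂ → X} {z : ℂ}
    (hL : AnalyticAt ℂ L z) (p : ℕ) :
    AnalyticAt ℂ (iteratedDeriv p L) z ∧
      ∀ᶠ t in 𝓝 z, iteratedDeriv p (fun t => φ (L t)) t = φ (iteratedDeriv p L t) := by
  induction p with
  | zero => exact ⟨by simpa using hL, Eventually.of_forall fun t => by simp⟩
  | succ p ih =>
    constructor
    · rw [iteratedDeriv_succ]; exact ih.1.deriv
    · filter_upwards [ih.2.eventually_nhds, ih.1.eventually_analyticAt] with t h1 h2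
      have h1' : iteratedDeriv p (fun t => φ (L t)) =ᶠ[𝓝 t] fun t => φ (iteratedDeriv p L t) := h1
      rw [iteratedDeriv_succ, h1'.deriv_eq, iteratedDeriv_succ]
      exact (φ.hasFDerivAt.comp_hasDerivAt t h2.differentiableAt.hasDerivAt).deriv

/-- The line through `(1, 0)` in the direction `(α, β)`. -/
def line (α β t : ℂ) : ℂ × ℂ := (1 + α * t, β * t)

theorem analyticAt_line (α β t : ℂ) : AnalyticAt ℂ (line α β) t :=
  (analyticAt_const.add (analyticAt_const.mul analyticAt_id)).prod
    (analyticAt_const.mul analyticAt_id)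

theorem line_zero (α β : ℂ) : line α β 0 = (1, 0) := by simp [line]

/-- The transfer operator along a line through `(1, 0)`. -/
def opLine (c : ℕ → ℝ) (α β t : ℂ) : HInf →L[ℂ] HInf := opL c (line α β t).1 (line α β t).2

theorem opLine_zero (c : ℕ → ℝ) (α β : ℂ) : opLine c α β 0 = opL c 1 0 := by
  rw [opLine, line_zero]

theorem analyticAt_opLine {c : ℕ → ℝ} {M : ℝ} (hM : ∀ n, 1 ≤ n → |c n| ≤ M) (α β : ℂ) :
    AnalyticAt ℂ (opLine c α β) 0 := by
  refine AnalyticAt.comp (g := fun x : ℂ × ℂ => opL c x.1 x.2) (f := line α β) ?_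
    (analyticAt_line α β 0)
  rw [line_zero]
  exact analyticAt_opL hM (two_mul_re (by simp))

/-- The weight `(x + k + 1)^{-2} f(1 / (x + k + 1))`. -/
def lineWeight (f : HInf) (x : ℝ) (k : ℕ) : ℂ :=
  ((1 / (x + k + 1) ^ 2 : ℝ) : ℂ) * value f ((1 / (x + k + 1) : ℝ) : ℂ)

/-- The logarithmic derivative of the branch weight in the direction `(α, β)`. -/
def lineSlope (c : ℕ → ℝ) (α β : ℂ) (x : ℝ) (k : ℕ) : ℂ :=
  β * c (k + 1) - (2 * α + mean c * β) * Real.log (x + k + 1)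

theorem exists_lineWeight_bound {c : ℕ → ℝ} {M : ℝ} (hM : ∀ n, 1 ≤ n → |c n| ≤ M) (α β : ℂ) :
    ∃ r > 0, ∃ C, ∀ (f : HInf), ∀ x ∈ Icc (0 : ℝ) 1, ∀ k : ℕ,
      ‖lineWeight f x k‖ * Real.exp (r * ‖lineSlope c α β x k‖) ≤
        C * ‖f‖ * ((k : ℝ) + 1) ^ (-(3 / 2 : ℝ)) := by
  set κ := 2 * α + mean c * β with hκ
  -- With `r ‖κ‖ ≤ 1/2` the exponential costs at most a constant times `(x + k + 1)^{1/2}`, which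
  -- leaves the summable exponent `-3/2`.
  set r : ℝ := 1 / (2 * (‖κ‖ + 1)) with hr
  have hr0 : 0 < r := by rw [hr]; positivity
  refine ⟨r, hr0, Real.exp (r * (‖β‖ * M)), fun f x hx k => ?_⟩
  have hx0 := hx.1
  have hk1 : (1 : ℝ) ≤ x + k + 1 := by linarith [Nat.cast_nonneg (α := ℝ) k]
  have hp : 0 < x + k + 1 := by linarith
  have hlog : 0 ≤ Real.log (x + k + 1) := Real.log_nonneg hk1
  have hrκ : r * ‖κ‖ ≤ 1 / 2 := by
    rw [hr, one_div_mul_eq_div, div_le_div_iff₀ (by positivity) two_pos]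
    linarith [norm_nonneg κ]
  have h1 : ‖lineSlope c α β x k‖ ≤ ‖β‖ * M + ‖κ‖ * Real.log (x + k + 1) := by
    refine (norm_sub_le _ _).trans (add_le_add ?_ ?_)
    · rw [norm_mul, Complex.norm_real]
      exact mul_le_mul_of_nonneg_left (hM _ (Nat.succ_pos k)) (norm_nonneg _)
    · rw [norm_mul, Complex.norm_real, Real.norm_eq_abs, abs_of_nonneg hlog]
  have h2 : Real.exp (r * ‖lineSlope c α β x k‖) ≤
      Real.exp (r * (‖β‖ * M)) * (x + k + 1) ^ (1 / 2 : ℝ) := by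
    rw [Real.rpow_def_of_pos hp, ← Real.exp_add]
    refine Real.exp_le_exp.2 ((mul_le_mul_of_nonneg_left h1 hr0.le).trans ?_)
    nlinarith
  have h3 : ‖lineWeight f x k‖ ≤ (x + k + 1) ^ (-2 : ℝ) * ‖f‖ := by
    rw [lineWeight, norm_mul, Complex.norm_real, Real.norm_eq_abs, abs_of_pos (by positivity),
      Real.rpow_neg hp.le, one_div]
    refine mul_le_mul ?_ (norm_value_le f _) (norm_nonneg _) (by positivity)
    rw [Real.rpow_two]
  calc ‖lineWeight f x k‖ * Real.exp (r * ‖lineSlope c α β x k‖)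
      ≤ (x + k + 1) ^ (-2 : ℝ) * ‖f‖ * (Real.exp (r * (‖β‖ * M)) * (x + k + 1) ^ (1 / 2 : ℝ)) := by
        gcongr
    _ = Real.exp (r * (‖β‖ * M)) * ‖f‖ * (x + k + 1) ^ (-(3 / 2) : ℝ) := by
        rw [show (-(3 / 2) : ℝ) = -2 + 1 / 2 by norm_num, Real.rpow_add hp]; ring
    _ ≤ _ := by
        refine mul_le_mul_of_nonneg_left ?_ (by positivity)
        exact Real.rpow_le_rpow_of_nonpos (by positivity) (by linarith) (by norm_num)

theorem hasSum_opLine {c : ℕ → ℝ} {M : ℝ} (hM : ∀ n, 1 ≤ n → |c n| ≤ M) (α β : ℂ) (f : HInf)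
    {x : ℝ} (hx : x ∈ Icc (0 : ℝ) 1) : ∀ᶠ t : ℂ in 𝓝 0,
    HasSum (fun k => lineWeight f x k * Complex.exp (t * lineSlope c α β x k))
      (value (opLine c α β t f) x) := by
  have hs : 1 < (2 * (1 : ℂ) + mean c * 0).re := two_mul_re (by simp)
  have hev : ∀ᶠ t : ℂ in 𝓝 0, 1 < (2 * (line α β t).1 + mean c * (line α β t).2).re := by
    have h1 := eventually_re_gt hs
    have h2 : Tendsto (line α β) (𝓝 0) (𝓝 (1, 0)) := by
      rw [← line_zero α β]; exact (analyticAt_line α β 0).continuousAt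
    exact h2.eventually h1
  filter_upwards [hev] with t ht
  have h := hasSum_value_transfer ht (NormedSpace.exp ((line α β t).2 • costSeq c M hM)) f
    (ofReal_mem_disc_of_mem_Icc hx)
  rw [← opL_eq_transfer hM ht] at h
  refine h.congr_fun fun k => ?_
  have e : 2 * (line α β t).1 + mean c * (line α β t).2 = 2 + t * (2 * α + mean c * β) := by
    simp only [line]; ring
  rw [exp_smul_costSeq_apply, e, weight_two_add k _ hx.1, ofReal_inv_add, lineWeight, lineSlope]
  have e2 : t * (β * c (k + 1) - (2 * α + mean c * β) * Real.log (x + k + 1)) =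
      (line α β t).2 * c (k + 1) + -(t * (2 * α + mean c * β) * Real.log (x + k + 1)) := by
    simp only [line]; ring
  rw [e2, Complex.exp_add]
  ring

theorem hasSum_iteratedDeriv_opLine {c : ℕ → ℝ} {M : ℝ} (hM : ∀ n, 1 ≤ n → |c n| ≤ M) (α β : ℂ)
    (f : HInf) {x : ℝ} (hx : x ∈ Icc (0 : ℝ) 1) (p : ℕ) :
    HasSum (fun k => lineWeight f x k * lineSlope c α β x k ^ p)
      (value (iteratedDeriv p (opLine c α β) 0 f) x) := by
  obtain ⟨r, hr, C, hC⟩ := exists_lineWeight_bound hM α β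
  have hsum : Summable fun k => ‖lineWeight f x k‖ * Real.exp (r * ‖lineSlope c α β x k‖) :=
    Summable.of_nonneg_of_le (fun k => by positivity) (hC f x hx)
      ((summable_rpow_succ (by norm_num)).mul_left _)
  have h1 := iteratedDeriv_tsum_exp_zero hr hsum p
  have h2 := (iteratedDeriv_clm_comp ((evalL x).comp (ContinuousLinearMap.apply ℂ HInf f))
    (analyticAt_opLine hM α β) p).2.self_of_nhds
  have hev : (fun t => ((evalL x).comp (ContinuousLinearMap.apply ℂ HInf f)) (opLine c α β t))
      =ᶠ[𝓝 0] fun t => ∑' k, lineWeight f x k * Complex.exp (t * lineSlope c α β x k) := by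
    filter_upwards [hasSum_opLine hM α β f hx] with t ht
    exact ht.tsum_eq.symm
  rw [hev.iteratedDeriv_eq] at h2
  rw [h2] at h1
  exact h1

theorem continuousOn_lineWeight_mul {c : ℕ → ℝ} (α β : ℂ) (f : HInf) (k : ℕ) :
    ContinuousOn (fun x : ℝ => lineWeight f x k * lineSlope c α β x k) (Icc 0 1) := by
  have hne : ∀ x ∈ Icc (0 : ℝ) 1, x + k + 1 ≠ 0 := fun x hx => by
    have := hx.1; positivity
  have hc : ContinuousOn (fun x : ℝ => x + k + 1) (Icc 0 1) := by fun_prop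
  have h1 : ContinuousOn (fun x : ℝ => 1 / (x + k + 1)) (Icc 0 1) := continuousOn_const.div hc hne
  have h2 : ContinuousOn (fun x : ℝ => 1 / (x + k + 1) ^ 2) (Icc 0 1) :=
    continuousOn_const.div (hc.pow 2) fun x hx => pow_ne_zero 2 (hne x hx)
  have h3 : ContinuousOn (fun x : ℝ => value f ((1 / (x + k + 1) : ℝ) : ℂ)) (Icc 0 1) :=
    (continuousOn_value_ofReal f).comp h1 fun x hx => inv_add_mem_Icc hx k
  have h4 : ContinuousOn (fun x : ℝ => Real.log (x + k + 1)) (Icc 0 1) := hc.log hne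
  exact ((Complex.continuous_ofReal.comp_continuousOn h2).mul h3).mul
    (continuousOn_const.sub (continuousOn_const.mul (Complex.continuous_ofReal.comp_continuousOn h4)))

/-- Dominated convergence permits integration branch by branch. The substitution `y = 1/(x + k + 1)`
replaces `log(x + k + 1)` by `-log y`, which produces the integrals defining the entropy and the
mean. -/
theorem hasSum_integralL_deriv_opLine {c : ℕ → ℝ} {M : ℝ} (hM : ∀ n, 1 ≤ n → |c n| ≤ M) (α β : ℂ) :
    HasSum (fun k : ℕ => β * (c (k + 1) * cylinder k : ℝ) + (2 * α + mean c * β) *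
        ((∫ y in (1 / ((k : ℝ) + 2))..(1 / ((k : ℝ) + 1)), Real.log y * xi y : ℝ) : ℂ))
      (integralL (deriv (opLine c α β) 0 xiH)) := by
  obtain ⟨r, hr, C, hC⟩ := exists_lineWeight_bound hM α β
  have hmain := intervalIntegral.hasSum_integral_of_dominated_convergence
    (μ := MeasureTheory.volume) (a := 0) (b := 1)
    (F := fun (k : ℕ) (x : ℝ) => lineWeight xiH x k * lineSlope c α β x k)
    (f := fun x : ℝ => value (deriv (opLine c α β) 0 xiH) x)
    (fun k _ => 1 / r * (C * ‖xiH‖ * ((k : ℝ) + 1) ^ (-(3 / 2 : ℝ))))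
    (fun k => ?_) (fun k => ?_) ?_ ?_ ?_
  · refine hmain.congr_fun fun k => ?_
    have hle : 1 / ((k : ℝ) + 2) ≤ 1 / ((k : ℝ) + 1) :=
      one_div_le_one_div_of_le (by positivity) (by linarith)
    have hlog : ContinuousOn (fun y : ℝ => Real.log y * xi y)
        (Icc (1 / ((k : ℝ) + 2)) (1 / ((k : ℝ) + 1))) := by
      refine ContinuousOn.mul (Real.continuousOn_log.mono fun y hy => ?_)
        (continuousOn_xi.mono ((Icc_branch_subset k).trans Ioc_subset_Icc_self))
      exact (Icc_branch_subset k hy).1.ne'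
    have hxi : ContinuousOn xi (Icc (1 / ((k : ℝ) + 2)) (1 / ((k : ℝ) + 1))) :=
      continuousOn_xi.mono ((Icc_branch_subset k).trans Ioc_subset_Icc_self)
    have hb := integral_branch k (φ := fun y => β * (c (k + 1) * xi y : ℝ) +
      (2 * α + mean c * β) * ((Real.log y * xi y : ℝ) : ℂ))
      ((continuousOn_const.mul (Complex.continuous_ofReal.comp_continuousOn
        (continuousOn_const.mul hxi))).add
        (continuousOn_const.mul (Complex.continuous_ofReal.comp_continuousOn hlog)))
    rw [intervalIntegral.integral_add, intervalIntegral.integral_const_mul,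
      intervalIntegral.integral_const_mul, intervalIntegral.integral_ofReal,
      intervalIntegral.integral_ofReal, intervalIntegral.integral_const_mul] at hb
    · rw [cylinder, ← hb]
      refine intervalIntegral.integral_congr fun x hx => ?_
      rw [uIcc_of_le zero_le_one] at hx
      have hmem := ofReal_mem_disc_of_mem_Icc (inv_add_mem_Icc hx k)
      simp only [lineWeight, lineSlope]
      rw [value_xiH hmem, xiC_ofReal, one_div (x + k + 1), Real.log_inv]
      push_cast
      ring
    · refine ContinuousOn.intervalIntegrable ?_
      rw [uIcc_of_le hle]
      exact continuousOn_const.mul (Complex.continuous_ofReal.comp_continuousOn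
        (continuousOn_const.mul hxi))
    · refine ContinuousOn.intervalIntegrable ?_
      rw [uIcc_of_le hle]
      exact continuousOn_const.mul (Complex.continuous_ofReal.comp_continuousOn hlog)
  · rw [uIoc_of_le zero_le_one]
    exact ((continuousOn_lineWeight_mul α β xiH k).mono
      Ioc_subset_Icc_self).aestronglyMeasurable measurableSet_Ioc
  · refine Eventually.of_forall fun x hx => ?_
    rw [uIoc_of_le zero_le_one] at hx
    have h1 := hC xiH x (Ioc_subset_Icc_self hx) k
    have h2 : ‖lineSlope c α β x k‖ ≤ 1 / r * Real.exp (r * ‖lineSlope c α β x k‖) := by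
      rw [one_div, ← div_eq_inv_mul, le_div_iff₀ hr]
      linarith [Real.add_one_le_exp (r * ‖lineSlope c α β x k‖)]
    rw [norm_mul]
    calc ‖lineWeight xiH x k‖ * ‖lineSlope c α β x k‖
        ≤ ‖lineWeight xiH x k‖ * (1 / r * Real.exp (r * ‖lineSlope c α β x k‖)) := by gcongr
      _ = 1 / r * (‖lineWeight xiH x k‖ * Real.exp (r * ‖lineSlope c α β x k‖)) := by ring
      _ ≤ _ := by gcongr
  · exact Eventually.of_forall fun x _ =>
      ((summable_rpow_succ (by norm_num)).mul_left _).mul_left _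
  · exact _root_.intervalIntegrable_const
  · refine Eventually.of_forall fun x hx => ?_
    rw [uIoc_of_le zero_le_one] at hx
    have := hasSum_iteratedDeriv_opLine hM α β xiH (Ioc_subset_Icc_self hx) 1
    simpa only [pow_one, iteratedDeriv_one] using this

theorem hasSum_integral_log_branch {c : ℕ → ℝ} {M : ℝ} (hM : ∀ n, 1 ≤ n → |c n| ≤ M) :
    HasSum (fun k : ℕ => ((∫ y in (1 / ((k : ℝ) + 2))..(1 / ((k : ℝ) + 1)),
      Real.log y * xi y : ℝ) : ℂ)) ((-entropy / 2 : ℝ) : ℂ) := by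
  have h1 : Summable fun k : ℕ => ∫ y in (1 / ((k : ℝ) + 2))..(1 / ((k : ℝ) + 1)),
      ((Real.log y * xi y : ℝ) : ℂ) := by
    -- In the direction `(1, 0)` only the logarithmic term survives, with factor `2`, so its
    -- summability can be read off.
    have h := (hasSum_integralL_deriv_opLine hM 1 0).summable.mul_left (1 / 2)
    refine h.congr fun k => ?_
    rw [intervalIntegral.integral_ofReal]
    ring
  have h2 := hasSum_integral_branches
    (φ := fun x => ((Real.log x * xi x : ℝ) : ℂ))
    ⟨intervalIntegrable_log_mul_xi.1.ofReal, intervalIntegrable_log_mul_xi.2.ofReal⟩ h1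
  simp only [intervalIntegral.integral_ofReal] at h2
  have e : (-entropy / 2 : ℝ) = ∫ x in (0 : ℝ)..1, Real.log x * xi x := by rw [entropy_eq]; ring
  rw [e]
  exact h2

/-- The terms in `β` cancel: the mean digit cost contributes `β μ 𝔥(T) / 2` and the logarithm `-β μ
𝔥(T) / 2`. This is the reason for the normalisation of `μ`. -/
theorem integralL_deriv_opLine {c : ℕ → ℝ} {M : ℝ} (hM : ∀ n, 1 ≤ n → |c n| ≤ M) (α β : ℂ) :
    integralL (deriv (opLine c α β) 0 xiH) = -(entropy * α) := by
  have h1 := hasSum_integralL_deriv_opLine hM α β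
  have h2 := (Complex.hasSum_ofReal.2 (summable_mul_cylinder hM).hasSum).mul_left β
  have h3 := (hasSum_integral_log_branch hM).mul_left (2 * α + mean c * β)
  rw [h1.unique (h2.add h3)]
  have h4 : (∑' k, c (k + 1) * cylinder k) = mean c * entropy / 2 := by
    rw [mean_eq]
    have := entropy_pos.ne'
    field_simp
  rw [h4]
  push_cast
  ring

/-! ### The dominant eigenvalue along lines -/

theorem xi_eigen_data {c : ℕ → ℝ} {V : Set (ℂ × ℂ)} {lam : ℂ × ℂ → ℂ}
    {P N : ℂ × ℂ → (HInf →L[ℂ] HInf)} (h : IsSpectralDecomposition c V lam P N) :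
    P (1, 0) = projXi := by
  ext1 f
  refine HInf.ext_value fun z hz => ?_
  rw [h.P_one_zero f z hz, projXi, ContinuousLinearMap.smulRight_apply, value_smul, value_xiH hz,
    integralL_apply]

theorem opL_comp_P {c : ℕ → ℝ} {V : Set (ℂ × ℂ)} {lam : ℂ × ℂ → ℂ}
    {P N : ℂ × ℂ → (HInf →L[ℂ] HInf)} (h : IsSpectralDecomposition c V lam P N) {x : ℂ × ℂ}
    (hx : x ∈ V) (f : HInf) : opL c x.1 x.2 (P x f) = lam x • P x f := by
  have h1 := congrArg (fun T : HInf →L[ℂ] HInf => T f) (h.P_idem x hx)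
  have h2 := congrArg (fun T : HInf →L[ℂ] HInf => T f) (h.N_comp_P x hx)
  simp only [ContinuousLinearMap.comp_apply, zero_apply] at h1 h2
  rw [h.decomp x hx, add_apply, smul_apply, h1, h2, add_zero]

theorem lam_line_derivatives {c : ℕ → ℝ} {M : ℝ} (hM : ∀ n, 1 ≤ n → |c n| ≤ M) {V : Set (ℂ × ℂ)}
    {lam : ℂ × ℂ → ℂ} {P N : ℂ × ℂ → (HInf →L[ℂ] HInf)} (h : IsSpectralDecomposition c V lam P N)
    (α β : ℂ) :
    deriv (fun t => lam (line α β t)) 0 = -(entropy * α) ∧ ∃ u : HInf, integralL u = 0 ∧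
      deriv (opLine c α β) 0 xiH + opL c 1 0 u = -(entropy * α) • xiH + u ∧
      iteratedDeriv 2 (fun t => lam (line α β t)) 0 =
        integralL (iteratedDeriv 2 (opLine c α β) 0 xiH) +
          2 * integralL (deriv (opLine c α β) 0 u) := by
  have hlamA : AnalyticAt ℂ (fun t => lam (line α β t)) 0 := by
    refine AnalyticAt.comp (g := lam) (f := line α β) ?_ (analyticAt_line α β 0)
    rw [line_zero]; exact h.lam_analytic _ h.mem
  have hPA : AnalyticAt ℂ (fun t => P (line α β t)) 0 := by
    refine AnalyticAt.comp (g := P) (f := line α β) ?_ (analyticAt_line α β 0)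
    rw [line_zero]; exact h.P_analytic _ h.mem
  have hhA : AnalyticAt ℂ (fun t => P (line α β t) xiH) 0 :=
    AnalyticAt.comp (g := ContinuousLinearMap.apply ℂ HInf xiH)
      (f := fun t => P (line α β t)) (ContinuousLinearMap.analyticAt _ _) hPA
  have hmem : ∀ᶠ t in 𝓝 (0 : ℂ), line α β t ∈ V := by
    have h1 : Tendsto (line α β) (𝓝 0) (𝓝 (1, 0)) := by
      rw [← line_zero α β]; exact (analyticAt_line α β 0).continuousAt
    exact h1.eventually (h.isOpen.mem_nhds h.mem)
  have key := eigenvalue_derivatives (L := opLine c α β) (h := fun t => P (line α β t) xiH)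
    (lam := fun t => lam (line α β t)) (ξ := xiH) (ℓ := integralL) (analyticAt_opLine hM α β) hhA
    hlamA (hmem.mono fun t ht => opL_comp_P h ht xiH) (by rw [line_zero, h.lam_one_zero])
    (by
      rw [line_zero, xi_eigen_data h, projXi, ContinuousLinearMap.smulRight_apply, integralL_xiH,
        one_smul]) integralL_xiH
    (fun y => by rw [opLine_zero]; exact integralL_opL_one hM y)
  obtain ⟨k1, u, k2, k3, k4⟩ := key
  rw [integralL_deriv_opLine hM] at k1
  refine ⟨k1, u, k2, ?_, k4⟩
  rw [← k1, ← k3, opLine_zero]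

/-! ### Positivity of the variance -/

theorem hasSum_opLine_zero {c : ℕ → ℝ} {M : ℝ} (hM : ∀ n, 1 ≤ n → |c n| ≤ M) (f : HInf) {x : ℝ}
    (hx : x ∈ Icc (0 : ℝ) 1) : HasSum (fun k => lineWeight f x k) (value (opL c 1 0 f) x) := by
  have h := hasSum_iteratedDeriv_opLine hM 0 1 f hx 0
  simpa only [pow_zero, mul_one, iteratedDeriv_zero, opLine_zero] using h

/-- The slope in the direction `(0, 1)`, a real number. -/
def slope (c : ℕ → ℝ) (x : ℝ) (k : ℕ) : ℝ := c (k + 1) - mean c * Real.log (x + k + 1)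

theorem lineSlope_eq (c : ℕ → ℝ) (x : ℝ) (k : ℕ) : lineSlope c 0 1 x k = slope c x k := by
  simp [lineSlope, slope]

/-- The weight of the invariant density in the `k`-th branch. -/
def xiWeight (x : ℝ) (k : ℕ) : ℝ := 1 / (x + k + 1) ^ 2 * xi (1 / (x + k + 1))

theorem xiWeight_pos {x : ℝ} (hx : x ∈ Icc (0 : ℝ) 1) (k : ℕ) : 0 < xiWeight x k := by
  have h0 := hx.1
  have h1 := xi_pos (inv_add_mem_Icc hx k).1
  unfold xiWeight
  positivity

theorem lineWeight_xiH {x : ℝ} (hx : x ∈ Icc (0 : ℝ) 1) (k : ℕ) :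
    lineWeight xiH x k = xiWeight x k := by
  rw [lineWeight, value_xiH (ofReal_mem_disc_of_mem_Icc (inv_add_mem_Icc hx k)), xiC_ofReal,
    xiWeight, Complex.ofReal_mul]

theorem im_integralL (f : HInf) : (integralL f).im = ∫ x in (0 : ℝ)..1, (value f x).im := by
  rw [integralL_apply]
  exact (Complex.imCLM.intervalIntegral_comp_comm (intervalIntegrable_value f)).symm

/-- The solution of the linearised eigenvalue equation is real on the unit interval. -/
theorem im_normalized_eq_zero {c : ℕ → ℝ} {M : ℝ} (hM : ∀ n, 1 ≤ n → |c n| ≤ M) {u : HInf}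
    (hu0 : integralL u = 0) (hu : deriv (opLine c 0 1) 0 xiH + opL c 1 0 u = u) {x : ℝ}
    (hx : x ∈ Icc (0 : ℝ) 1) : (normalized u x).im = 0 := by
  have hreal : ∀ x ∈ Icc (0 : ℝ) 1, (value (deriv (opLine c 0 1) 0 xiH) x).im = 0 := fun x hx => by
    have h := Complex.hasSum_im (hasSum_iteratedDeriv_opLine hM 0 1 xiH hx 1)
    simp only [pow_one, iteratedDeriv_one, lineWeight_xiH hx, lineSlope_eq, ← Complex.ofReal_mul,
      Complex.ofReal_im] at h
    exact h.unique hasSum_zero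
  -- The inhomogeneous term is real, so the imaginary part of `(1 + x) u` is harmonic and thus a
  -- constant `C`; then `Im u` is a multiple of `ξ`, and `∫ u = 0` forces `C = 0`.
  have hharm : ∀ x ∈ Icc (0 : ℝ) 1, HasSum (fun k => (gaussWeight k x : ℂ) *
      ((normalized u (1 / (x + k + 1))).im : ℂ)) ((normalized u x).im : ℂ) := fun x hx => by
    have h := Complex.hasSum_im (hasSum_opL_one_ofReal hM u hx)
    simp only [Complex.im_ofReal_mul] at h
    have e : (normalized (opL c 1 0 u) x).im = (normalized u x).im := by
      have h1 : normalized u x =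
          ((1 + x : ℝ) : ℂ) * value (deriv (opLine c 0 1) 0 xiH) x + normalized (opL c 1 0 u) x := by
        conv_lhs => rw [← hu]
        rw [normalized, normalized, value_add, mul_add]
      rw [h1, Complex.add_im, Complex.im_ofReal_mul, hreal x hx, mul_zero, zero_add]
    rw [e] at h
    simpa only [Complex.ofReal_mul] using Complex.hasSum_ofReal.2 h
  have hcont : ContinuousOn (fun x => ((normalized u x).im : ℂ)) (Icc 0 1) :=
    (Complex.continuous_ofReal.comp Complex.continuous_im).comp_continuousOn
      (continuousOn_normalized u)
  have hconst := eq_const_of_harmonic hcont hharm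
  set C := (normalized u 0).im with hC
  have hval : ∀ x ∈ Icc (0 : ℝ) 1, (value u x).im = C * Real.log 2 * xi x := fun x hx => by
    have h1 : (normalized u x).im = C := by exact_mod_cast hconst x hx
    rw [normalized, Complex.im_ofReal_mul] at h1
    have h2 : 1 + x ≠ 0 := by linarith [hx.1]
    have h3 := log_two_pos.ne'
    rw [xi, ← h1]
    field_simp
  have hint := im_integralL u
  rw [hu0, Complex.zero_im, intervalIntegral.integral_congr (g := fun x => C * Real.log 2 * xi x)
    (fun x hx => hval x (by rwa [uIcc_of_le zero_le_one] at hx)),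
    intervalIntegral.integral_const_mul, integral_xi, mul_one] at hint
  have hC0 : C = 0 := (mul_eq_zero.1 hint.symm).resolve_right log_two_pos.ne'
  have := hconst x hx
  rw [hC0] at this
  exact_mod_cast this

/-- The element `f² / ξ` of `H^∞(𝔻)`. -/
theorem exists_sq_div_xi (f : HInf) :
    ∃ q : HInf, ∀ z ∈ disc, value q z = value f z ^ 2 * (Real.log 2 * (1 + z)) := by
  refine ⟨mkH (fun z => value f z ^ 2 * (Real.log 2 * (1 + z))) ?_
    (‖f‖ ^ 2 * (Real.log 2 * 3)) fun z hz => ?_, fun z hz => value_mkH hz⟩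
  · exact ((differentiableOn_value f).pow 2).mul (by fun_prop)
  · have h1 : ‖z - 2 / 3‖ < 1 := by simpa [disc, dist_eq_norm] using hz
    have h2 : ‖1 + z‖ ≤ 3 := by
      have e : 1 + z = (z - 2 / 3) + ((5 / 3 : ℝ) : ℂ) := by push_cast; ring
      rw [e]
      refine (norm_add_le _ _).trans ?_
      rw [Complex.norm_real, Real.norm_eq_abs, abs_of_pos (by norm_num)]
      linarith
    rw [norm_mul, norm_pow, norm_mul, Complex.norm_real, Real.norm_eq_abs,
      abs_of_pos log_two_pos]
    have := norm_value_le f z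
    have := log_two_pos
    gcongr

theorem slope_unbounded {c : ℕ → ℝ} {M : ℝ} (hM : ∀ n, 1 ≤ n → |c n| ≤ M) (hμ : 0 < mean c)
    (B : ℝ) : ∃ k, slope c 0 k < -B := by
  have h1 : Tendsto (fun k : ℕ => mean c * Real.log ((k : ℝ) + 1)) atTop atTop :=
    (Real.tendsto_log_atTop.comp
      (tendsto_atTop_add_const_right _ 1 tendsto_natCast_atTop_atTop)).const_mul_atTop hμ
  obtain ⟨k, hk⟩ := (h1.eventually_gt_atTop (M + B)).exists
  refine ⟨k, ?_⟩
  have := (abs_le.1 (hM (k + 1) (by omega))).2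
  rw [slope, zero_add]
  linarith

/-- Completing the square. Writing `u = ψ ξ` with `ψ` real, and adding a term of integral zero, the
integrand becomes the sum over the branches of `xiWeight` times `(slope + ψ(1/(x+k+1)) - ψ(x))²`. If
it vanished at `x = 0`, then `slope c 0` would be bounded in `k`, contrary to `slope_unbounded`. -/
theorem second_derivative_pos {c : ℕ → ℝ} {M : ℝ} (hM : ∀ n, 1 ≤ n → |c n| ≤ M) (hμ : 0 < mean c)
    {u : HInf} (hu0 : integralL u = 0) (hu : deriv (opLine c 0 1) 0 xiH + opL c 1 0 u = u) :
    ∃ v : ℝ, 0 < v ∧ integralL (iteratedDeriv 2 (opLine c 0 1) 0 xiH) +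
      2 * integralL (deriv (opLine c 0 1) 0 u) = v := by
  obtain ⟨q, hq⟩ := exists_sq_div_xi u
  set ψ : ℝ → ℝ := fun x => (normalized u x).re * Real.log 2 with hψ
  have hψc : ContinuousOn ψ (Icc 0 1) :=
    (Complex.continuous_re.comp_continuousOn (continuousOn_normalized u)).mul continuousOn_const
  have hl2 := log_two_pos.ne'
  have hvu : ∀ x ∈ Icc (0 : ℝ) 1, value u x = (ψ x * xi x : ℝ) := fun x hx => by
    have h1 : normalized u x = ((normalized u x).re : ℂ) :=
      Complex.ext rfl (im_normalized_eq_zero hM hu0 hu hx)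
    have h2 : ((1 + x : ℝ) : ℂ) ≠ 0 := Complex.ofReal_ne_zero.2 (by linarith [hx.1])
    have h3 : (1 + x : ℝ) ≠ 0 := by linarith [hx.1]
    have h4 : ψ x * xi x = (normalized u x).re / (1 + x) := by rw [hψ, xi]; field_simp
    rw [h4, Complex.ofReal_div, ← h1, normalized, mul_div_cancel_left₀ _ h2]
  have hvq : ∀ x ∈ Icc (0 : ℝ) 1, value q x = (ψ x ^ 2 * xi x : ℝ) := fun x hx => by
    rw [hq _ (ofReal_mem_disc_of_mem_Icc hx), hvu x hx]
    have h3 : (1 + x : ℝ) ≠ 0 := by linarith [hx.1]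
    have : ψ x ^ 2 * xi x = (ψ x * xi x) ^ 2 * (Real.log 2 * (1 + x)) := by
      rw [xi]; field_simp
    rw [this]; push_cast; ring
  -- Since `𝓛_{1,0}` preserves integrals, `𝓛_{1,0} q - q` has integral zero for `q = u²/ξ`. Adding
  -- it supplies the missing squares of `ψ`.
  set S : HInf := iteratedDeriv 2 (opLine c 0 1) 0 xiH + (2 : ℂ) • deriv (opLine c 0 1) 0 u +
    (opL c 1 0 q - q) with hS
  have hintS : integralL (iteratedDeriv 2 (opLine c 0 1) 0 xiH) +
      2 * integralL (deriv (opLine c 0 1) 0 u) = integralL S := by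
    rw [hS, map_add, map_add, map_sub, map_smul, integralL_opL_one hM, sub_self, add_zero,
      smul_eq_mul]
  have hsum : ∀ x ∈ Icc (0 : ℝ) 1, HasSum (fun k : ℕ =>
      xiWeight x k * (slope c x k + ψ (1 / (x + k + 1)) - ψ x) ^ 2) (value S x).re ∧
      (value S x).im = 0 := fun x hx => by
    have hw : ∀ k, lineWeight u x k = (xiWeight x k * ψ (1 / (x + k + 1)) : ℝ) := fun k => by
      rw [lineWeight, hvu _ (inv_add_mem_Icc hx k), xiWeight, ← Complex.ofReal_mul]
      congr 1; ring
    have hw2 : ∀ k, lineWeight q x k = (xiWeight x k * ψ (1 / (x + k + 1)) ^ 2 : ℝ) := fun k => by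
      rw [lineWeight, hvq _ (inv_add_mem_Icc hx k), xiWeight, ← Complex.ofReal_mul]
      congr 1; ring
    have a1 := hasSum_iteratedDeriv_opLine hM 0 1 xiH hx 2
    have a2 := hasSum_iteratedDeriv_opLine hM 0 1 u hx 1
    have a3 := hasSum_opLine_zero hM q hx
    have b1 := hasSum_iteratedDeriv_opLine hM 0 1 xiH hx 1
    have b2 := hasSum_opLine_zero hM u hx
    have b3 := hasSum_opLine_zero hM xiH hx
    rw [iteratedDeriv_one] at a2 b1
    have b12 := b1.add b2
    rw [← value_add, hu, hvu x hx] at b12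
    rw [opL_one_xiH hM, value_xiH (ofReal_mem_disc_of_mem_Icc hx), xiC_ofReal] at b3
    -- The equation satisfied by `u`, multiplied by `-2ψ(x)`, and `𝓛_{1,0} ξ = ξ`, multiplied by
    -- `ψ(x)²`, give the remaining terms of the expanded square.
    have hall := ((a1.add (a2.mul_left 2)).add a3).add
      ((b12.mul_left (-2 * (ψ x : ℂ))).add (b3.mul_left ((ψ x : ℂ) ^ 2)))
    have hval : value (iteratedDeriv 2 (opLine c 0 1) 0 xiH) x +
        2 * value (deriv (opLine c 0 1) 0 u) x + value (opL c 1 0 q) x +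
        (-2 * (ψ x : ℂ) * ((ψ x * xi x : ℝ) : ℂ) + (ψ x : ℂ) ^ 2 * (xi x : ℂ)) = value S x := by
      rw [hS, value_add, value_add, value_smul, value_sub, hvq x hx]
      push_cast
      ring
    rw [hval] at hall
    have hall' : HasSum (fun k : ℕ =>
        ((xiWeight x k * (slope c x k + ψ (1 / (x + k + 1)) - ψ x) ^ 2 : ℝ) : ℂ)) (value S x) := by
      refine hall.congr_fun fun k => ?_
      rw [hw, hw2, lineWeight_xiH hx, lineSlope_eq]
      push_cast
      ring
    refine ⟨by simpa only [Complex.ofReal_re] using Complex.hasSum_re hall', ?_⟩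
    have him := Complex.hasSum_im hall'
    simp only [Complex.ofReal_im] at him
    exact him.unique hasSum_zero
  have hcont : ContinuousOn (fun x : ℝ => (value S x).re) (Icc 0 1) :=
    Complex.continuous_re.comp_continuousOn (continuousOn_value_ofReal S)
  have hnn : ∀ x ∈ Icc (0 : ℝ) 1, ∀ k : ℕ,
      0 ≤ xiWeight x k * (slope c x k + ψ (1 / (x + k + 1)) - ψ x) ^ 2 := fun x hx k =>
    mul_nonneg (xiWeight_pos hx k).le (sq_nonneg _)
  refine ⟨∫ x in (0 : ℝ)..1, (value S x).re, ?_, ?_⟩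
  · refine intervalIntegral.integral_pos zero_lt_one hcont
      (fun x hx => (hsum x (Ioc_subset_Icc_self hx)).1.nonneg (hnn x (Ioc_subset_Icc_self hx)))
      ⟨0, by simp, ?_⟩
    have h0 : (0 : ℝ) ∈ Icc (0 : ℝ) 1 := by simp
    refine lt_of_le_of_ne ((hsum 0 h0).1.nonneg (hnn 0 h0)) fun hz => ?_
    have hs0 := (hsum 0 h0).1
    rw [← hz] at hs0
    have hall := (hasSum_zero_iff_of_nonneg (hnn 0 h0)).1 hs0
    obtain ⟨B, hB⟩ := isCompact_Icc.exists_bound_of_continuousOn hψc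
    obtain ⟨k, hk⟩ := slope_unbounded hM hμ (2 * B)
    have h1 := congrFun hall k
    have h2 : slope c 0 k + ψ (1 / (0 + k + 1)) - ψ 0 = 0 := by
      have := (mul_eq_zero.1 h1).resolve_left (xiWeight_pos h0 k).ne'
      exact pow_eq_zero_iff two_ne_zero |>.1 this
    have h3 := abs_le.1 (hB _ h0)
    have h4 := abs_le.1 (hB _ (inv_add_mem_Icc h0 k))
    linarith [h3.1, h4.2]
  · rw [hintS, integralL_apply, ← intervalIntegral.integral_ofReal]
    refine intervalIntegral.integral_congr fun x hx => ?_
    rw [uIcc_of_le zero_le_one] at hx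
    exact Complex.ext rfl (by rw [(hsum x hx).2, Complex.ofReal_im])

theorem lam_second_derivative_pos {c : ℕ → ℝ} {M : ℝ} (hM : ∀ n, 1 ≤ n → |c n| ≤ M)
    (hμ : 0 < mean c) {V : Set (ℂ × ℂ)} {lam : ℂ × ℂ → ℂ} {P N : ℂ × ℂ → (HInf →L[ℂ] HInf)}
    (h : IsSpectralDecomposition c V lam P N) :
    deriv (fun ω => lam (1, ω)) 0 = 0 ∧
      ∃ v : ℝ, 0 < v ∧ iteratedDeriv 2 (fun ω : ℂ => lam (1, ω)) 0 = v := by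
  obtain ⟨h1, u, h2, h3, h4⟩ := lam_line_derivatives hM h 0 1
  have e : (fun t => lam (line 0 1 t)) = fun ω => lam (1, ω) := by
    funext t; simp [line]
  rw [e] at h1 h4
  rw [mul_zero, neg_zero, zero_smul, zero_add] at h3
  obtain ⟨v, hv, hv2⟩ := second_derivative_pos hM hμ h2 h3
  exact ⟨by rw [h1]; simp, v, hv, by rw [h4, hv2]⟩

theorem lam_deriv_fst {c : ℕ → ℝ} {M : ℝ} (hM : ∀ n, 1 ≤ n → |c n| ≤ M) {V : Set (ℂ × ℂ)}
    {lam : ℂ × ℂ → ℂ} {P N : ℂ × ℂ → (HInf →L[ℂ] HInf)} (h : IsSpectralDecomposition c V lam P N) :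
    deriv (fun t => lam (1 + t, 0)) 0 = -entropy := by
  have h1 := (lam_line_derivatives hM h 1 0).1
  have e : (fun t => lam (line 1 0 t)) = fun t => lam (1 + t, 0) := by
    funext t; simp [line]
  rw [e] at h1
  rw [h1, mul_one]

/-! ### The constant `𝔣₀` -/

theorem integralL_oneH : integralL oneH = 1 := by
  rw [integralL_apply, intervalIntegral.integral_congr (g := fun _ => (1 : ℂ))]
  · simp
  · intro x hx
    rw [uIcc_of_le zero_le_one] at hx
    exact value_oneH (ofReal_mem_disc_of_mem_Icc hx)

/-- As `∫ 𝟏 = 1`, the projection sends `𝟏` to `ξ`, and the value at `0` is a series of positive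
terms `(k+2)^{-2} ξ(1/(k+2))`. -/
theorem value_opF_pos {c : ℕ → ℝ} {M : ℝ} (hM : ∀ n, 1 ≤ n → |c n| ≤ M) {V : Set (ℂ × ℂ)}
    {lam : ℂ × ℂ → ℂ} {P N : ℂ × ℂ → (HInf →L[ℂ] HInf)} (h : IsSpectralDecomposition c V lam P N) :
    ∃ f₀ : ℝ, 0 < f₀ ∧ (f₀ : ℂ) = value (opF c 1 0 (P (1, 0) oneH)) 0 := by
  have hP : P (1, 0) oneH = xiH := by
    rw [xi_eigen_data h, projXi, ContinuousLinearMap.smulRight_apply, integralL_oneH, one_smul]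
  have h0 : (0 : ℂ) ∈ disc := by
    have := ofReal_mem_disc (x := 0) (by norm_num) (by norm_num)
    rwa [Complex.ofReal_zero] at this
  have hsum := hasSum_value_opF hM (two_mul_re (c := c) (s := 1) (by simp)) xiH h0
  set a : ℕ → ℝ := fun k => 1 / ((k : ℝ) + 2) ^ 2 * xi (1 / ((k : ℝ) + 2)) with ha
  have hx : ∀ k : ℕ, 1 / ((k : ℝ) + 2) ∈ Icc (0 : ℝ) 1 := fun k => by
    have := inv_add_mem_Icc (x := 1) (by simp) k
    rwa [show (1 : ℝ) + k + 1 = k + 2 by ring] at this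
  have hterm : ∀ k : ℕ, branch c 1 0 (k + 2) xiH 0 = a k := fun k => by
    have e1 : (1 / ((0 : ℂ) + (k + 2 : ℕ)) : ℂ) = ((1 / ((k : ℝ) + 2) : ℝ) : ℂ) := by
      push_cast; ring
    have e2 : ((0 : ℂ) + ((k + 2 : ℕ) : ℂ)) ^ (2 * 1 + mean c * 0 : ℂ) =
        ((((k : ℝ) + 2) ^ 2 : ℝ) : ℂ) := by
      have e3 : (2 * 1 + mean c * 0 : ℂ) = ((2 : ℕ) : ℂ) := by push_cast; ring
      rw [e3, Complex.cpow_natCast]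
      push_cast; ring
    rw [branch, e1, e2, value_xiH (ofReal_mem_disc_of_mem_Icc (hx k)), xiC_ofReal, zero_mul,
      Complex.exp_zero, ha]
    push_cast
    rfl
  simp only [hterm] at hsum
  have hpos : ∀ k, 0 < a k := fun k => by
    have := xi_pos (hx k).1
    rw [ha]
    positivity
  have hre : HasSum a (value (opF c 1 0 xiH) 0).re := by simpa using Complex.hasSum_re hsum
  refine ⟨∑' k, a k, hre.summable.tsum_pos (fun k => (hpos k).le) 0 (hpos 0), ?_⟩
  rw [hP, ← hsum.tsum_eq, Complex.ofReal_tsum]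

/-! ### Sums over coprime pairs -/

/-- The coprime pairs `(u, v)` with `1 ≤ u < v`. -/
abbrev CoprimePair : Type := {q : ℕ × ℕ // 1 ≤ q.1 ∧ q.1 < q.2 ∧ q.1.Coprime q.2}

/-- The pair `(v, u + (k + 1) v)`, whose quotient is the image of `u / v` under the inverse branch
`x ↦ 1 / (x + k + 1)`. -/
def CoprimePair.child (q : CoprimePair) (k : ℕ) : CoprimePair :=
  ⟨(q.1.2, q.1.1 + (k + 1) * q.1.2), by
    obtain ⟨⟨u, v⟩, h1, h2, h3⟩ := q
    refine ⟨by simp only at *; omega, ?_, ?_⟩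
    · simp only at *
      nlinarith
    · exact (Nat.coprime_add_mul_right_right v u (k + 1)).2 h3.symm⟩

/-- The pair `(1, k + 2)`. -/
def CoprimePair.root (k : ℕ) : CoprimePair := ⟨(1, k + 2), le_rfl, by simp, by simp⟩

/-- Every coprime pair is a root or the child of a unique pair. -/
def CoprimePair.decode : (CoprimePair × ℕ) ⊕ ℕ → CoprimePair :=
  Sum.elim (fun x => x.1.child x.2) CoprimePair.root

/-- One Euclidean division: a pair with `u ≥ 2` is the child of `(v % u, u)` with digit `k + 1 = v /
u`, the remainder being nonzero by coprimality. Roots have first entry `1` and children have first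
entry at least `2`. -/
theorem CoprimePair.decode_bijective : Function.Bijective CoprimePair.decode := by
  constructor
  · rintro (⟨⟨⟨u, v⟩, h1, h2, h3⟩, k⟩ | k) (⟨⟨⟨u', v'⟩, h1', h2', h3'⟩, k'⟩ | k') h
    · simp only [decode, Sum.elim_inl, child, Subtype.mk.injEq, Prod.mk.injEq] at h h1 h2 h1' h2'
      obtain ⟨rfl, h⟩ := h
      have hu : u = u' := by
        have := congrArg (· % v) h
        simpa [Nat.mod_eq_of_lt h2, Nat.mod_eq_of_lt h2'] using this
      subst hu
      have hk : k + 1 = k' + 1 := Nat.eq_of_mul_eq_mul_right (by omega) (Nat.add_left_cancel h)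
      have : k = k' := by omega
      subst this
      rfl
    · simp only [decode, Sum.elim_inl, Sum.elim_inr, child, root, Subtype.mk.injEq,
        Prod.mk.injEq] at h h1 h2
      omega
    · simp only [decode, Sum.elim_inl, Sum.elim_inr, child, root, Subtype.mk.injEq,
        Prod.mk.injEq] at h h1' h2'
      omega
    · simp only [decode, Sum.elim_inr, root, Subtype.mk.injEq, Prod.mk.injEq] at h
      congr 1; omega
  · rintro ⟨⟨u, v⟩, h1, h2, h3⟩
    simp only at h1 h2 h3
    rcases Nat.eq_or_lt_of_le h1 with rfl | hu
    · refine ⟨Sum.inr (v - 2), Subtype.ext ?_⟩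
      simp only [decode, Sum.elim_inr, root, Prod.mk.injEq, true_and]
      omega
    · have hdm := Nat.div_add_mod v u
      have hlt : v % u < u := Nat.mod_lt _ (by omega)
      have hco : (v % u).Coprime u := by
        rw [Nat.Coprime, ← Nat.gcd_rec]; exact h3
      have hpos : 1 ≤ v % u := by
        rcases Nat.eq_zero_or_pos (v % u) with h0 | h0
        · rw [h0, Nat.coprime_zero_left] at hco; omega
        · exact h0
      have hq : 1 ≤ v / u := Nat.div_pos h2.le (by omega)
      refine ⟨Sum.inl (⟨(v % u, u), hpos, hlt, hco⟩, v / u - 1), Subtype.ext ?_⟩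
      simp only [decode, Sum.elim_inl, child, Prod.mk.injEq, true_and]
      rw [Nat.sub_add_cancel hq, mul_comm]
      omega

theorem cost_child (c : ℕ → ℝ) (q : CoprimePair) (k : ℕ) :
    cost c (q.child k).1.1 (q.child k).1.2 = c (k + 1) + cost c q.1.1 q.1.2 := by
  obtain ⟨⟨u, v⟩, h1, h2, h3⟩ := q
  simp only at h1 h2
  obtain ⟨w, rfl⟩ : ∃ w, v = w + 1 := ⟨v - 1, by omega⟩
  simp only [cost, CoprimePair.child]
  rw [cfDigits, Nat.add_mul_div_right _ _ (by omega), Nat.div_eq_of_lt h2, Nat.add_mul_mod_self_right,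
    Nat.mod_eq_of_lt h2, zero_add, List.map_cons, List.sum_cons]

theorem cost_root (c : ℕ → ℝ) (k : ℕ) :
    cost c (CoprimePair.root k).1.1 (CoprimePair.root k).1.2 = c (k + 2) := by
  simp only [cost, CoprimePair.root]
  rw [show (1 : ℕ) = 0 + 1 from rfl, cfDigits, zero_add, Nat.mod_one, cfDigits]
  simp

/-- Each division at least halves the product of the two entries, because `2 (v % u) ≤ v`. Hence the
number of digits, and with it the cost, is `O(log v)`. -/
theorem two_pow_length_le (u v : ℕ) (hu : 0 < u) (huv : u < v) :
    2 ^ (cfDigits u v).length ≤ 2 * u * v := by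
  induction u using Nat.strong_induction_on generalizing v with
  | _ u ih =>
    obtain ⟨w, rfl⟩ : ∃ w, u = w + 1 := ⟨u - 1, by omega⟩
    rw [cfDigits, List.length_cons, pow_succ]
    rcases Nat.eq_zero_or_pos (v % (w + 1)) with h0 | hpos
    · rw [h0, cfDigits, List.length_nil]
      nlinarith
    · have hlt : v % (w + 1) < w + 1 := Nat.mod_lt _ hu
      have h := ih _ hlt (w + 1) hpos hlt
      have hdm := Nat.div_add_mod v (w + 1)
      have hq : 1 ≤ v / (w + 1) := Nat.div_pos huv.le hu
      have h2 : 2 * (v % (w + 1)) ≤ v := by nlinarith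
      calc 2 ^ (cfDigits (v % (w + 1)) (w + 1)).length * 2
          ≤ 2 * (v % (w + 1)) * (w + 1) * 2 := Nat.mul_le_mul_right 2 h
        _ = 2 * (w + 1) * (2 * (v % (w + 1))) := by ring
        _ ≤ _ := Nat.mul_le_mul_left _ h2

theorem abs_cost_le {c : ℕ → ℝ} {M : ℝ} (hM : ∀ n, 1 ≤ n → |c n| ≤ M) (q : CoprimePair) :
    |cost c q.1.1 q.1.2| ≤ 3 * M / Real.log 2 * Real.log q.1.2 := by
  obtain ⟨⟨u, v⟩, h1, h2, h3⟩ := q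
  simp only at h1 h2 ⊢
  have hM0 : 0 ≤ M := (abs_nonneg _).trans (hM 1 le_rfl)
  have hl2 := log_two_pos
  have hlen : ((cfDigits u v).length : ℝ) * Real.log 2 ≤ 3 * Real.log v := by
    have h := two_pow_length_le u v h1 h2
    have h' : 2 ^ (cfDigits u v).length ≤ v ^ 3 := by
      refine h.trans ?_
      have : 2 * u ≤ v * v := by nlinarith
      calc 2 * u * v ≤ v * v * v := Nat.mul_le_mul_right v this
        _ = v ^ 3 := by ring
    have h'' : (2 : ℝ) ^ (cfDigits u v).length ≤ (v : ℝ) ^ 3 := by exact_mod_cast h'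
    have := Real.log_le_log (by positivity) h''
    rw [Real.log_pow, Real.log_pow] at this
    exact_mod_cast this
  have hdig := (cfDigits_spec u v h1 h2).2.1
  have hsum : ∀ l : List ℕ, (∀ a ∈ l, 1 ≤ a) → |(l.map c).sum| ≤ l.length * M := by
    intro l
    induction l with
    | nil => simp
    | cons a l ih =>
      intro h
      rw [List.map_cons, List.sum_cons, List.length_cons]
      have h4 := hM a (h a (by simp))
      have h5 := ih fun b hb => h b (by simp [hb])
      refine (abs_add_le _ _).trans ?_
      push_cast
      linarith
  refine (hsum _ hdig).trans ?_
  rw [div_mul_eq_mul_div, le_div_iff₀ hl2]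
  nlinarith

/-- The factor `v^{-2s}`. -/
def pairWeight (s : ℂ) (q : CoprimePair) : ℂ := Complex.exp (-(2 * s) * Real.log q.1.2)

/-- The centred cost `C(u / v) - μ log v`. -/
def centredCost (c : ℕ → ℝ) (q : CoprimePair) : ℝ :=
  cost c q.1.1 q.1.2 - mean c * Real.log q.1.2

theorem norm_pairWeight (s : ℂ) (q : CoprimePair) :
    ‖pairWeight s q‖ = Real.exp (-(2 * s.re) * Real.log q.1.2) := by
  rw [pairWeight, Complex.norm_exp, Complex.re_mul_ofReal]
  simp

/-- As `u < v`, the term `v^{-t}` is at most `u^{-t/2} v^{-t/2}`, and the double series factors. -/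
theorem summable_exp_neg_mul_log {t : ℝ} (ht : 2 < t) :
    Summable fun q : CoprimePair => Real.exp (-t * Real.log q.1.2) := by
  have h1 : Summable fun n : ℕ => (n : ℝ) ^ (-(t / 2)) := Real.summable_nat_rpow.2 (by linarith)
  have h2 := h1.mul_of_nonneg h1 (fun n => by positivity) fun n => by positivity
  refine Summable.of_nonneg_of_le (fun q => (Real.exp_pos _).le) (fun q => ?_)
    (h2.comp_injective (Subtype.val_injective (p := fun q : ℕ × ℕ =>
      1 ≤ q.1 ∧ q.1 < q.2 ∧ q.1.Coprime q.2)))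
  obtain ⟨⟨u, v⟩, h3, h4, -⟩ := q
  simp only [Function.comp_apply] at h3 h4 ⊢
  have hu : (0 : ℝ) < u := by exact_mod_cast h3
  have huv : (u : ℝ) ≤ v := by exact_mod_cast h4.le
  have hv : (0 : ℝ) < v := hu.trans_le huv
  rw [Real.rpow_def_of_pos hu, Real.rpow_def_of_pos hv, ← Real.exp_add]
  have := Real.log_le_log hu huv
  refine Real.exp_le_exp.2 ?_
  nlinarith

theorem exists_summable_pairWeight {c : ℕ → ℝ} {M : ℝ} (hM : ∀ n, 1 ≤ n → |c n| ≤ M) {s : ℂ}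
    (hs : 1 < s.re) : ∃ r > 0, Summable fun q : CoprimePair =>
      ‖pairWeight s q‖ * Real.exp (r * ‖(centredCost c q : ℂ)‖) := by
  set K := 3 * M / Real.log 2 + |mean c| with hK
  have hM0 : 0 ≤ M := (abs_nonneg _).trans (hM 1 le_rfl)
  have hl2 := log_two_pos
  have hK0 : 0 ≤ K := by rw [hK]; positivity
  -- The centred cost is at most `K log v`, so the exponential costs a factor at most `v^{Re s -
  -- 1}`, and the exponent `2 Re s - (Re s - 1) = Re s + 1` still exceeds `2`.
  set r := (s.re - 1) / (K + 1) with hr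
  have hr0 : 0 < r := div_pos (by linarith) (by linarith)
  have hrK : r * K ≤ s.re - 1 := by
    rw [hr, div_mul_eq_mul_div, div_le_iff₀ (by linarith)]
    nlinarith
  refine ⟨r, hr0, Summable.of_nonneg_of_le (fun q => by positivity) (fun q => ?_)
    (summable_exp_neg_mul_log (t := s.re + 1) (by linarith))⟩
  rw [norm_pairWeight, ← Real.exp_add]
  refine Real.exp_le_exp.2 ?_
  have hlog : 0 ≤ Real.log q.1.2 := Real.log_natCast_nonneg _
  have h1 : ‖(centredCost c q : ℂ)‖ ≤ K * Real.log q.1.2 := by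
    rw [Complex.norm_real, Real.norm_eq_abs, centredCost, hK, add_mul]
    refine (abs_sub _ _).trans (add_le_add (abs_cost_le hM q) ?_)
    rw [abs_mul, abs_of_nonneg hlog]
  have h2 := mul_le_mul_of_nonneg_left h1 hr0.le
  have h3 := mul_le_mul_of_nonneg_right hrK hlog
  nlinarith

/-! ### The Dirichlet series as a sum over coprime pairs -/

theorem mem_Omega_diff {k : ℕ} {q : ℕ × ℕ} : q ∈ Omega (k + 1) \ Omega (k + 1 - 1) ↔
    (1 ≤ q.1 ∧ q.1 < q.2 ∧ q.1.Coprime q.2) ∧ q.2 = k + 1 := by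
  simp only [Omega, Finset.mem_sdiff, Finset.mem_filter, Finset.mem_product, Finset.mem_Icc]
  constructor
  · rintro ⟨⟨⟨h1, h2⟩, h3, h4⟩, h5⟩
    refine ⟨⟨h1.1, h3, h4⟩, ?_⟩
    by_contra hne
    exact h5 ⟨⟨⟨h1.1, by omega⟩, h2.1, by omega⟩, h3, h4⟩
  · rintro ⟨⟨h1, h3, h4⟩, h5⟩
    exact ⟨⟨⟨⟨h1, by omega⟩, by omega, by omega⟩, h3, h4⟩, fun h => by omega⟩

theorem hasSum_Omega_diff {E : Type*} [NormedAddCommGroup E] [CompleteSpace E] {F : ℕ × ℕ → E}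
    {a : E} (h : HasSum (fun q : CoprimePair => F q.1) a) :
    HasSum (fun k : ℕ => ∑ q ∈ Omega (k + 1) \ Omega (k + 1 - 1), F q) a := by
  -- The pairs are grouped by denominator `v = k + 1`; the truncated subtraction is harmless because
  -- `v ≥ 2`.
  have h1 := h.tsum_fiberwise (fun q : CoprimePair => q.1.2 - 1)
  refine h1.congr_fun fun k => ?_
  have hsupp : ∀ q : CoprimePair, q.1.2 - 1 = k ↔ q.1.2 = k + 1 := fun q => by
    have := q.2.2.1
    omega
  let e : ((fun q : CoprimePair => q.1.2 - 1) ⁻¹' {k}) ≃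
      {q // q ∈ Omega (k + 1) \ Omega (k + 1 - 1)} :=
    { toFun := fun q => ⟨q.1.1, mem_Omega_diff.2 ⟨q.1.2, (hsupp q.1).1 q.2⟩⟩
      invFun := fun q => ⟨⟨q.1, (mem_Omega_diff.1 q.2).1⟩,
        (hsupp ⟨q.1, (mem_Omega_diff.1 q.2).1⟩).2 (mem_Omega_diff.1 q.2).2⟩
      left_inv := fun q => rfl
      right_inv := fun q => rfl }
  have h2 := e.tsum_eq (fun q => F q.1)
  rw [Finset.tsum_subtype (Omega (k + 1) \ Omega (k + 1 - 1)) F] at h2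
  exact h2.symm

theorem natCast_cpow_inv (s : ℂ) (k : ℕ) :
    1 / ((k + 1 : ℕ) : ℂ) ^ (2 * s) = Complex.exp (-(2 * s) * Real.log (k + 1 : ℕ)) := by
  rw [Complex.cpow_def_of_ne_zero (by exact_mod_cast Nat.succ_ne_zero k), one_div,
    ← Complex.exp_neg, Complex.natCast_log]
  congr 1
  ring

theorem dirichletTerm_eq (c : ℕ → ℝ) (p : ℕ) (s : ℂ) (k : ℕ) : dirichletTerm c p s k =
    ∑ q ∈ Omega (k + 1) \ Omega (k + 1 - 1), Complex.exp (-(2 * s) * Real.log q.2) *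
      ((cost c q.1 q.2 - mean c * Real.log q.2 : ℝ) : ℂ) ^ p := by
  rw [dirichletTerm, dirichletCoeff, natCast_cpow_inv, Complex.ofReal_sum, Finset.mul_sum]
  refine Finset.sum_congr rfl fun q hq => ?_
  rw [(mem_Omega_diff.1 hq).2, Complex.ofReal_pow]

theorem summable_dirichletTerm {c : ℕ → ℝ} {M : ℝ} (hM : ∀ n, 1 ≤ n → |c n| ≤ M) (p : ℕ) {s : ℂ}
    (hs : 1 < s.re) : Summable fun k : ℕ => ‖dirichletTerm c p s k‖ := by
  obtain ⟨r, hr, h⟩ := exists_summable_pairWeight hM hs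
  have h1 := (summable_mul_pow_of_exp h p hr).hasSum
  simp only [zero_mul, Real.exp_zero, mul_one] at h1
  have h2 := hasSum_Omega_diff (F := fun q : ℕ × ℕ => ‖Complex.exp (-(2 * s) * Real.log q.2)‖ *
      ‖((cost c q.1 q.2 - mean c * Real.log q.2 : ℝ) : ℂ)‖ ^ p) h1
  refine Summable.of_nonneg_of_le (fun k => norm_nonneg _) (fun k => ?_) h2.summable
  rw [dirichletTerm_eq]
  refine (norm_sum_le _ _).trans (le_of_eq (Finset.sum_congr rfl fun q _ => ?_))
  rw [norm_mul, norm_pow]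

theorem dirichletSeries_eq_iteratedDeriv {c : ℕ → ℝ} {M : ℝ} (hM : ∀ n, 1 ≤ n → |c n| ≤ M) (p : ℕ)
    {s : ℂ} (hs : 1 < s.re) : dirichletSeries c p s = iteratedDeriv p (fun ω : ℂ =>
      ∑' q : CoprimePair, pairWeight s q * Complex.exp (ω * centredCost c q)) 0 := by
  obtain ⟨r, hr, h⟩ := exists_summable_pairWeight hM hs
  have h1 := iteratedDeriv_tsum_exp_zero hr h p
  have h2 := hasSum_Omega_diff (F := fun q : ℕ × ℕ => Complex.exp (-(2 * s) * Real.log q.2) *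
      ((cost c q.1 q.2 - mean c * Real.log q.2 : ℝ) : ℂ) ^ p) h1
  simp only [← dirichletTerm_eq] at h2
  exact h2.tsum_eq

/-! ### The renewal identity -/

/-- The weight `e^{ω C(u/v)} v^{-(2s + μ ω)}`. -/
def fullWeight (c : ℕ → ℝ) (s ω : ℂ) (q : CoprimePair) : ℂ :=
  pairWeight s q * Complex.exp (ω * centredCost c q)

theorem fullWeight_eq (c : ℕ → ℝ) (s ω : ℂ) (q : CoprimePair) : fullWeight c s ω q =
    Complex.exp (ω * cost c q.1.1 q.1.2 - (2 * s + mean c * ω) * Real.log q.1.2) := by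
  rw [fullWeight, pairWeight, ← Complex.exp_add, centredCost]
  congr 1
  push_cast
  ring

/-- The rational number `u / v`. -/
def ratio (q : CoprimePair) : ℂ := (((q.1.1 : ℝ) / q.1.2 : ℝ) : ℂ)

theorem ratio_mem (q : CoprimePair) : ratio q ∈ disc := by
  obtain ⟨⟨u, v⟩, h1, h2, -⟩ := q
  simp only at h1 h2
  have hv : (0 : ℝ) < v := by exact_mod_cast (show 0 < v by omega)
  refine ofReal_mem_disc_of_mem_Icc ⟨by positivity, ?_⟩
  rw [div_le_one hv]
  exact_mod_cast h2.le

theorem branch_ofReal (c : ℕ → ℝ) (s ω : ℂ) (n : ℕ) (f : HInf) {a b : ℝ} (hb : 0 < b)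
    (hab : 0 < a + n * b) : branch c s ω n f ((a / b : ℝ) : ℂ) =
      Complex.exp (ω * c n - (2 * s + mean c * ω) * (Real.log (a + n * b) - Real.log b)) *
        value f ((b / (a + n * b) : ℝ) : ℂ) := by
  have e1 : ((a / b : ℝ) : ℂ) + n = (((a + n * b) / b : ℝ) : ℂ) := by
    rw [add_div, mul_div_cancel_right₀ _ hb.ne']
    push_cast; rfl
  have hpos : 0 < (a + n * b) / b := div_pos hab hb
  have e2 : (1 : ℂ) / (((a + n * b) / b : ℝ) : ℂ) = ((b / (a + n * b) : ℝ) : ℂ) := by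
    rw [← Complex.ofReal_one, ← Complex.ofReal_div, one_div_div]
  rw [branch, e1, e2, Complex.cpow_def_of_ne_zero (Complex.ofReal_ne_zero.2 hpos.ne'),
    ← Complex.exp_sub, ← Complex.ofReal_log hpos.le, Real.log_div hab.ne' hb.ne']
  congr 2
  push_cast
  ring

/-- The child's denominator is `v (u/v + k + 1)` and its cost grows by `c(k + 1)`, so the ratio of
the two weights is the branch weight at `u/v`. -/
theorem fullWeight_child (c : ℕ → ℝ) (s ω : ℂ) (q : CoprimePair) (k : ℕ) (f : HInf) :
    fullWeight c s ω (q.child k) * value f (ratio (q.child k)) =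
      fullWeight c s ω q * branch c s ω (k + 1) f (ratio q) := by
  have hv : (0 : ℝ) < q.1.2 := by exact_mod_cast (lt_of_lt_of_le q.2.1 q.2.2.1.le)
  have huv : (0 : ℝ) < q.1.1 + (k + 1 : ℕ) * q.1.2 := by positivity
  rw [ratio, ratio, branch_ofReal c s ω (k + 1) f hv huv, fullWeight_eq, fullWeight_eq, cost_child,
    ← mul_assoc, ← Complex.exp_add]
  have e : (((q.child k).1.2 : ℕ) : ℝ) = q.1.1 + (k + 1 : ℕ) * q.1.2 := by
    simp only [CoprimePair.child]; push_cast; ring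
  have e' : (q.child k).1.1 = q.1.2 := rfl
  rw [e, e']
  congr 2
  push_cast
  ring

/-- The pair `(1, k + 2)` acts as the image of `0/1` under the branch `n = k + 2`. Excluding `n =
1`, which would give `1/1`, is why `𝓕` starts at `2`. -/
theorem fullWeight_root (c : ℕ → ℝ) (s ω : ℂ) (k : ℕ) (f : HInf) :
    fullWeight c s ω (CoprimePair.root k) * value f (ratio (CoprimePair.root k)) =
      branch c s ω (k + 2) f 0 := by
  have huv : (0 : ℝ) < 0 + (k + 2 : ℕ) * 1 := by positivity
  have h := branch_ofReal c s ω (k + 2) f (a := 0) one_pos huv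
  rw [zero_div, Complex.ofReal_zero, zero_add, mul_one] at h
  rw [h, fullWeight_eq, cost_root, ratio]
  have e : (((CoprimePair.root k).1.2 : ℕ) : ℝ) = (k + 2 : ℕ) := rfl
  have e' : (((CoprimePair.root k).1.1 : ℕ) : ℝ) = 1 := by simp [CoprimePair.root]
  rw [e, e', Real.log_one, Complex.ofReal_zero, sub_zero]

theorem zero_mem_disc : (0 : ℂ) ∈ disc := by
  have := ofReal_mem_disc (x := 0) (by norm_num) (by norm_num)
  rwa [Complex.ofReal_zero] at this

theorem summable_fullWeight_value {c : ℕ → ℝ} {s ω : ℂ} (h : Summable fun q => ‖fullWeight c s ω q‖)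
    (f : HInf) : Summable fun q => fullWeight c s ω q * value f (ratio q) := by
  refine Summable.of_norm_bounded (h.mul_right ‖f‖) fun q => ?_
  rw [norm_mul]
  exact mul_le_mul_of_nonneg_left (norm_value_le f _) (norm_nonneg _)

/-- The renewal equation: splitting the pairs by `decode`, the children of all pairs reproduce the
sum with `𝓛 f` in place of `f`, and the roots contribute `(𝓕 f)(0)`. -/
theorem tsum_fullWeight_value {c : ℕ → ℝ} {M : ℝ} (hM : ∀ n, 1 ≤ n → |c n| ≤ M) {s ω : ℂ}
    (hs : 1 < (2 * s + mean c * ω).re) (h : Summable fun q => ‖fullWeight c s ω q‖) (f : HInf) :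
    ∑' q, fullWeight c s ω q * value f (ratio q) =
      (∑' q, fullWeight c s ω q * value (opL c s ω f) (ratio q)) + value (opF c s ω f) 0 := by
  set F : CoprimePair → ℂ := fun q => fullWeight c s ω q * value f (ratio q) with hF
  have hsum : Summable F := summable_fullWeight_value h f
  let e := Equiv.ofBijective _ CoprimePair.decode_bijective
  have hsum' : Summable (F ∘ e) := e.summable_iff.2 hsum
  have h1 : Summable ((F ∘ e) ∘ Sum.inl) := hsum'.comp_injective Sum.inl_injective
  have h2 : Summable ((F ∘ e) ∘ Sum.inr) := hsum'.comp_injective Sum.inr_injective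
  rw [← e.tsum_eq F]
  have h3 := Summable.tsum_sum h1 h2
  refine h3.trans ?_
  congr 1
  · refine h1.tsum_prod.trans ?_
    refine tsum_congr fun q => ?_
    rw [← (hasSum_value_opL hM hs f (ratio_mem q)).tsum_eq, ← tsum_mul_left]
    exact tsum_congr fun k => fullWeight_child c s ω q k f
  · rw [← (hasSum_value_opF hM hs f zero_mem_disc).tsum_eq]
    exact tsum_congr fun k => fullWeight_root c s ω k f

/-- The renewal equation is applied to `x = (1 - 𝓛)⁻¹ 𝟏`, for which `x - 𝓛 x = 𝟏`. No Neumann series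
is involved, so invertibility and absolute convergence suffice. -/
theorem tsum_fullWeight {c : ℕ → ℝ} {M : ℝ} (hM : ∀ n, 1 ≤ n → |c n| ≤ M) {s ω : ℂ}
    (hs : 1 < (2 * s + mean c * ω).re) (h : Summable fun q => ‖fullWeight c s ω q‖)
    (hu : IsUnit (1 - opL c s ω)) : ∑' q, fullWeight c s ω q =
      value (opF c s ω (Ring.inverse (1 - opL c s ω) oneH)) 0 := by
  set x := Ring.inverse (1 - opL c s ω) oneH with hx
  have h1 : oneH = x - opL c s ω x := by
    have := congrArg (fun T : HInf →L[ℂ] HInf => T oneH) (Ring.mul_inverse_cancel _ hu)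
    exact this.symm
  have h2 := tsum_fullWeight_value hM hs h x
  have h3 : ∑' q, fullWeight c s ω q = ∑' q, (fullWeight c s ω q * value x (ratio q) -
      fullWeight c s ω q * value (opL c s ω x) (ratio q)) := by
    refine tsum_congr fun q => ?_
    rw [← mul_sub, ← value_sub, ← h1, value_oneH (ratio_mem q), mul_one]
  rw [h3, (summable_fullWeight_value h x).tsum_sub (summable_fullWeight_value h _), h2]
  ring

/-- The resolvent expression `𝓕_{s,ω} (1 - 𝓛_{s,ω})⁻¹ 𝟏 (0)`. -/
def resolventValue (c : ℕ → ℝ) (s ω : ℂ) : ℂ :=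
  value (opF c s ω (Ring.inverse (1 - opL c s ω) oneH)) 0

/-- The `p`-th derivative in `ω` of the resolvent expression at `ω = 0`. -/
def resolventDeriv (c : ℕ → ℝ) (p : ℕ) (s : ℂ) : ℂ := iteratedDeriv p (resolventValue c s) 0

theorem analyticAt_clm_apply {X Y Z : Type*} [NormedAddCommGroup X] [NormedSpace ℂ X]
    [NormedAddCommGroup Y] [NormedSpace ℂ Y] [NormedAddCommGroup Z] [NormedSpace ℂ Z]
    {T : X → (Y →L[ℂ] Z)} {f : X → Y} {x : X} (hT : AnalyticAt ℂ T x) (hf : AnalyticAt ℂ f x) :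
    AnalyticAt ℂ (fun x => T x (f x)) x :=
  AnalyticAt.comp (g := fun q : (Y →L[ℂ] Z) × Y => q.1 q.2) (f := fun x => (T x, f x))
    ((ContinuousLinearMap.id ℂ (Y →L[ℂ] Z)).analyticAt_bilinear _) (hT.prod hf)

theorem analyticAt_resolventValue {c : ℕ → ℝ} {M : ℝ} (hM : ∀ n, 1 ≤ n → |c n| ≤ M) {s ω : ℂ}
    (hs : 1 < (2 * s + mean c * ω).re) (hu : IsUnit (1 - opL c s ω)) :
    AnalyticAt ℂ (fun x : ℂ × ℂ => resolventValue c x.1 x.2) (s, ω) := by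
  obtain ⟨U, hU⟩ := hu
  have h1 : AnalyticAt ℂ (fun x : ℂ × ℂ => 1 - opL c x.1 x.2) (s, ω) :=
    analyticAt_const.sub (analyticAt_opL hM hs)
  have h2 : AnalyticAt ℂ (fun x : ℂ × ℂ => Ring.inverse (1 - opL c x.1 x.2)) (s, ω) := by
    refine AnalyticAt.fun_comp (g := Ring.inverse) ?_ h1
    rw [← hU]
    exact analyticAt_inverse U
  have h3 : AnalyticAt ℂ (fun x : ℂ × ℂ => Ring.inverse (1 - opL c x.1 x.2) oneH) (s, ω) :=
    analyticAt_clm_apply h2 analyticAt_const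
  have h4 := analyticAt_clm_apply (analyticAt_opF hM hs) h3
  exact AnalyticAt.comp (g := evalL 0) ((evalL 0).analyticAt _) h4

/-- Parametrised derivatives of a jointly analytic function. -/
theorem analyticAt_iteratedDeriv_snd {H : ℂ → ℂ → ℂ} {s ω : ℂ}
    (h : AnalyticAt ℂ (fun x : ℂ × ℂ => H x.1 x.2) (s, ω)) (p : ℕ) :
    AnalyticAt ℂ (fun x : ℂ × ℂ => iteratedDeriv p (H x.1) x.2) (s, ω) := by
  induction p with
  | zero => simpa using h
  | succ p ih =>
    have h1 := ih.fderiv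
    have h2 : AnalyticAt ℂ (fun x : ℂ × ℂ =>
        fderiv ℂ (fun x : ℂ × ℂ => iteratedDeriv p (H x.1) x.2) x (0, 1)) (s, ω) :=
      analyticAt_clm_apply h1 analyticAt_const
    refine h2.congr ?_
    filter_upwards [ih.eventually_analyticAt] with x hx
    rw [iteratedDeriv_succ]
    have h3 : HasDerivAt (fun t : ℂ => (x.1, t)) ((0, 1) : ℂ × ℂ) x.2 :=
      (hasDerivAt_const x.2 x.1).prodMk (hasDerivAt_id x.2)
    have h4 := HasFDerivAt.comp_hasDerivAt (f := fun t : ℂ => (x.1, t)) x.2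
      (l := fun x : ℂ × ℂ => iteratedDeriv p (H x.1) x.2) hx.differentiableAt.hasFDerivAt h3
    exact h4.deriv.symm

theorem analyticAt_resolventDeriv {c : ℕ → ℝ} {M : ℝ} (hM : ∀ n, 1 ≤ n → |c n| ≤ M) (p : ℕ) {s : ℂ}
    (hs : 1 ≤ s.re) (hs1 : s ≠ 1) : AnalyticAt ℂ (resolventDeriv c p) s := by
  have h := analyticAt_iteratedDeriv_snd (H := resolventValue c)
    (analyticAt_resolventValue hM (two_mul_re (c := c) hs) (isUnit_one_sub_opL hM hs hs1)) p
  exact AnalyticAt.comp (g := fun x : ℂ × ℂ => iteratedDeriv p (resolventValue c x.1) x.2)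
    (f := fun s : ℂ => (s, (0 : ℂ))) h (analyticAt_id.prod analyticAt_const)

/-- For fixed `s` the closed form holds for all `ω` in a neighbourhood of `0`, since invertibility
and absolute convergence persist there; this suffices for comparing derivatives. -/
theorem dirichletSeries_eq_resolventDeriv {c : ℕ → ℝ} {M : ℝ} (hM : ∀ n, 1 ≤ n → |c n| ≤ M) (p : ℕ)
    {s : ℂ} (hs : 1 < s.re) : dirichletSeries c p s = resolventDeriv c p s := by
  rw [dirichletSeries_eq_iteratedDeriv hM p hs, resolventDeriv]
  refine Filter.EventuallyEq.iteratedDeriv_eq p ?_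
  obtain ⟨r, hr, h⟩ := exists_summable_pairWeight hM hs
  have hs0 := two_mul_re (c := c) hs.le
  have hs1 : s ≠ 1 := fun h => by rw [h] at hs; simp at hs
  have htend : Tendsto (fun ω : ℂ => (s, ω)) (𝓝 0) (𝓝 (s, 0)) :=
    (Continuous.prodMk_right s).tendsto 0
  have hunit : ∀ᶠ ω : ℂ in 𝓝 0, IsUnit (1 - opL c s ω) := by
    have h1 : Tendsto (fun ω : ℂ => 1 - opL c s ω) (𝓝 0) (𝓝 (1 - opL c s 0)) :=
      ((analyticAt_opL hM hs0).continuousAt.tendsto.comp htend).const_sub 1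
    exact h1.eventually (Units.isOpen.mem_nhds (isUnit_one_sub_opL hM hs.le hs1))
  filter_upwards [htend.eventually (eventually_re_gt hs0), hunit,
    Metric.ball_mem_nhds (0 : ℂ) hr] with ω h1 h2 h3
  refine tsum_fullWeight hM h1 ?_ h2
  refine Summable.of_nonneg_of_le (fun q => norm_nonneg _) (fun q => ?_) h
  rw [fullWeight, norm_mul]
  refine mul_le_mul_of_nonneg_left ?_ (norm_nonneg _)
  exact norm_exp_mul_le (by simpa using (Metric.mem_ball.1 h3).le)

/-! ### Poles produced by a simple zero of a denominator -/

theorem exists_analyticAt_sub_mul {f : ℂ → ℂ} {x : ℂ} (hf : AnalyticAt ℂ f x) :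
    ∃ g : ℂ → ℂ, AnalyticAt ℂ g x ∧ g x = deriv f x ∧ ∀ s, f s = f x + (s - x) * g s := by
  obtain ⟨p, hp⟩ := hf
  refine ⟨dslope f x, ⟨_, hp.has_fpower_series_dslope_fslope⟩, dslope_same f x, fun s => ?_⟩
  have := sub_smul_dslope f x s
  rw [smul_eq_mul] at this
  rw [this]; ring

theorem exists_taylor {f : ℂ → ℂ} {x : ℂ} (hf : AnalyticAt ℂ f x) (n : ℕ) :
    ∃ (b : ℕ → ℂ) (r : ℂ → ℂ), b 0 = f x ∧ AnalyticAt ℂ r x ∧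
      ∀ s, f s = ∑ i ∈ Finset.range (n + 1), b i * (s - x) ^ i + (s - x) ^ (n + 1) * r s := by
  induction n generalizing f with
  | zero =>
    obtain ⟨g, hg, -, h⟩ := exists_analyticAt_sub_mul hf
    exact ⟨fun _ => f x, g, rfl, hg, fun s => by rw [h s]; simp⟩
  | succ n ih =>
    obtain ⟨g, hg, -, h⟩ := exists_analyticAt_sub_mul hf
    obtain ⟨b, r, -, hr, h'⟩ := ih hg
    refine ⟨fun i => Nat.casesOn i (f x) b, r, rfl, hr, fun s => ?_⟩
    rw [h s, h' s, Finset.sum_range_succ' _ (n + 1), mul_add, Finset.mul_sum]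
    change _ = ∑ i ∈ Finset.range (n + 1), b i * (s - x) ^ (i + 1) + f x * (s - x) ^ 0 + _
    have : ∀ i ∈ Finset.range (n + 1), (s - x) * (b i * (s - x) ^ i) = b i * (s - x) ^ (i + 1) :=
      fun i _ => by ring
    rw [Finset.sum_congr rfl this]
    ring

/-- If `E H = η` as formal exponential series with analytic coefficients, where `E₀` has a simple
zero and `E₁` vanishes at `1`, then `H_p` has at `1` a pole of order at most `1 + ⌊p / 2⌋`. -/
theorem exists_pole_coefficient {H E η : ℕ → ℂ → ℂ} (hE : ∀ j, AnalyticAt ℂ (E j) 1)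
    (hη : ∀ j, AnalyticAt ℂ (η j) 1) (hE0 : E 0 1 = 0) (hd : deriv (E 0) 1 ≠ 0) (hE1 : E 1 1 = 0)
    (hrec : ∀ p, ∀ᶠ s in 𝓝[≠] (1 : ℂ),
      ∑ j ∈ Finset.range (p + 1), (p.choose j : ℂ) * E j s * H (p - j) s = η p s) (p : ℕ) :
    ∃ K : ℂ → ℂ, AnalyticAt ℂ K 1 ∧ (∀ᶠ s in 𝓝[≠] (1 : ℂ), (s - 1) ^ (1 + p / 2) * H p s = K s) ∧
      (Even p → K 1 = p.factorial * (-E 2 1 / (2 * deriv (E 0) 1)) ^ (p / 2) *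
        (η 0 1 / deriv (E 0) 1)) := by
  induction p using Nat.strong_induction_on with
  | _ p ih =>
    obtain ⟨e, he, he1, hEe⟩ := exists_analyticAt_sub_mul (hE 0)
    simp only [hE0, zero_add] at hEe
    have he0 : e 1 ≠ 0 := he1 ▸ hd
    -- The recursion is solved for `E 0 * H p`, where `E 0` is `(s - 1)` times a unit. Every other
    -- term becomes analytic after multiplication by `(s - 1)^(p/2)`, and for even `p` only the one
    -- with `E 2` is nonzero at `1`.
    have hA : ∀ j ∈ Finset.range p, ∃ A : ℂ → ℂ, AnalyticAt ℂ A 1 ∧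
        (∀ᶠ s in 𝓝[≠] (1 : ℂ), (s - 1) ^ (p / 2) * (E (j + 1) s * H (p - (j + 1)) s) = A s) ∧
        (Even p → A 1 = if j = 1 then E 2 1 * ((p - 2).factorial *
          (-E 2 1 / (2 * deriv (E 0) 1)) ^ ((p - 2) / 2) * (η 0 1 / deriv (E 0) 1)) else 0) := by
      intro j hj
      rw [Finset.mem_range] at hj
      obtain ⟨K, hK, hKs, hKe⟩ := ih (p - (j + 1)) (by omega)
      rcases Nat.eq_zero_or_pos j with rfl | hj0
      · obtain ⟨e₁, he₁, -, hEe₁⟩ := exists_analyticAt_sub_mul (hE 1)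
        simp only [hE1, zero_add] at hEe₁
        -- The zero of `E 1` lowers the pole order of `H (p - 1)` by one; for even `p` a further
        -- factor `s - 1` remains, so this term vanishes at `1`.
        obtain ⟨m, hm⟩ : ∃ m, p / 2 = (p - (0 + 1)) / 2 + m := ⟨p / 2 - (p - (0 + 1)) / 2, by omega⟩
        refine ⟨fun s => (s - 1) ^ m * e₁ s * K s,
          (((analyticAt_id.sub analyticAt_const).pow m).mul he₁).mul hK, ?_, fun hp => ?_⟩
        · filter_upwards [hKs] with s hs
          rw [zero_add, hEe₁ s, ← hs, hm]
          rw [zero_add]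
          ring
        · have hm1 : m ≠ 0 := by obtain ⟨r, rfl⟩ := hp; omega
          simp [hm1]
      · obtain ⟨m, hm⟩ : ∃ m, p / 2 = 1 + (p - (j + 1)) / 2 + m :=
          ⟨p / 2 - (1 + (p - (j + 1)) / 2), by omega⟩
        refine ⟨fun s => (s - 1) ^ m * E (j + 1) s * K s,
          (((analyticAt_id.sub analyticAt_const).pow m).mul (hE _)).mul hK, ?_, fun hp => ?_⟩
        · filter_upwards [hKs] with s hs
          rw [← hs, hm]
          ring
        · split_ifs with hj1
          · subst hj1
            have hm0 : m = 0 := by omega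
            have hpe : Even (p - 2) := by
              rw [Nat.even_sub (by omega)]; simp [hp]
            have hK1 := hKe hpe
            simp only [hm0, pow_zero, one_mul]
            rw [hK1]
          · have hm1 : m ≠ 0 := by obtain ⟨r, rfl⟩ := hp; omega
            simp [hm1]
    choose! A hAa hAs hAe using hA
    refine ⟨fun s => (e s)⁻¹ * ((s - 1) ^ (p / 2) * η p s -
      ∑ j ∈ Finset.range p, (p.choose (j + 1) : ℂ) * A j s), ?_, ?_, fun hp => ?_⟩
    · refine (he.inv he0).mul (AnalyticAt.sub
        (((analyticAt_id.sub analyticAt_const).pow _).mul (hη p)) ?_)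
      exact Finset.analyticAt_fun_sum _ fun j hj => analyticAt_const.mul (hAa j hj)
    · have hall : ∀ᶠ s in 𝓝[≠] (1 : ℂ), ∀ j ∈ Finset.range p,
          (s - 1) ^ (p / 2) * (E (j + 1) s * H (p - (j + 1)) s) = A j s :=
        (Filter.eventually_all_finset _).2 hAs
      have hene : ∀ᶠ s in 𝓝[≠] (1 : ℂ), e s ≠ 0 :=
        (he.continuousAt.eventually_ne he0).filter_mono nhdsWithin_le_nhds
      filter_upwards [hrec p, hall, hene] with s h1 h2 h3
      rw [Finset.sum_range_succ', Nat.choose_zero_right, Nat.cast_one, one_mul, Nat.sub_zero,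
        hEe s] at h1
      have h4 : ∑ j ∈ Finset.range p, (p.choose (j + 1) : ℂ) * A j s = (s - 1) ^ (p / 2) *
          ∑ j ∈ Finset.range p, (p.choose (j + 1) : ℂ) * E (j + 1) s * H (p - (j + 1)) s := by
        rw [Finset.mul_sum]
        refine Finset.sum_congr rfl fun j hj => ?_
        rw [← h2 j hj]; ring
      rw [h4, ← h1]
      field_simp
      ring
    · rcases Nat.eq_zero_or_pos p with rfl | hp0
      · simp [he1]; ring
      obtain ⟨r, rfl⟩ : ∃ r, p = 2 * (r + 1) := by
        obtain ⟨r, rfl⟩ := hp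
        exact ⟨r - 1, by omega⟩
      have hsum : ∑ j ∈ Finset.range (2 * (r + 1)), ((2 * (r + 1)).choose (j + 1) : ℂ) * A j 1 =
          ((2 * (r + 1)).choose 2 : ℂ) * A 1 1 := by
        refine Finset.sum_eq_single_of_mem 1 (by simp; omega) fun j hj hj1 => ?_
        rw [hAe j hj hp, if_neg hj1, mul_zero]
      have hA1 := hAe 1 (by simp; omega) hp
      rw [if_pos rfl] at hA1
      have hfac : (((2 * (r + 1)).factorial : ℕ) : ℂ) =
          2 * ((2 * (r + 1)).choose 2 : ℂ) * ((2 * (r + 1) - 2).factorial : ℂ) := by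
        have := Nat.choose_mul_factorial_mul_factorial (n := 2 * (r + 1)) (k := 2) (by omega)
        rw [Nat.factorial_two] at this
        rw [← this]; push_cast; ring
      simp only []
      rw [hsum, hA1, hfac, he1, show 2 * (r + 1) / 2 = r + 1 by omega,
        show (2 * (r + 1) - 2) / 2 = r by omega, sub_self, zero_pow (by omega), pow_succ]
      field_simp
      ring

theorem meromorphicAt_of_pow_mul {f K : ℂ → ℂ} {x : ℂ} {n : ℕ} (hK : AnalyticAt ℂ K x)
    (h : ∀ᶠ s in 𝓝[≠] x, (s - x) ^ n * f s = K s) :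
    MeromorphicAt f x ∧ ((-(n : ℤ) : ℤ) : WithTop ℤ) ≤ meromorphicOrderAt f x := by
  have hpow : AnalyticAt ℂ (fun s : ℂ => (s - x) ^ n) x :=
    (analyticAt_id.sub analyticAt_const).pow n
  have heq : (fun s => ((fun s : ℂ => (s - x) ^ n)⁻¹ * K) s) =ᶠ[𝓝[≠] x] f := by
    filter_upwards [h, self_mem_nhdsWithin] with s hs hne
    have : (s - x) ^ n ≠ 0 := pow_ne_zero _ (sub_ne_zero.2 hne)
    simp only [Pi.mul_apply, Pi.inv_apply]
    rw [← hs, inv_mul_cancel_left₀ this]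
  have hmer : MeromorphicAt ((fun s : ℂ => (s - x) ^ n)⁻¹ * K) x :=
    hpow.meromorphicAt.inv.mul hK.meromorphicAt
  refine ⟨hmer.congr heq, ?_⟩
  rw [← meromorphicOrderAt_congr heq,
    meromorphicOrderAt_mul hpow.meromorphicAt.inv hK.meromorphicAt, meromorphicOrderAt_inv]
  have h1 : meromorphicOrderAt (fun s : ℂ => (s - x) ^ n) x = (n : ℤ) := by
    rw [meromorphicOrderAt_eq_int_iff hpow.meromorphicAt]
    exact ⟨fun _ => 1, analyticAt_const, one_ne_zero, Eventually.of_forall fun s => by simp⟩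
  rw [h1]
  have h2 := hK.meromorphicOrderAt_nonneg
  calc ((-(n : ℤ) : ℤ) : WithTop ℤ) = -((n : ℤ) : WithTop ℤ) + 0 := by rw [add_zero]; rfl
    _ ≤ _ := by gcongr

theorem exists_principal_part {G K : ℂ → ℂ} {n : ℕ} {U : Set ℂ}
    (hG : ∀ s ∈ U, s ≠ 1 → AnalyticAt ℂ G s) (hK : AnalyticAt ℂ K 1)
    (h : ∀ᶠ s in 𝓝[≠] (1 : ℂ), (s - 1) ^ (1 + n) * G s = K s) :
    ∃ (R : ℂ → ℂ) (a : ℕ → ℂ), AnalyticOnNhd ℂ R U ∧ ∀ s, s ≠ 1 →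
      G s = K 1 / (s - 1) ^ (1 + n) + ∑ k ∈ Finset.Icc 1 n, a k / (s - 1) ^ k + R s := by
  obtain ⟨b, r, hb, hr, hKr⟩ := exists_taylor hK n
  set Q : ℂ → ℂ := fun s => K 1 / (s - 1) ^ (1 + n) +
    ∑ k ∈ Finset.Icc 1 n, b (n + 1 - k) / (s - 1) ^ k with hQ
  have hQs : ∀ s, s ≠ 1 → (s - 1) ^ (1 + n) * Q s =
      ∑ i ∈ Finset.range (n + 1), b i * (s - 1) ^ i := fun s hs => by
    have hne : s - 1 ≠ 0 := sub_ne_zero.2 hs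
    rw [hQ, mul_add, mul_div_cancel₀ _ (pow_ne_zero _ hne), Finset.sum_range_succ', pow_zero,
      mul_one, hb, add_comm]
    congr 1
    rw [Finset.mul_sum]
    refine Finset.sum_nbij' (fun k => n - k) (fun i => n - i) ?_ ?_ ?_ ?_ ?_
    · intro k hk; simp only [Finset.mem_Icc, Finset.mem_range] at *; omega
    · intro k hk; simp only [Finset.mem_Icc, Finset.mem_range] at *; omega
    · intro k hk; simp only [Finset.mem_Icc] at hk; omega
    · intro k hk; simp only [Finset.mem_range] at hk; omega
    · intro k hk
      simp only [Finset.mem_Icc] at hk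
      have e1 : n + 1 - k = n - k + 1 := by omega
      have e2 : 1 + n = (n - k + 1) + k := by omega
      rw [e1, e2, pow_add]
      field_simp
  -- The value of `G` at `1` carries no information, so there the regular part is given the value of
  -- the Taylor remainder of `K`.
  refine ⟨fun s => if s = 1 then r 1 else G s - Q s, fun k => b (n + 1 - k), fun s hs => ?_,
    fun s hs => ?_⟩
  · rcases eq_or_ne s 1 with rfl | hs1
    · refine hr.congr ?_
      have h1 : ∀ᶠ s in 𝓝 (1 : ℂ), s ≠ 1 → (s - 1) ^ (1 + n) * G s = K s :=
        eventually_nhdsWithin_iff.1 h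
      filter_upwards [h1] with s h2
      split_ifs with h3
      · rw [h3]
      · have h4 := h2 h3
        have h5 : (s - 1) ^ (1 + n) ≠ 0 := pow_ne_zero _ (sub_ne_zero.2 h3)
        refine mul_left_cancel₀ h5 ?_
        rw [mul_sub, h4, hQs s h3, hKr s, add_comm n 1]
        ring
    · have hQa : AnalyticAt ℂ Q s := by
        have hpow : ∀ m : ℕ, AnalyticAt ℂ (fun s : ℂ => (s - 1) ^ m) s := fun m =>
          (analyticAt_id.sub analyticAt_const).pow m
        have hne : ∀ m : ℕ, (s - 1) ^ m ≠ 0 := fun m => pow_ne_zero _ (sub_ne_zero.2 hs1)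
        refine (analyticAt_const.div (hpow _) (hne _)).add ?_
        exact Finset.analyticAt_fun_sum _ fun k _ => analyticAt_const.div (hpow _) (hne _)
      refine ((hG s hs hs1).sub hQa).congr ?_
      filter_upwards [isOpen_ne.mem_nhds hs1] with t ht
      rw [if_neg ht]; rfl
  · simp only [if_neg hs]
    rw [hQ]
    ring

/-! ### The pole of the resolvent at `s = 1` -/

/-- On the range of `P` the operator acts as the scalar `1 - l`, on the range of `1 - P` as `1 - N`;
the inverse is assembled from the two blocks. -/
theorem inverse_of_splitting {A : Type*} [Ring A] [Algebra ℂ A] {P N : A} {l : ℂ}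
    (hPN : P * N = 0) (hNP : N * P = 0) (hP : P * P = P) (hu : IsUnit (1 - N)) (hl : l ≠ 1) :
    IsUnit (1 - (l • P + N)) ∧
      Ring.inverse (1 - (l • P + N)) = (1 - l)⁻¹ • P + Ring.inverse (1 - N) * (1 - P) := by
  set R := Ring.inverse (1 - N) with hR
  have h1 : (1 - N) * R = 1 := Ring.mul_inverse_cancel _ hu
  have h2 : R * (1 - N) = 1 := Ring.inverse_mul_cancel _ hu
  have hPR : P * R = P := by
    calc P * R = (P * (1 - N)) * R := by rw [mul_sub, mul_one, hPN, sub_zero]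
      _ = P := by rw [mul_assoc, h1, mul_one]
  have hRP : R * P = P := by
    calc R * P = R * ((1 - N) * P) := by rw [sub_mul, one_mul, hNP, sub_zero]
      _ = P := by rw [← mul_assoc, h2, one_mul]
  have hl' : 1 - l ≠ 0 := sub_ne_zero.2 hl.symm
  have hsm : (1 - l)⁻¹ • P - (1 - l)⁻¹ • l • P = P := by
    rw [← smul_sub]
    have : P - l • P = (1 - l) • P := by rw [sub_smul, one_smul]
    rw [this, smul_smul, inv_mul_cancel₀ hl', one_smul]
  have h3 : (1 - (l • P + N)) * ((1 - l)⁻¹ • P + R * (1 - P)) = 1 := by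
    have e1 : (1 - (l • P + N)) * ((1 - l)⁻¹ • P) = P := by
      rw [sub_mul, one_mul, add_mul, mul_smul_comm, smul_mul_assoc, hP, mul_smul_comm, hNP,
        smul_zero, add_zero, hsm]
    have e2 : (1 - (l • P + N)) * (R * (1 - P)) = 1 - P := by
      have : 1 - (l • P + N) = (1 - N) - l • P := by abel
      rw [this, sub_mul, ← mul_assoc, h1, one_mul, ← mul_assoc, smul_mul_assoc, hPR, smul_mul_assoc,
        mul_sub, mul_one, hP, sub_self, smul_zero, sub_zero]
    rw [mul_add, e1, e2, add_sub_cancel]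
  have h4 : ((1 - l)⁻¹ • P + R * (1 - P)) * (1 - (l • P + N)) = 1 := by
    have e1 : ((1 - l)⁻¹ • P) * (1 - (l • P + N)) = P := by
      rw [mul_sub, mul_one, mul_add, smul_mul_assoc, mul_smul_comm, hP, smul_mul_assoc, hPN,
        smul_zero, add_zero, hsm]
    have e2 : R * (1 - P) * (1 - (l • P + N)) = 1 - P := by
      have : (1 - P) * (1 - (l • P + N)) = (1 - N) - P := by
        rw [mul_sub, mul_one, mul_add, sub_mul, sub_mul, one_mul, one_mul, mul_smul_comm, hP, hPN]
        abel
      rw [mul_assoc, this, mul_sub, h2, hRP]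
    rw [add_mul, e1, e2, add_sub_cancel]
  exact ⟨⟨⟨_, _, h3, h4⟩, rfl⟩, Ring.inverse_unit ⟨_, _, h3, h4⟩⟩

theorem isUnit_one_sub_of_spectralRadius_lt {N : HInf →L[ℂ] HInf} (h : spectralRadius ℂ N < 1) :
    IsUnit (1 - N) := by
  have h1 := spectrum.mem_resolventSet_of_spectralRadius_lt (k := (1 : ℂ)) (a := N) (by simpa using h)
  simpa [spectrum.mem_resolventSet_iff] using h1

/-- Multiplication by `1 - λ` removes the only singular part `(1 - λ)⁻¹ P` of the resolvent. The
regular part acquires the factor `1 - λ`, hence does not contribute at `(1, 0)`. -/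
theorem exists_resolvent_numerator {c : ℕ → ℝ} {M : ℝ} (hM : ∀ n, 1 ≤ n → |c n| ≤ M)
    {V : Set (ℂ × ℂ)} {lam : ℂ × ℂ → ℂ} {P N : ℂ × ℂ → (HInf →L[ℂ] HInf)}
    (h : IsSpectralDecomposition c V lam P N) :
    ∃ η : ℂ × ℂ → ℂ, AnalyticOnNhd ℂ η V ∧ η (1, 0) = value (opF c 1 0 (P (1, 0) oneH)) 0 ∧
      ∀ x ∈ V, lam x ≠ 1 → (1 - lam x) * resolventValue c x.1 x.2 = η x := by
  have hunit : ∀ x ∈ V, IsUnit (1 - N x) := fun x hx =>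
    isUnit_one_sub_of_spectralRadius_lt (h.N_radius x hx)
  refine ⟨fun x => value (opF c x.1 x.2 (P x oneH + (1 - lam x) •
    (Ring.inverse (1 - N x) * (1 - P x)) oneH)) 0, fun x hx => ?_, ?_, fun x hx hl => ?_⟩
  · have h1 : AnalyticAt ℂ (fun x => Ring.inverse (1 - N x)) x := by
      obtain ⟨U, hU⟩ := hunit x hx
      refine AnalyticAt.fun_comp (g := Ring.inverse) ?_
        (analyticAt_const.sub (h.N_analytic x hx))
      rw [← hU]
      exact analyticAt_inverse U
    have h2 : AnalyticAt ℂ (fun x => (Ring.inverse (1 - N x) * (1 - P x)) oneH) x :=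
      analyticAt_clm_apply (h1.mul (analyticAt_const.sub (h.P_analytic x hx))) analyticAt_const
    have h3 : AnalyticAt ℂ (fun x => P x oneH + (1 - lam x) •
        (Ring.inverse (1 - N x) * (1 - P x)) oneH) x :=
      (analyticAt_clm_apply (h.P_analytic x hx) analyticAt_const).add
        ((analyticAt_const.sub (h.lam_analytic x hx)).smul h2)
    have h4 := analyticAt_clm_apply (analyticAt_opF hM (h.re_gt x hx).2) h3
    exact AnalyticAt.comp (g := evalL 0) ((evalL 0).analyticAt _) h4
  · simp only [h.lam_one_zero, sub_self, zero_smul, add_zero]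
  · have hl' : 1 - lam x ≠ 0 := sub_ne_zero.2 hl.symm
    rw [resolventValue, h.decomp x hx, (inverse_of_splitting (h.P_comp_N x hx) (h.N_comp_P x hx)
      (h.P_idem x hx) (hunit x hx) hl).2, ← value_smul, ← map_smul, add_apply, smul_add, smul_apply,
      smul_smul, mul_inv_cancel₀ hl', one_smul]

theorem iteratedDeriv_const_sub_of_ne_zero {f : ℂ → ℂ} (a : ℂ) {j : ℕ} (hj : j ≠ 0) (x : ℂ) :
    iteratedDeriv j (fun ω => a - f ω) x = -iteratedDeriv j f x := by
  rw [iteratedDeriv_const_sub (Nat.pos_of_ne_zero hj), iteratedDeriv_neg]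

/-- The behaviour of the derivatives of the resolvent expression at `s = 1`. -/
theorem exists_resolventDeriv_pole {c : ℕ → ℝ} {M : ℝ} (hM : ∀ n, 1 ≤ n → |c n| ≤ M)
    (hμ : 0 < mean c) {V : Set (ℂ × ℂ)} {lam : ℂ × ℂ → ℂ} {P N : ℂ × ℂ → (HInf →L[ℂ] HInf)}
    (h : IsSpectralDecomposition c V lam P N) (p : ℕ) :
    ∃ K : ℂ → ℂ, AnalyticAt ℂ K 1 ∧
      (∀ᶠ s in 𝓝[≠] (1 : ℂ), (s - 1) ^ (1 + p / 2) * resolventDeriv c p s = K s) ∧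
      (Even p → K 1 = p.factorial *
        (iteratedDeriv 2 (fun ω : ℂ => lam (1, ω)) 0 / (2 * entropy)) ^ (p / 2) *
        (value (opF c 1 0 (P (1, 0) oneH)) 0 / entropy)) := by
  obtain ⟨η, hη, hη1, hηs⟩ := exists_resolvent_numerator hM h
  obtain ⟨hd0, -⟩ := lam_second_derivative_pos hM hμ h
  have hd1 := lam_deriv_fst hM h
  have hent : (entropy : ℂ) ≠ 0 := Complex.ofReal_ne_zero.2 entropy_pos.ne'
  set D : (ℂ × ℂ → ℂ) → ℕ → ℂ → ℂ := fun f j s => iteratedDeriv j (fun ω => f (s, ω)) 0 with hD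
  have hDa : ∀ {f : ℂ × ℂ → ℂ} {s : ℂ} (j : ℕ), AnalyticAt ℂ f (s, 0) → AnalyticAt ℂ (D f j) s :=
    fun {f s} j hf => AnalyticAt.comp
      (g := fun x : ℂ × ℂ => iteratedDeriv j (fun ω => f (x.1, ω)) x.2)
      (f := fun s : ℂ => (s, (0 : ℂ))) (analyticAt_iteratedDeriv_snd (H := fun s ω => f (s, ω)) hf j)
      (analyticAt_id.prod analyticAt_const)
  set E : ℂ × ℂ → ℂ := fun x => 1 - lam x with hE
  have hEa : AnalyticOnNhd ℂ E V := fun x hx => analyticAt_const.sub (h.lam_analytic x hx)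
  have hE0 : D E 0 1 = 0 := by simp [hD, hE, h.lam_one_zero]
  have hE1 : D E 1 1 = 0 := by
    simp only [hD, hE]
    rw [iteratedDeriv_const_sub_of_ne_zero 1 one_ne_zero, iteratedDeriv_one, hd0, neg_zero]
  have hE2 : D E 2 1 = -iteratedDeriv 2 (fun ω : ℂ => lam (1, ω)) 0 := by
    simp only [hD, hE]
    rw [iteratedDeriv_const_sub_of_ne_zero 1 two_ne_zero]
  have hEd : deriv (D E 0) 1 = entropy := by
    have e1 : D E 0 = fun s => 1 - lam (s, 0) := by
      funext s; simp [hD, hE]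
    have e2 := deriv_comp_const_add (f := fun s : ℂ => lam (s, 0)) 1 0
    rw [hd1, add_zero] at e2
    rw [e1, deriv_const_sub, ← e2, neg_neg]
  have htend : Tendsto (fun s : ℂ => (s, (0 : ℂ))) (𝓝 1) (𝓝 (1, 0)) :=
    (Continuous.prodMk_left (0 : ℂ)).tendsto 1
  have hV : ∀ᶠ s in 𝓝[≠] (1 : ℂ), (s, (0 : ℂ)) ∈ V :=
    (htend.eventually (h.isOpen.mem_nhds h.mem)).filter_mono nhdsWithin_le_nhds
  -- The zero of `1 - λ(s, 0)` at `s = 1` is simple, its derivative there being the positive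
  -- entropy.
  have hne : ∀ᶠ s in 𝓝[≠] (1 : ℂ), E (s, 0) ≠ 0 := by
    obtain ⟨e, he, he1, hes⟩ := exists_analyticAt_sub_mul (hDa 0 (hEa _ h.mem))
    have he0 : e 1 ≠ 0 := by rw [he1, hEd]; exact hent
    filter_upwards [(he.continuousAt.eventually_ne he0).filter_mono nhdsWithin_le_nhds,
      self_mem_nhdsWithin] with s h1 h2
    have h3 := hes s
    rw [hE0, zero_add] at h3
    have h4 : D E 0 s = E (s, 0) := by simp [hD]
    rw [← h4, h3]
    exact mul_ne_zero (sub_ne_zero.2 h2) h1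
  have key := exists_pole_coefficient (H := resolventDeriv c) (E := D E) (η := D η)
    (fun j => hDa j (hEa _ h.mem)) (fun j => hDa j (hη _ h.mem)) hE0 (by rw [hEd]; exact hent) hE1
    (fun p => ?_) p
  · obtain ⟨K, hK, hKs, hKe⟩ := key
    refine ⟨K, hK, hKs, fun hp => ?_⟩
    have e : D η 0 1 = η (1, 0) := by simp [hD]
    rw [hKe hp, hEd, hE2, neg_neg, e, hη1]
  · filter_upwards [hV, hne] with s hsV hsE
    have htend' : Tendsto (fun ω : ℂ => (s, ω)) (𝓝 0) (𝓝 (s, 0)) :=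
      (Continuous.prodMk_right s).tendsto 0
    have hlam : lam (s, 0) ≠ 1 := fun h => hsE (by simp [hE, h])
    have hunit : IsUnit (1 - opL c s 0) := by
      have h1 := (inverse_of_splitting (h.P_comp_N _ hsV) (h.N_comp_P _ hsV)
        (h.P_idem _ hsV) (isUnit_one_sub_of_spectralRadius_lt (h.N_radius _ hsV)) hlam).1
      rwa [← h.decomp _ hsV] at h1
    have hHa : AnalyticAt ℂ (resolventValue c s) 0 :=
      AnalyticAt.comp (g := fun x : ℂ × ℂ => resolventValue c x.1 x.2) (f := fun ω : ℂ => (s, ω))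
        (analyticAt_resolventValue hM (h.re_gt _ hsV).2 hunit) (analyticAt_const.prod analyticAt_id)
    have hEa' : AnalyticAt ℂ (fun ω => E (s, ω)) 0 :=
      AnalyticAt.comp (g := E) (f := fun ω : ℂ => (s, ω)) (hEa _ hsV)
        (analyticAt_const.prod analyticAt_id)
    -- For fixed `s ≠ 1` near `1`, the Leibniz rule applied to this identity in `ω` is the recursion
    -- required by `exists_pole_coefficient`.
    have hprod : (fun ω => E (s, ω) * resolventValue c s ω) =ᶠ[𝓝 0] fun ω => η (s, ω) := by
      filter_upwards [htend'.eventually (h.isOpen.mem_nhds hsV),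
        hEa'.continuousAt.eventually_ne hsE] with ω h1 h2
      exact hηs _ h1 fun h3 => h2 (by simp [hE, h3])
    rw [hD]
    simp only
    rw [← hprod.iteratedDeriv_eq, iteratedDeriv_fun_mul hEa'.contDiffAt hHa.contDiffAt]
    rfl

end EuclidCost

end

/-! ### Assembly of the theorem -/

theorem mainTheorem5 (c : ℕ → ℝ) (hc_nonneg : ∀ n, 1 ≤ n → 0 ≤ c n)
    (hc_bdd : ∃ M : ℝ, ∀ n, 1 ≤ n → c n ≤ M) (hc_ne : ∃ n, 1 ≤ n ∧ c n ≠ 0) :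
    (∃ V lam P N, EuclidCost.IsSpectralDecomposition c V lam P N) ∧
    ∀ V lam P N, EuclidCost.IsSpectralDecomposition c V lam P N →
      ∃ σ f₀ : ℝ, 0 < σ ∧ 0 < f₀ ∧
        (σ : ℂ) ^ 2 =
          2 * iteratedDeriv 2 (fun ω : ℂ => lam (1, ω)) 0 / (EuclidCost.entropy : ℂ) ∧
        (f₀ : ℂ) =
          EuclidCost.value (EuclidCost.opF c 1 0 (P (1, 0) EuclidCost.oneH)) 0 ∧
        ∀ p : ℕ,
          (∀ s : ℂ, 1 < s.re → Summable fun k : ℕ => ‖EuclidCost.dirichletTerm c p s k‖) ∧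
          (∃ G : ℂ → ℂ, AnalyticOnNhd ℂ G {s : ℂ | 1 ≤ s.re ∧ s ≠ 1} ∧
            (∀ s : ℂ, 1 < s.re → G s = EuclidCost.dirichletSeries c p s) ∧
            (Odd p → MeromorphicAt G 1 ∧
              ((-(((p + 1) / 2 : ℕ) : ℤ) : ℤ) : WithTop ℤ) ≤ meromorphicOrderAt G 1)) ∧
          (Even p → ∃ (R : ℂ → ℂ) (a : ℕ → ℂ),
            AnalyticOnNhd ℂ R {s : ℂ | 1 ≤ s.re} ∧
            ∀ s : ℂ, 1 < s.re → EuclidCost.dirichletSeries c p s =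
              (p.factorial : ℂ) * (σ : ℂ) ^ p * (f₀ : ℂ) /
                  (2 ^ p * (EuclidCost.entropy : ℂ) * (s - 1) ^ (1 + p / 2)) +
                ∑ k ∈ Finset.Icc 1 (p / 2), a k / (s - 1) ^ k + R s) := by
  obtain ⟨M, hM'⟩ := hc_bdd
  have hM : ∀ n, 1 ≤ n → |c n| ≤ M := fun n hn => by
    rw [abs_of_nonneg (hc_nonneg n hn)]; exact hM' n hn
  have hμ := EuclidCost.mean_pos hM hc_nonneg hc_ne
  refine ⟨EuclidCost.exists_isSpectralDecomposition hM, fun V lam P N h => ?_⟩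
  obtain ⟨-, v, hv, hlam⟩ := EuclidCost.lam_second_derivative_pos hM hμ h
  obtain ⟨f₀, hf₀, hf⟩ := EuclidCost.value_opF_pos hM h
  have hent := EuclidCost.entropy_pos
  have hent' : (EuclidCost.entropy : ℂ) ≠ 0 := Complex.ofReal_ne_zero.2 hent.ne'
  have hσ : ((Real.sqrt (2 * v / EuclidCost.entropy) : ℝ) : ℂ) ^ 2 =
      2 * v / EuclidCost.entropy := by
    rw [← Complex.ofReal_pow, Real.sq_sqrt (by positivity)]
    push_cast
    rfl
  refine ⟨Real.sqrt (2 * v / EuclidCost.entropy), f₀, Real.sqrt_pos.2 (by positivity), hf₀,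
    by rw [hσ, hlam], hf, fun p => ?_⟩
  obtain ⟨K, hK, hKs, hKe⟩ := EuclidCost.exists_resolventDeriv_pole hM hμ h p
  refine ⟨fun s hs => EuclidCost.summable_dirichletTerm hM p hs,
    ⟨EuclidCost.resolventDeriv c p,
      fun s hs => EuclidCost.analyticAt_resolventDeriv hM p hs.1 hs.2,
      fun s hs => (EuclidCost.dirichletSeries_eq_resolventDeriv hM p hs).symm, fun hp => ?_⟩,
    fun hp => ?_⟩
  · have e : (p + 1) / 2 = 1 + p / 2 := by
      obtain ⟨r, rfl⟩ := hp
      omega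
    rw [e]
    exact EuclidCost.meromorphicAt_of_pow_mul hK hKs
  · obtain ⟨R, a, hR, hRs⟩ := EuclidCost.exists_principal_part
      (U := {s : ℂ | 1 ≤ s.re}) (fun s hs hs1 => EuclidCost.analyticAt_resolventDeriv hM p hs hs1)
      hK hKs
    refine ⟨R, a, hR, fun s hs => ?_⟩
    have hs1 : s ≠ 1 := fun h => by rw [h] at hs; simp at hs
    rw [EuclidCost.dirichletSeries_eq_resolventDeriv hM p hs, hRs s hs1, hKe hp, hlam, ← hf]
    congr 2
    obtain ⟨r, rfl⟩ := hp
    rw [show (r + r) / 2 = r by omega, ← two_mul, pow_mul, pow_mul, hσ]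
    have hsne : (s - 1) ^ (1 + r) ≠ 0 := pow_ne_zero _ (sub_ne_zero.2 hs1)
    -- From `σ² = 2v / 𝔥` one has `σ² = 4 · v / (2𝔥)`, so `(v / 2𝔥)^r` equals `σ^{2r} / 2^{2r}`.
    have h4 : (2 * (v : ℂ) / EuclidCost.entropy) ^ r =
        (2 ^ 2) ^ r * ((v : ℂ) / (2 * EuclidCost.entropy)) ^ r := by
      rw [← mul_pow]
      congr 1
      field_simp
    have h5 : ((2 : ℂ) ^ 2) ^ r ≠ 0 := pow_ne_zero _ (by norm_num)
    rw [h4]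
    field_simp
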